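/- Let $k$ be a number field. A \emph{variety} over $k$ is an integral separated scheme of finite type over $k$. Let $V$ be a smooth projective variety over $k$ of dimension $n\ge 1$. Then there exist finitely many varieties $\tilde V_1,\dots,\tilde V_r$ over $k$, together with birational $k$-morphisms $\nu_i:\tilde V_i\to V$ (that is, for each $i$ there is an affine dense open subset of $V$ over which $\nu_i$ is an isomorphism) and proper flat $k$-morphisms $f_i:\tilde V_i\to\mathbb P^{n-1}_k$, such that: (1) for every $i$, the generic fiber of $f_i$ is a smooth irreducible curve $C_i$ over the function field $k(\mathbb P^{n-1})$; (2) for every choice of affine dense open subsets $U_i\subseteq V$ such that $\nu_i$ restricts to an isomorphism $\nu_i^{-1}(U_i)\to U_i$ $(1\le i\le r)$, setting $U:=\bigcap_i U_i$, the following holds: for every divisor $D\in\operatorname{Div}(V)$ with $D\cap U\ne\emptyset$ there exists an index $i$ such that $f_i(D')=\mathbb P^{n-1}$, where $D':=\overline{\nu_i^{-1}(D\cap U_i)}\subseteq\tilde V_i$ (closure in $\tilde V_i$). Here a divisor is identified with its support, the union of the prime divisors occurring in it with nonzero coefficient. -/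

import Mathlib

open CategoryTheory AlgebraicGeometry

universe u

namespace GeomFibration

noncomputable section

attribute [local instance] MvPolynomial.gradedAlgebra

/-- Projective space `ℙ^m` over a field `k`, as `Proj k[x₀, …, x_m]`. -/
abbrev ProjSpace (k : Type u) [Field k] (m : ℕ) : Scheme.{u} :=
  Proj (MvPolynomial.homogeneousSubmodule (Fin (m + 1)) k)

/-- The structure morphism `ℙ^m ⟶ Spec k`. -/
def ProjSpace.toSpec (k : Type u) [Field k] (m : ℕ) :
    ProjSpace k m ⟶ Spec (CommRingCat.of k) :=
  Proj.toSpecZero (MvPolynomial.homogeneousSubmodule (Fin (m + 1)) k) ≫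
    Spec.map (CommRingCat.ofHom
      (algebraMap k (MvPolynomial.homogeneousSubmodule (Fin (m + 1)) k 0)))

/-- Projective space is irreducible: the point given by the zero ideal is dense. -/
instance ProjSpace.irreducibleSpace (k : Type u) [Field k] (m : ℕ) :
    IrreducibleSpace (ProjSpace k m) := by
  let z : ProjectiveSpectrum (MvPolynomial.homogeneousSubmodule (Fin (m + 1)) k) :=
    { asHomogeneousIdeal := ⊥
      isPrime := by
        rw [HomogeneousIdeal.toIdeal_bot]
        exact Ideal.isPrime_bot
      not_irrelevant_le := by
        intro h
        have hX : (MvPolynomial.X 0 : MvPolynomial (Fin (m + 1)) k) ∈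
            HomogeneousIdeal.irrelevant (MvPolynomial.homogeneousSubmodule (Fin (m + 1)) k) := by
          rw [HomogeneousIdeal.mem_irrelevant_iff, GradedRing.proj_apply,
            DirectSum.decompose_of_mem_ne (i := 1) _
              ((MvPolynomial.mem_homogeneousSubmodule 1 _).2
                (MvPolynomial.isHomogeneous_X k 0)) one_ne_zero]
        have h0 := h hX
        rw [← HomogeneousIdeal.mem_iff, HomogeneousIdeal.toIdeal_bot, Ideal.mem_bot] at h0
        exact MvPolynomial.X_ne_zero 0 h0 }
  have hz : closure {z} = (Set.univ :
      Set (ProjectiveSpectrum (MvPolynomial.homogeneousSubmodule (Fin (m + 1)) k))) := by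
    refine Set.eq_univ_of_forall fun x => ?_
    rw [← ProjectiveSpectrum.le_iff_mem_closure]
    exact (bot_le : (⊥ : HomogeneousIdeal _) ≤ x.asHomogeneousIdeal)
  have hi : IsIrreducible (Set.univ :
      Set (ProjectiveSpectrum (MvPolynomial.homogeneousSubmodule (Fin (m + 1)) k))) := by
    rw [← hz]
    exact isIrreducible_singleton.closure
  exact (irreducibleSpace_def _).2 hi

/-- A variety over `k`: an integral separated scheme of finite type over `k`. -/
structure IsVariety {k : Type u} [Field k] {X : Scheme.{u}} (s : X ⟶ Spec (CommRingCat.of k)) :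
    Prop where
  isIntegral : IsIntegral X
  isSeparated : IsSeparated s
  locallyOfFiniteType : LocallyOfFiniteType s
  quasiCompact : QuasiCompact s

/-- `X` is projective over `k`: it is a closed subscheme of some projective space over `k`. -/
def IsProjective {k : Type u} [Field k] {X : Scheme.{u}} (s : X ⟶ Spec (CommRingCat.of k)) :
    Prop :=
  ∃ (N : ℕ) (j : X ⟶ ProjSpace k N), IsClosedImmersion j ∧ j ≫ ProjSpace.toSpec k N = s

/-- `U` is an affine dense open subset of `V` over which `ν : W ⟶ V` is an isomorphism,
i.e. `ν` restricts to an isomorphism `ν⁻¹(U) ⟶ U`. -/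
structure IsAffineIsoOpen {W V : Scheme.{u}} (ν : W ⟶ V) (U : V.Opens) : Prop where
  isAffineOpen : IsAffineOpen U
  dense : Dense (U : Set V)
  isIso : IsIso (ν ∣_ U)

/-- The generic fiber of `f : W ⟶ Y` is a smooth irreducible curve over the residue field of the
generic point of `Y` (which is the function field when `Y` is integral). -/
structure GenericFiberIsSmoothIrreducibleCurve {W Y : Scheme.{u}} [IrreducibleSpace Y]
    (f : W ⟶ Y) : Prop where
  smooth : Smooth (f.fiberToSpecResidueField (genericPoint Y))
  irreducible : IrreducibleSpace (f.fiber (genericPoint Y))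
  dim_eq_one : topologicalKrullDim (f.fiber (genericPoint Y)) = 1

/-- A prime divisor, represented by its generic point: a point of codimension one. -/
abbrev PrimeDivisor (X : Scheme.{u}) : Type u := {x : X // Order.coheight x = 1}

/-- The group `Div(X)` of Weil divisors (used for Noetherian `X`): formal finite `ℤ`-linear
combinations of prime divisors. -/
abbrev WeilDivisor (X : Scheme.{u}) : Type u := PrimeDivisor X →₀ ℤ

/-- The closed subset underlying a divisor: the union of the prime divisors which occur in it
with nonzero coefficient. -/
def WeilDivisor.supp {X : Scheme.{u}} (D : WeilDivisor X) : Set X :=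
  ⋃ x ∈ D.support, closure {(x : X)}

/-- The proper transform of `D` along `ν`, computed from the open set `U`:
the closure of `ν⁻¹(D ∩ U)`. -/
def properTransform {W V : Scheme.{u}} (ν : W ⟶ V) (U : V.Opens) (D : WeilDivisor V) : Set W :=
  closure (ν ⁻¹' (D.supp ∩ (U : Set V)))

end

end GeomFibration

/-! Noether normalisation gives a finite surjective `p : V ⟶ ℙⁿ`
(`ProjSp.exists_isFinite_surjective`). It is flat by miracle flatness, `V` being smooth and `ℙⁿ`
regular (`flat_mvPolynomial_of_smooth`, `ProjSp.flat_of_isFinite`). In characteristic zero it is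
smooth over a nonempty open `O` (`exists_smooth_morphismRestrict`), and a linear change of
coordinates puts all `n + 1` coordinate points into `O` (`ProjSp.exists_linear_iso`).

For each coordinate point `Pᵢ` let `Bᵢ` be the blow-up of `ℙⁿ` at `Pᵢ`, realised as the closure of
the graph of the projection from `Pᵢ`. The resolved projection `Bᵢ ⟶ ℙⁿ⁻¹` is covered by affine
lines over affine opens of the base (`ProjSp.hasAffineLineCharts_blowupSnd`). The fibration is `Wᵢ =
V ×_{ℙⁿ} Bᵢ ⟶ Bᵢ ⟶ ℙⁿ⁻¹`. The first map is finite flat and the second smooth, so the composite is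
flat and its nonempty fibres have dimension one (`topologicalKrullDim_fiber_eq_one`). The map `Wᵢ ⟶
V` is an isomorphism away from the preimage of `Pᵢ`. By flatness the part of `Wᵢ` lying there is
schematically dense, hence `Wᵢ` is integral (`isIntegral_of_isPullback`).

The generic fibre is smooth for two reasons (`IsFibrationDatum.mem_smoothLocus`). Above `Pᵢ` the map
`Wᵢ ⟶ Bᵢ` is smooth because `Pᵢ ∈ O`. Elsewhere `Wᵢ` is locally an open piece of the smooth variety
`V`, and generic smoothness applies (`formallySmooth_of_field`).

For the divisors, let `y` be the generic point of a component of `D` meeting `U`. By flatness `p y`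
has no generisation other than itself and the generic point. In an affine chart its prime is
therefore zero or generated by one irreducible polynomial, which involves some variable `xᵢ`. No
nonzero polynomial free of `xᵢ` lies in that prime, so projection from `Pᵢ` sends `p y` to the
generic point of `ℙⁿ⁻¹` (`ProjSp.exists_proj_eq_genericPoint`). Since `fᵢ` is closed, it maps the
proper transform onto `ℙⁿ⁻¹`. -/

namespace GeomFibration

/-! ### Regular sequences over a Noetherian local ring: exchange, and systems of parameters -/

section RegularSequences

open RingTheory.Sequence IsLocalRing Pointwise

variable {R : Type*} [CommRing R] [IsLocalRing R] [IsNoetherianRing R]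

/-- An element of the maximal ideal that is regular on two modules, as soon as the maximal ideal
consists of zero divisors on neither of them. -/
lemma exists_mem_maximalIdeal_isSMulRegular_and (M N : Type*) [AddCommGroup M] [Module R M]
    [Module.Finite R M] [AddCommGroup N] [Module R N] [Module.Finite R N]
    (hM : maximalIdeal R ∉ associatedPrimes R M) (hN : maximalIdeal R ∉ associatedPrimes R N) :
    ∃ z ∈ maximalIdeal R, IsSMulRegular M z ∧ IsSMulRegular N z := by
  by_contra! h
  have hfin : (associatedPrimes R M ∪ associatedPrimes R N).Finite :=
    (associatedPrimes.finite R M).union (associatedPrimes.finite R N)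
  have hsub : (maximalIdeal R : Set R) ⊆
      ⋃ p ∈ associatedPrimes R M ∪ associatedPrimes R N, (p : Set R) := by
    intro z hz
    rw [Set.biUnion_union, biUnion_associatedPrimes_eq_compl_regular,
      biUnion_associatedPrimes_eq_compl_regular]
    by_cases hzM : IsSMulRegular M z
    · exact Or.inr (h z hz hzM)
    · exact Or.inl hzM
  obtain ⟨p, hp, hle⟩ := (Ideal.subset_union_prime_finite hfin ⊤ ⊤ (f := id)
    (fun p hp _ _ => hp.elim (fun h => h.1) fun h => h.1)).1 hsub
  have hpp : p.IsPrime := hp.elim (fun h => h.1) fun h => h.1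
  have : p = maximalIdeal R := le_antisymm (le_maximalIdeal hpp.ne_top) hle
  subst this
  exact hp.elim hM hN

omit [IsLocalRing R] in
lemma notMem_of_isSMulRegular_of_mem_associatedPrimes {M : Type*} [AddCommGroup M]
    [Module R M] {z : R} {p : Ideal R} (hp : p ∈ associatedPrimes R M) (h : IsSMulRegular M z) :
    z ∉ p := by
  intro hz
  have : z ∈ ⋃ p ∈ associatedPrimes R M, (p : Set R) := Set.mem_biUnion hp hz
  rw [biUnion_associatedPrimes_eq_compl_regular] at this
  exact this h

lemma maximalIdeal_mem_associatedPrimes_iff {M : Type*} [AddCommGroup M] [Module R M] :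
    maximalIdeal R ∈ associatedPrimes R M ↔
      ∃ x : M, x ≠ 0 ∧ ∀ r ∈ maximalIdeal R, r • x = 0 := by
  rw [AssociatedPrimes.mem_iff, isAssociatedPrime_iff]
  constructor
  · rintro ⟨hp, x, hx⟩
    refine ⟨x, ?_, fun r hr => ?_⟩
    · rintro rfl
      apply hp.ne_top
      rw [hx]
      ext; simp [Submodule.mem_colon_singleton]
    · rw [hx] at hr
      simpa [Submodule.mem_colon_singleton] using hr
  · rintro ⟨x, hx, h⟩
    refine ⟨inferInstance, x, le_antisymm (fun r hr => ?_) (le_maximalIdeal fun ht => hx ?_)⟩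
    · simpa [Submodule.mem_colon_singleton] using h r hr
    · have : (1 : R) ∈ (⊥ : Submodule R M).colon {x} := ht ▸ Submodule.mem_top
      simpa [Submodule.mem_colon_singleton] using this

/-- Whether the maximal ideal consists of zero divisors on `M / xM` does not depend on the regular
element `x`. -/
lemma maximalIdeal_notMem_associatedPrimes_quotSMulTop {M : Type*} [AddCommGroup M] [Module R M]
    {x y : R} (hx : IsSMulRegular M x) (hy : IsSMulRegular M y)
    (hxm : x ∈ maximalIdeal R)
    (h : maximalIdeal R ∉ associatedPrimes R (QuotSMulTop x M)) :
    maximalIdeal R ∉ associatedPrimes R (QuotSMulTop y M) := by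
  contrapose! h
  rw [maximalIdeal_mem_associatedPrimes_iff] at h ⊢
  obtain ⟨m, hm0, hm⟩ := h
  obtain ⟨m, rfl⟩ := Submodule.Quotient.mk_surjective _ m
  have key : ∀ r ∈ maximalIdeal R, ∃ n : M, y • n = r • m := fun r hr => by
    have := hm r hr
    rw [← Submodule.Quotient.mk_smul, Submodule.Quotient.mk_eq_zero,
      Submodule.mem_smul_pointwise_iff_exists] at this
    obtain ⟨n, -, hn⟩ := this
    exact ⟨n, hn⟩
  -- The relation `y • m₁ = x • m` transports the socle element `m` of `M / yM` to `m₁` in `M / xM`;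
  -- it stays nonzero because `m₁ ∈ xM` would force `m ∈ yM`.
  obtain ⟨m₁, hm₁⟩ := key x hxm
  refine ⟨Submodule.Quotient.mk m₁, fun h0 => hm0 ?_, fun r hr => ?_⟩
  · rw [Submodule.Quotient.mk_eq_zero, Submodule.mem_smul_pointwise_iff_exists] at h0 ⊢
    obtain ⟨n, -, rfl⟩ := h0
    exact ⟨n, trivial, hx (by simp only; rw [← hm₁, smul_comm])⟩
  · obtain ⟨n, hn⟩ := key r hr
    rw [← Submodule.Quotient.mk_smul, Submodule.Quotient.mk_eq_zero,
      Submodule.mem_smul_pointwise_iff_exists]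
    refine ⟨n, trivial, hy ?_⟩
    simp only
    rw [smul_comm y x, hn, smul_comm x r, ← hm₁, smul_comm r y]

/-- Exchange: a regular element can be completed to a weakly regular sequence of any length that
occurs. -/
lemma exists_isWeaklyRegular_quotSMulTop (d : ℕ) : ∀ {M : Type*} [AddCommGroup M] [Module R M]
    [Module.Finite R M] {rs : List R} (_ : IsWeaklyRegular M rs) (_ : rs.length = d + 1)
    (_ : ∀ r ∈ rs, r ∈ maximalIdeal R) {y : R} (_ : IsSMulRegular M y) (_ : y ∈ maximalIdeal R),
    ∃ ss : List R, ss.length = d ∧ (∀ r ∈ ss, r ∈ maximalIdeal R) ∧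
      IsWeaklyRegular (QuotSMulTop y M) ss := by
  induction d with
  | zero => intro M _ _ _ rs _ _ _ y _ _; exact ⟨[], rfl, by simp, IsWeaklyRegular.nil R _⟩
  | succ d ih =>
    intro M _ _ _ rs hrs hlen hmem y hy hym
    obtain ⟨x, x₂, t, rfl⟩ : ∃ x x₂ t, rs = x :: x₂ :: t := by
      match rs, hlen with
      | x :: x₂ :: t, _ => exact ⟨x, x₂, t, rfl⟩
    obtain ⟨hx, hrs'⟩ := (isWeaklyRegular_cons_iff M x _).1 hrs
    have hx₂ := ((isWeaklyRegular_cons_iff _ x₂ _).1 hrs').1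
    have hxm := hmem x (by simp)
    have hAx : maximalIdeal R ∉ associatedPrimes R (QuotSMulTop x M) := fun h =>
      notMem_of_isSMulRegular_of_mem_associatedPrimes h hx₂ (hmem x₂ (by simp))
    -- An element `z` regular modulo both `x` and `y` mediates between them: induction on `M / xM`
    -- trades `x₂` for `z`, a permutation brings `z` to the front, and induction on `M / zM` trades
    -- `x` for `y`.
    obtain ⟨z, hzm, hzx, hzy⟩ := exists_mem_maximalIdeal_isSMulRegular_and _ _ hAx
      (maximalIdeal_notMem_associatedPrimes_quotSMulTop hx hy hxm hAx)
    obtain ⟨ss, hss, hssm, hssr⟩ := ih hrs' (by simpa using hlen)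
      (fun r hr => hmem r (by simp_all)) hzx hzm
    have h1 : IsWeaklyRegular M (z :: x :: ss) :=
      isWeaklyRegular_of_perm_of_subset_maximalIdeal
        ((isWeaklyRegular_cons_iff M x _).2 ⟨hx, (isWeaklyRegular_cons_iff _ z _).2 ⟨hzx, hssr⟩⟩)
        (List.Perm.swap _ _ _) (by simp_all)
    obtain ⟨hz, h1'⟩ := (isWeaklyRegular_cons_iff M z _).1 h1
    have h2 : IsWeaklyRegular M [z, y] :=
      isWeaklyRegular_of_perm_of_subset_maximalIdeal
        ((isWeaklyRegular_cons_iff M y _).2 ⟨hy, (isWeaklyRegular_cons_iff _ z _).2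
          ⟨hzy, IsWeaklyRegular.nil R _⟩⟩)
        (List.Perm.swap _ _ _) (by simp_all)
    have hyz := ((isWeaklyRegular_cons_iff _ y _).1 ((isWeaklyRegular_cons_iff M z _).1 h2).2).1
    obtain ⟨ts, hts, htsm, htsr⟩ := ih h1' (by simp [hss]) (by simp_all) hyz hym
    have h3 : IsWeaklyRegular M (y :: z :: ts) :=
      isWeaklyRegular_of_perm_of_subset_maximalIdeal
        ((isWeaklyRegular_cons_iff M z _).2 ⟨hz, (isWeaklyRegular_cons_iff _ y _).2 ⟨hyz, htsr⟩⟩)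
        (List.Perm.swap _ _ _) (by simp_all)
    exact ⟨z :: ts, by simp [hts], by simp_all, ((isWeaklyRegular_cons_iff M y _).1 h3).2⟩

/-- Nakayama on the submodule `N` of elements killed by `p`: if `N ≤ xM`, regularity of `x` gives `N
≤ xN`, so `N = 0`, which is absurd. The class of an element of `N` outside `xM` is nonzero and
killed by `p` and by `x`, so any associated prime above its annihilator will do. -/
lemma exists_associatedPrime_quotSMulTop {M : Type*} [AddCommGroup M] [Module R M]
    [Module.Finite R M] {x : R} (hx : IsSMulRegular M x) (hxm : x ∈ maximalIdeal R)
    {p : Ideal R} (hp : p ∈ associatedPrimes R M) :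
    ∃ q ∈ associatedPrimes R (QuotSMulTop x M), p ≤ q ∧ x ∈ q := by
  obtain ⟨hpp, m, hm⟩ := isAssociatedPrime_iff.1 hp
  let N : Submodule R M :=
    { carrier := {n | ∀ r ∈ p, r • n = 0}
      add_mem' := fun {a b} ha hb r hr => by rw [smul_add, ha r hr, hb r hr, add_zero]
      zero_mem' := fun r _ => smul_zero r
      smul_mem' := fun c n hn r hr => by rw [smul_comm, hn r hr, smul_zero] }
  have hmN : m ∈ N := fun r hr => by
    rw [hm] at hr
    simpa [Submodule.mem_colon_singleton] using hr
  have hN : ¬ N ≤ x • (⊤ : Submodule R M) := by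
    intro hle
    have h1 : N ≤ Ideal.span {x} • N := by
      intro n hn
      obtain ⟨n', -, rfl⟩ := (Submodule.mem_smul_pointwise_iff_exists _ _ _).1 (hle hn)
      refine Submodule.smul_mem_smul (Ideal.mem_span_singleton_self x) fun r hr => hx ?_
      have := hn r hr
      simp only [smul_zero]
      rwa [smul_comm]
    have h0 := Submodule.eq_bot_of_le_smul_of_le_jacobson_bot (Ideal.span {x}) N
      (IsNoetherian.noetherian N) h1 (by
        rw [Ideal.span_singleton_le_iff_mem]
        exact maximalIdeal_le_jacobson _ hxm)
    have : m = 0 := by simpa [h0] using hmN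
    apply hpp.ne_top
    rw [hm, this]
    ext; simp [Submodule.mem_colon_singleton]
  obtain ⟨n, hnN, hn⟩ := Set.not_subset.1 hN
  have hne : (Submodule.Quotient.mk n : QuotSMulTop x M) ≠ 0 := by
    rwa [Ne, Submodule.Quotient.mk_eq_zero]
  obtain ⟨q, hq, hle⟩ := exists_le_isAssociatedPrime_of_isNoetherianRing R _ hne
  refine ⟨q, hq, fun r hr => hle ?_, hle ?_⟩
  · rw [Submodule.mem_colon_singleton, ← Submodule.Quotient.mk_smul, hnN r hr]
    simp
  · rw [Submodule.mem_colon_singleton, ← Submodule.Quotient.mk_smul, Submodule.mem_bot,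
      Submodule.Quotient.mk_eq_zero]
    exact Submodule.smul_mem_pointwise_smul _ _ _ trivial

/-- The dimension of `R / p` is at least the length of a weakly regular sequence when `p` is an
associated prime. -/
lemma length_le_ringKrullDim_quotient : ∀ (rs : List R) {M : Type*} [AddCommGroup M] [Module R M]
    [Module.Finite R M] (_ : IsWeaklyRegular M rs) (_ : ∀ r ∈ rs, r ∈ maximalIdeal R)
    {p : Ideal R} (_ : p ∈ associatedPrimes R M), (rs.length : WithBot ℕ∞) ≤ ringKrullDim (R ⧸ p) := by
  intro rs
  induction rs with
  | nil =>
    intro M _ _ _ _ _ p hp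
    have : Nontrivial (R ⧸ p) := Ideal.Quotient.nontrivial_iff.2 hp.1.ne_top
    simpa using ringKrullDim_nonneg_of_nontrivial (R := R ⧸ p)
  | cons x rs ih =>
    intro M _ _ _ hrs hmem p hp
    obtain ⟨hx, hrs'⟩ := (isWeaklyRegular_cons_iff M x _).1 hrs
    obtain ⟨q, hq, hpq, hxq⟩ := exists_associatedPrime_quotSMulTop hx (hmem x (by simp)) hp
    have h1 := ih hrs' (by simp_all) hq
    have : p.IsPrime := hp.1
    -- `x` is nonzero in the domain `R ⧸ p` but dies in `R ⧸ q`, so the dimension drops by at least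
    -- one.
    have h2 : ringKrullDim (R ⧸ q) + 1 ≤ ringKrullDim (R ⧸ p) := by
      refine ringKrullDim_succ_le_of_surjective (Ideal.Quotient.factor hpq)
        (Ideal.Quotient.factor_surjective hpq) (r := Ideal.Quotient.mk p x) ?_ ?_
      · rw [mem_nonZeroDivisors_iff_ne_zero, Ne, Ideal.Quotient.eq_zero_iff_mem]
        exact notMem_of_isSMulRegular_of_mem_associatedPrimes hp hx
      · simpa [Ideal.Quotient.eq_zero_iff_mem] using hxq
    refine le_trans ?_ h2
    push_cast [List.length_cons]
    gcongr

omit [IsNoetherianRing R] in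
-- Dividing by one element of the Jacobson radical lowers the dimension by at most one, and modulo
-- all of `ys` the ring `R ⧸ p` has dimension zero.
lemma ringKrullDim_quotient_le_length {p : Ideal R} [p.IsPrime] [IsNoetherianRing R]
    (ys : List R) (hys : ∀ y ∈ ys, y ∈ maximalIdeal R)
    (h : ∀ q : Ideal R, q.IsPrime → p ≤ q → (∀ y ∈ ys, y ∈ q) → q = maximalIdeal R) :
    ringKrullDim (R ⧸ p) ≤ ys.length := by
  classical
  let s : Finset (R ⧸ p) := (ys.map (Ideal.Quotient.mk p)).toFinset
  have : Nontrivial (R ⧸ p) := Ideal.Quotient.nontrivial_iff.2 (Ideal.IsPrime.ne_top ‹_›)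
  have : IsLocalRing (R ⧸ p) :=
    IsLocalRing.of_surjective' (Ideal.Quotient.mk p) Ideal.Quotient.mk_surjective
  have hsJ : (s : Set (R ⧸ p)) ⊆ Ring.jacobson (R ⧸ p) := by
    rw [ringJacobson_eq_maximalIdeal]
    intro z hz
    obtain ⟨y, hy, rfl⟩ : ∃ y ∈ ys, Ideal.Quotient.mk p y = z := by simpa [s] using hz
    have := IsLocalHom.of_surjective (Ideal.Quotient.mk p) Ideal.Quotient.mk_surjective
    exact (map_mem_nonunits_iff (Ideal.Quotient.mk p) y).2 (hys y hy)
  refine (ringKrullDim_le_ringKrullDim_quotient_add_card s hsJ).trans ?_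
  have h0 : ringKrullDim ((R ⧸ p) ⧸ Ideal.span (s : Set (R ⧸ p))) ≤ 0 := by
    rw [← Nat.cast_zero, ← Ring.krullDimLE_iff, Ring.krullDimLE_zero_iff]
    intro I hI
    let φ : R →+* (R ⧸ p) ⧸ Ideal.span (s : Set (R ⧸ p)) :=
      (Ideal.Quotient.mk _).comp (Ideal.Quotient.mk p)
    have hφ : Function.Surjective φ :=
      Ideal.Quotient.mk_surjective.comp Ideal.Quotient.mk_surjective
    have hq := h (I.comap φ) (hI.comap φ) (fun r hr => by
      rw [Ideal.mem_comap, RingHom.comp_apply, Ideal.Quotient.eq_zero_iff_mem.2 hr]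
      simp) (fun y hy => by
      rw [Ideal.mem_comap, RingHom.comp_apply, Ideal.Quotient.eq_zero_iff_mem.2]
      · simp
      · exact Ideal.subset_span (by simp only [s, List.coe_toFinset, List.mem_map]; exact ⟨y, hy, rfl⟩))
    have : (I.comap φ).IsMaximal := hq ▸ maximalIdeal.isMaximal R
    rw [← Ideal.map_comap_of_surjective φ hφ I]
    refine (Ideal.map_eq_top_or_isMaximal_of_surjective φ hφ this).resolve_left ?_
    rw [Ideal.map_comap_of_surjective φ hφ I]
    exact hI.ne_top
  calc _ ≤ (0 : WithBot ℕ∞) + (s.card : WithBot ℕ∞) := by gcongr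
    _ ≤ ys.length := by
      rw [zero_add]
      exact_mod_cast (List.toFinset_card_le _).trans (by simp)

/-- If `M` has a weakly regular sequence of length `d`, then any `d` elements of the maximal ideal
that cut the support of `M` down to the closed point form a weakly regular sequence. -/
lemma isWeaklyRegular_of_forall_eq_maximalIdeal : ∀ (ys : List R) {M : Type*} [AddCommGroup M]
    [Module R M] [Module.Finite R M] {rs : List R} (_ : IsWeaklyRegular M rs)
    (_ : rs.length = ys.length) (_ : ∀ r ∈ rs, r ∈ maximalIdeal R)
    (_ : ∀ y ∈ ys, y ∈ maximalIdeal R)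
    (_ : ∀ q : Ideal R, q.IsPrime → Module.annihilator R M ≤ q → (∀ y ∈ ys, y ∈ q) →
      q = maximalIdeal R), IsWeaklyRegular M ys := by
  intro ys
  induction ys with
  | nil => intros; exact IsWeaklyRegular.nil R _
  | cons y ys ih =>
    intro M _ _ _ rs hrs hlen hrm hym h
    -- If `y` were a zero divisor it would lie in an associated prime `p`. Then `dim R ⧸ p` is at
    -- least the length of `rs`, yet the elements after `y` already cut `R ⧸ p` down to the closed
    -- point, which bounds the dimension by one less.
    have hy : IsSMulRegular M y := by
      by_contra hy
      have : y ∈ ⋃ p ∈ associatedPrimes R M, (p : Set R) := by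
        rw [biUnion_associatedPrimes_eq_compl_regular]
        exact hy
      obtain ⟨p, hp, hyp⟩ := Set.mem_iUnion₂.1 this
      have hpp : p.IsPrime := hp.1
      have h1 := length_le_ringKrullDim_quotient rs hrs hrm hp
      have h2 := ringKrullDim_quotient_le_length (p := p) ys (by simp_all)
        (fun q hq hpq hqy => h q hq ((Submodule.annihilator_top (R := R) (M := M) ▸ hp.annihilator_le).trans hpq) (by
          intro z hz
          rcases List.mem_cons.1 hz with rfl | hz
          · exact hpq hyp
          · exact hqy z hz))
      have h3 := h1.trans h2
      rw [hlen] at h3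
      simp only [List.length_cons] at h3
      have : ys.length + 1 ≤ ys.length := by exact_mod_cast h3
      omega
    obtain ⟨ss, hss, hssm, hssr⟩ := exists_isWeaklyRegular_quotSMulTop ys.length hrs
      (by simpa using hlen) hrm hy (hym y (by simp))
    refine (isWeaklyRegular_cons_iff M y _).2 ⟨hy, ih hssr hss hssm (by simp_all) ?_⟩
    intro q hq hann hqy
    refine h q hq (le_trans ?_ hann) ?_
    · exact LinearMap.annihilator_le_of_surjective (Submodule.mkQ _) (Submodule.mkQ_surjective _)
    · intro z hz
      rcases List.mem_cons.1 hz with rfl | hz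
      · refine hann (Module.mem_annihilator.2 fun m => ?_)
        obtain ⟨m, rfl⟩ := Submodule.Quotient.mk_surjective _ m
        rw [← Submodule.Quotient.mk_smul, Submodule.Quotient.mk_eq_zero]
        exact Submodule.smul_mem_pointwise_smul _ _ _ trivial
      · exact hqy z hz

end RegularSequences

/-! ### Freeness from a regular sequence generating the maximal ideal -/

section Free

open RingTheory.Sequence IsLocalRing Pointwise

/-- A finite module over a Noetherian local ring is free as soon as some weakly regular sequence
generating the maximal ideal is weakly regular on the module. -/
lemma free_of_isWeaklyRegular (d : ℕ) : ∀ {A : Type u} [CommRing A] [IsLocalRing A]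
    [IsNoetherianRing A] {M : Type u} [AddCommGroup M] [Module A M] [Module.Finite A M]
    (ys : List A) (_ : ys.length = d) (_ : Ideal.ofList ys = maximalIdeal A)
    (_ : IsWeaklyRegular A ys) (_ : IsWeaklyRegular M ys), Module.Free A M := by
  induction d with
  | zero =>
    intro A _ _ _ M _ _ _ ys hlen hmax _ _
    obtain rfl := List.length_eq_zero_iff.1 hlen
    rw [Ideal.ofList_nil] at hmax
    have hf : IsField A := isField_iff_maximalIdeal_eq.2 hmax.symm
    let := hf.toField
    exact Module.Free.of_divisionRing A M
  | succ d ih =>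
    intro A _ _ _ M _ _ _ ys hlen hmax hA hM
    obtain ⟨y, t, rfl⟩ : ∃ y t, ys = y :: t := by
      match ys, hlen with
      | y :: t, _ => exact ⟨y, t, rfl⟩
    have hym : y ∈ maximalIdeal A := hmax ▸ Ideal.subset_span (by simp)
    obtain ⟨hyA, hA'⟩ := (isWeaklyRegular_cons_iff' A y t).1 hA
    obtain ⟨hyM, hM'⟩ := (isWeaklyRegular_cons_iff' M y t).1 hM
    have : Nontrivial (A ⧸ Ideal.span {y}) := Ideal.Quotient.nontrivial_iff.2 (by
      rw [Ne, Ideal.span_singleton_eq_top]; exact hym)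
    have : IsLocalRing (A ⧸ Ideal.span {y}) :=
      IsLocalRing.of_surjective' (Ideal.Quotient.mk _) Ideal.Quotient.mk_surjective
    have : Module.Finite (A ⧸ Ideal.span {y}) (QuotSMulTop y M) :=
      Module.Finite.of_restrictScalars_finite A _ _
    have : Module.FinitePresentation A M := Module.finitePresentation_of_finite A M
    -- Freeness lifts along the quotient by an element of the Jacobson radical regular on `M`;
    -- modulo `y` the remaining elements again generate the maximal ideal.
    rw [← Module.free_quotSMulTop_iff_free A M (x := y) (maximalIdeal_le_jacobson _ hym) hyM]
    refine ih (t.map (Ideal.Quotient.mk (Ideal.span {y}))) (by simpa using hlen) ?_ ?_ hM'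
    · rw [← Ideal.map_ofList]
      have : maximalIdeal (A ⧸ Ideal.span {y}) =
          (maximalIdeal A).map (Ideal.Quotient.mk (Ideal.span {y})) := by
        exact (IsLocalRing.map_maximalIdeal_of_surjective _ Ideal.Quotient.mk_surjective).symm
      rw [this, ← hmax, Ideal.ofList_cons, Ideal.map_sup, Ideal.map_quotient_self]
      simp
    · have e : QuotSMulTop y A ≃ₗ[A ⧸ Ideal.span {y}] (A ⧸ Ideal.span {y}) :=
        (Submodule.quotEquivOfEq _ _ (by simp [← Submodule.ideal_span_singleton_smul])).extendScalarsOfSurjective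
          Ideal.Quotient.mk_surjective
      exact (e.isWeaklyRegular_congr _).1 hA'

end Free

end GeomFibration

namespace GeomFibration

/-! ### Maximal ideals of polynomial rings are generated by regular sequences -/

section RegularSequencesInPolynomialRings

open RingTheory.Sequence IsLocalRing Pointwise Polynomial

lemma exists_isWeaklyRegular_of_ringEquiv {R S : Type*} [CommRing R] [CommRing S] (e : R ≃+* S)
    (n : ℕ)
    (h : ∀ m : Ideal R, m.IsMaximal →
      ∃ rs : List R, rs.length = n ∧ IsWeaklyRegular R rs ∧ Ideal.ofList rs = m)
    (m : Ideal S) (hm : m.IsMaximal) :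
    ∃ rs : List S, rs.length = n ∧ IsWeaklyRegular S rs ∧ Ideal.ofList rs = m := by
  obtain ⟨rs, hlen, hrs, hm'⟩ := h (m.comap e) (Ideal.comap_isMaximal_of_equiv e)
  refine ⟨rs.map e, by simpa using hlen, ?_, ?_⟩
  · exact (e.toAddEquiv.isWeaklyRegular_congr (M := R) (M₂ := S) (by
      rw [List.forall₂_map_right_iff, List.forall₂_same]
      intro r _ x
      simp)).1 hrs
  · rw [show rs.map e = rs.map (e : R →+* S) from rfl, ← Ideal.map_ofList, hm']
    exact Ideal.map_comap_of_surjective _ e.surjective m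

/-- Over a Jacobson ring `m` contracts to a maximal ideal of `R`. The sequence generating the
contraction stays regular in `R[X]` by flatness. Modulo it `m` is generated by a monic polynomial
over the residue field, and a monic polynomial is a nonzerodivisor. -/
lemma exists_isWeaklyRegular_polynomial {R : Type*} [CommRing R] [IsJacobsonRing R] (n : ℕ)
    (h : ∀ m : Ideal R, m.IsMaximal →
      ∃ rs : List R, rs.length = n ∧ IsWeaklyRegular R rs ∧ Ideal.ofList rs = m)
    (m : Ideal R[X]) (hm : m.IsMaximal) :
    ∃ rs : List R[X], rs.length = n + 1 ∧ IsWeaklyRegular R[X] rs ∧ Ideal.ofList rs = m := by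
  have hq : (m.comap (C : R →+* R[X])).IsMaximal :=
    Polynomial.isMaximal_comap_C_of_isJacobsonRing m
  obtain ⟨rs, hlen, hrs, hq'⟩ := h _ hq
  -- If `m` were extended from `R`, the polynomial ring over the residue field would itself be a
  -- field.
  have hne : m ≠ (m.comap (C : R →+* R[X])).map C := by
    intro he
    let := Ideal.Quotient.field (m.comap (C : R →+* R[X]))
    let φ := mapRingHom (Ideal.Quotient.mk (m.comap (C : R →+* R[X])))
    have hφ : Function.Surjective φ := map_surjective _ Ideal.Quotient.mk_surjective
    have hker : RingHom.ker φ = m :=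
      (by simp only [φ, Polynomial.ker_mapRingHom, Ideal.mk_ker] :
        RingHom.ker φ = (m.comap (C : R →+* R[X])).map C).trans he.symm
    have hmax : (RingHom.ker φ).IsMaximal := by rw [hker]; exact hm
    have : IsField (R ⧸ m.comap (C : R →+* R[X]))[X] :=
      (RingHom.quotientKerEquivOfSurjective hφ).symm.toMulEquiv.isField
        ((Ideal.Quotient.maximal_ideal_iff_isField_quotient _).1 hmax)
    exact Polynomial.not_isField _ this
  obtain ⟨f, hf, hmf⟩ := exists_monic_span_sup_map_eq R m hq hne
  have hofList : Ideal.ofList (rs.map (C : R →+* R[X])) = (m.comap (C : R →+* R[X])).map C := by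
    rw [← Ideal.map_ofList, hq']
  refine ⟨rs.map (C : R →+* R[X]) ++ [f], by simpa using hlen, ?_, ?_⟩
  · rw [isWeaklyRegular_append_iff]
    refine ⟨hrs.of_flat (S := R[X]), ?_⟩
    rw [isWeaklyRegular_singleton_iff, isSMulRegular_quotient_iff_mem_of_smul_mem, hofList]
    intro x hx
    simp only [smul_eq_mul, Ideal.mul_top] at hx ⊢
    have hk : (m.comap (C : R →+* R[X])).map C =
        RingHom.ker (mapRingHom (Ideal.Quotient.mk (m.comap (C : R →+* R[X])))) := by
      rw [Polynomial.ker_mapRingHom, Ideal.mk_ker]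
    rw [hk, RingHom.mem_ker] at hx ⊢
    rw [map_mul] at hx
    exact ((hf.map _).mul_right_eq_zero_iff).1 hx
  · rw [Ideal.ofList_append, hofList, Ideal.ofList_singleton, ← hmf]

/-- Maximal ideals of a polynomial ring in `n` variables over a field are generated by regular
sequences of length `n`. -/
lemma exists_isWeaklyRegular_mvPolynomial (k : Type*) [Field k] (n : ℕ) :
    ∀ m : Ideal (MvPolynomial (Fin n) k), m.IsMaximal →
      ∃ rs : List (MvPolynomial (Fin n) k), rs.length = n ∧
        IsWeaklyRegular (MvPolynomial (Fin n) k) rs ∧ Ideal.ofList rs = m := by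
  induction n with
  | zero =>
    refine exists_isWeaklyRegular_of_ringEquiv (MvPolynomial.isEmptyRingEquiv k (Fin 0)).symm 0 ?_
    intro m hm
    refine ⟨[], rfl, IsWeaklyRegular.nil k k, ?_⟩
    rw [Ideal.ofList_nil]
    exact ((eq_bot_or_eq_top m).resolve_right hm.ne_top).symm
  | succ n ih =>
    exact exists_isWeaklyRegular_of_ringEquiv (MvPolynomial.finSuccEquiv k n).toRingEquiv.symm
      (n + 1) (exists_isWeaklyRegular_polynomial n ih)

end RegularSequencesInPolynomialRings

/-! ### Regular sequences can be checked at maximal ideals -/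

section LocalGlobal

open RingTheory.Sequence Pointwise TensorProduct

lemma isWeaklyRegular_of_forall_isMaximal {R : Type*} [CommRing R] : ∀ (rs : List R) {M : Type*}
    [AddCommGroup M] [Module R M]
    (_ : ∀ (Q : Ideal R) [Q.IsMaximal], IsWeaklyRegular (Localization.AtPrime Q ⊗[R] M)
      (rs.map (algebraMap R (Localization.AtPrime Q)))), IsWeaklyRegular M rs := by
  intro rs
  induction rs with
  | nil => intros; exact IsWeaklyRegular.nil R _
  | cons r rs ih =>
    intro M _ _ h
    refine (isWeaklyRegular_cons_iff M r rs).2 ⟨?_, ih fun Q hQ => ?_⟩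
    · refine IsSMulRegular.of_right_eq_zero_of_smul fun x hx => ?_
      refine Module.eq_zero_of_localization_maximal
        (fun Q _ => Localization.AtPrime Q ⊗[R] M)
        (fun Q _ => TensorProduct.mk R (Localization.AtPrime Q) M 1) x fun Q hQ => ?_
      have hr := ((isWeaklyRegular_cons_iff _ _ _).1 (h Q)).1
      refine hr.right_eq_zero_of_smul ?_
      rw [algebraMap_smul, ← map_smul, hx, map_zero]
    · have := ((isWeaklyRegular_cons_iff _ _ _).1 (h Q)).2
      exact ((QuotSMulTop.algebraMapTensorEquivTensorQuotSMulTop r M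
        (Localization.AtPrime Q)).isWeaklyRegular_congr _).1 this

end LocalGlobal

end GeomFibration

namespace GeomFibration

/-! ### Miracle flatness for a smooth domain finite over a polynomial ring -/

section MiracleFlatness

open RingTheory.Sequence IsLocalRing Pointwise TensorProduct

/-- The fibre of `Spec C` over the closed point of `A` consists of closed points, so `ys` cuts each
localisation `C_Q` down to its closed point. As `C_Q` carries some regular sequence of the same
length, `ys` is itself regular there, hence on `C`, and `free_of_isWeaklyRegular` applies. -/
lemma free_of_forall_exists_isWeaklyRegular {A C : Type u} [CommRing A] [IsLocalRing A]
    [IsNoetherianRing A] [CommRing C] [Algebra A C] [Module.Finite A C] (d : ℕ)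
    (ys : List A) (hlen : ys.length = d) (hys : Ideal.ofList ys = maximalIdeal A)
    (hA : IsWeaklyRegular A ys)
    (hC : ∀ (Q : Ideal C) [Q.IsMaximal], ∃ rs : List (Localization.AtPrime Q), rs.length = d ∧
      IsWeaklyRegular (Localization.AtPrime Q) rs ∧
      ∀ r ∈ rs, r ∈ maximalIdeal (Localization.AtPrime Q)) :
    Module.Free A C := by
  have : IsNoetherianRing C := IsNoetherianRing.of_finite A C
  refine free_of_isWeaklyRegular d ys hlen hys hA ?_
  rw [← isWeaklyRegular_map_algebraMap_iff C C ys]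
  refine isWeaklyRegular_of_forall_isMaximal _ fun Q hQ => ?_
  have hcomap : Q.comap (algebraMap A C) = maximalIdeal A :=
    eq_maximalIdeal (Ideal.isMaximal_comap_of_isIntegral_of_isMaximal Q)
  rw [LinearEquiv.isWeaklyRegular_congr
    (AlgebraTensorModule.rid C (Localization.AtPrime Q) (Localization.AtPrime Q))]
  obtain ⟨rs, hrs, hreg, hmem⟩ := hC Q
  refine isWeaklyRegular_of_forall_eq_maximalIdeal _ hreg (by simp [hrs, hlen]) hmem ?_ ?_
  · simp only [List.map_map, List.mem_map, forall_exists_index, and_imp]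
    rintro _ y hy rfl
    have : y ∈ Q.comap (algebraMap A C) := by
      rw [hcomap, ← hys]
      exact Ideal.subset_span hy
    simpa using (IsLocalization.AtPrime.to_map_mem_maximal_iff (Localization.AtPrime Q) Q _).2 this
  -- Such a `q` lies over the maximal ideal of `A`; by integrality its contraction to `C` is
  -- maximal, and being contained in `Q` it equals `Q`.
  · intro q hq _ hy
    have hle : maximalIdeal A ≤ (q.comap (algebraMap C _)).comap (algebraMap A C) := by
      rw [← hys, Ideal.ofList, Ideal.span_le]
      intro y hy'
      exact hy _ (List.mem_map_of_mem (List.mem_map_of_mem hy'))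
    have hmax : ((q.comap (algebraMap C _)).comap (algebraMap A C)).IsMaximal := by
      rw [← (maximalIdeal.isMaximal A).eq_of_le (Ideal.IsPrime.ne_top inferInstance) hle]
      infer_instance
    have hmax' : (q.comap (algebraMap C (Localization.AtPrime Q))).IsMaximal :=
      Ideal.isMaximal_of_isIntegral_of_isMaximal_comap _ hmax
    have hle' : q.comap (algebraMap C (Localization.AtPrime Q)) ≤ Q := by
      exact (Ideal.comap_mono (le_maximalIdeal hq.ne_top)).trans
        (IsLocalization.AtPrime.under_maximalIdeal (Localization.AtPrime Q) Q).le
    have := hmax'.eq_of_le hQ.ne_top hle'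
    rw [← IsLocalization.map_under Q.primeCompl _ q, Ideal.under_def, this,
      Localization.AtPrime.map_eq_maximalIdeal]

/-- Injectivity comes from flatness. The extension of fraction fields is unramified and essentially
of finite type, hence separable algebraic. -/
lemma isAlgebraic_of_etale {P E : Type*} [CommRing P] [IsDomain P] [CommRing E] [IsDomain E]
    [Algebra P E] [Algebra.Etale P E] : FaithfulSMul P E ∧ Algebra.IsAlgebraic P E := by
  have : Module.Flat P E := inferInstance
  have hinj : FaithfulSMul P E := by
    rw [faithfulSMul_iff_algebraMap_injective, injective_iff_map_eq_zero]
    intro a ha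
    by_contra h
    have : Module.IsTorsionFree P E := inferInstance
    have := smul_right_injective E h (show a • (1 : E) = a • 0 by
      rw [Algebra.smul_def, ha]; simp)
    exact one_ne_zero this
  refine ⟨hinj, ?_⟩
  let K := FractionRing P
  let L := FractionRing E
  let : Algebra K L := FractionRing.liftAlgebra P L
  have : Algebra.FormallyUnramified E L :=
    .of_isLocalization (nonZeroDivisors E)
  have : Algebra.FormallyUnramified P L := .comp P E L
  have : Algebra.FormallyUnramified K L := .of_restrictScalars P K L
  have : Algebra.EssFiniteType E L := .of_isLocalization _ (nonZeroDivisors E)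
  have : Algebra.EssFiniteType P L := .comp P E L
  have : Algebra.EssFiniteType K L := .of_comp P K L
  have : Algebra.IsSeparable K L := Algebra.FormallyUnramified.isSeparable K L
  have : Algebra.IsAlgebraic P L := 
    (IsFractionRing.comap_isAlgebraic_iff (A := P) (K := K) (C := L)).2 inferInstance
  exact Algebra.IsAlgebraic.of_injective (IsScalarTower.toAlgHom P E L) (IsFractionRing.injective E L)

/-- Near `Q` the algebra is étale over a polynomial ring `P`. The ideal of `P` below `Q` is maximal,
hence generated by a regular sequence of the right length, and flatness of `P → S` carries this
sequence to `S`. -/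
lemma exists_isWeaklyRegular_of_isSmooth {k B S : Type u} [Field k] [CommRing B] [IsDomain B]
    [Algebra k B] [Algebra.Smooth k B] (n : ℕ) (htr : Algebra.trdeg k B = n) (Q : Ideal B)
    [Q.IsMaximal] [CommRing S] [IsLocalRing S] [Algebra B S] [IsLocalization.AtPrime S Q] :
    ∃ rs : List S, rs.length = n ∧ IsWeaklyRegular S rs ∧ ∀ r ∈ rs, r ∈ maximalIdeal S := by
  obtain ⟨f, hf, m, _, _, _⟩ :=
    Algebra.IsSmoothAt.exists_isStandardEtale_mvPolynomial (R := k) (S := B) (p := Q)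
  have hf0 : f ≠ 0 := fun h => hf (h ▸ Q.zero_mem)
  have : IsDomain (Localization.Away f) :=
    IsLocalization.isDomain_localization (powers_le_nonZeroDivisors_of_noZeroDivisors hf0)
  obtain ⟨_, _⟩ := isAlgebraic_of_etale (P := MvPolynomial (Fin m) k) (E := Localization.Away f)
  have : FaithfulSMul B (Localization.Away f) :=
    (faithfulSMul_iff_algebraMap_injective _ _).2 (IsLocalization.injective _
      (powers_le_nonZeroDivisors_of_noZeroDivisors hf0))
  -- The étale extension and the localisation are both algebraic, so the number of étale coordinates
  -- is the transcendence degree of `B`.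
  have hm : m = n := by
    have h1 := _root_.lift_trdeg_add_eq k (MvPolynomial (Fin m) k) (Localization.Away f)
    have h2 := _root_.lift_trdeg_add_eq k B (Localization.Away f)
    have : Algebra.IsAlgebraic B (Localization.Away f) :=
      IsLocalization.isAlgebraic _ (.powers f)
    rw [_root_.trdeg_eq_zero (A := Localization.Away f), MvPolynomial.trdeg_of_isDomain] at h1
    rw [_root_.trdeg_eq_zero (R := B), htr, ← h1] at h2
    simpa using h2.symm
  subst hm
  let : Algebra (Localization.Away f) S := (IsLocalization.Away.lift f
    (g := algebraMap B S) (IsLocalization.map_units S (⟨f, hf⟩ : Q.primeCompl))).toAlgebra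
  have : IsScalarTower B (Localization.Away f) S := .of_algebraMap_eq fun x => by
    simp [RingHom.algebraMap_toAlgebra]
  let P := MvPolynomial (Fin m) k
  let : Algebra P S := ((algebraMap (Localization.Away f) S).comp
    (algebraMap P (Localization.Away f))).toAlgebra
  have : IsScalarTower P (Localization.Away f) S := .of_algebraMap_eq fun x => rfl
  let : Algebra k S := ((algebraMap B S).comp (algebraMap k B)).toAlgebra
  have : IsScalarTower k B S := .of_algebraMap_eq fun x => rfl
  have : IsScalarTower k (Localization.Away f) S := .to₁₃₄ k B _ S
  have : IsScalarTower k P S := .to₁₂₄ k P (Localization.Away f) S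
  have : Module.Flat B S := IsLocalization.flat S Q.primeCompl
  have : Module.Flat (Localization.Away f) S :=
    (Module.flat_iff_of_isLocalization (Localization.Away f) (.powers f) S).2 this
  have : Module.Flat P (Localization.Away f) := inferInstance
  have : Module.Flat P S := .trans P (Localization.Away f) S
  -- By the Nullstellensatz the residue field of `S` is finite over `k`, hence integral over `P`.
  have hpmax : ((maximalIdeal S).comap (algebraMap P S)).IsMaximal := by
    have hsurj : Function.Surjective (IsScalarTower.toAlgHom k B (ResidueField S)) := by
      intro x
      obtain ⟨y, rfl⟩ := (IsLocalization.AtPrime.equivQuotMaximalIdeal Q S).surjective x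
      obtain ⟨y, rfl⟩ := Ideal.Quotient.mk_surjective y
      exact ⟨y, rfl⟩
    have : Algebra.FiniteType k (ResidueField S) := .of_surjective _ hsurj
    have : Module.Finite k (ResidueField S) := finite_of_finite_type_of_isJacobsonRing _ _
    have : IsScalarTower k P (ResidueField S) := .to₁₂₄ k P S (ResidueField S)
    have : Algebra.IsIntegral P (ResidueField S) := .tower_top k
    have hker : (maximalIdeal S).comap (algebraMap P S) =
        (⊥ : Ideal (ResidueField S)).comap (algebraMap P (ResidueField S)) := by
      rw [IsScalarTower.algebraMap_eq P S (ResidueField S), ← Ideal.comap_comap,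
        ← RingHom.ker_eq_comap_bot, ResidueField.algebraMap_eq, ker_residue]
    rw [hker]
    have : (⊥ : Ideal (ResidueField S)).IsMaximal := Ideal.bot_isMaximal
    exact Ideal.isMaximal_comap_of_isIntegral_of_isMaximal _
  obtain ⟨rs, hlen, hreg, hrs⟩ := exists_isWeaklyRegular_mvPolynomial k m _ hpmax
  refine ⟨rs.map (algebraMap P S), by simpa using hlen, hreg.of_flat, ?_⟩
  simp only [List.mem_map, forall_exists_index, and_imp]
  rintro _ y hy rfl
  have : y ∈ (maximalIdeal S).comap (algebraMap P S) := by
    rw [← hrs]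
    exact Ideal.subset_span hy
  exact this

/-- Finiteness and injectivity force the transcendence degree of `B` to be `n`. At each maximal
ideal of the polynomial ring the base has a regular sequence of length `n` generating the maximal
ideal, and every local ring of `B` above it has a regular sequence of length `n`, so the localised
extension is free. -/
theorem flat_mvPolynomial_of_smooth {k B : Type u} [Field k] (n : ℕ) [CommRing B] [IsDomain B]
    [Algebra k B] [Algebra (MvPolynomial (Fin n) k) B] [IsScalarTower k (MvPolynomial (Fin n) k) B]
    [Algebra.Smooth k B] [Module.Finite (MvPolynomial (Fin n) k) B]
    [FaithfulSMul (MvPolynomial (Fin n) k) B] : Module.Flat (MvPolynomial (Fin n) k) B := by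
  have htr : Algebra.trdeg k B = n := by
    have h1 := _root_.trdeg_add_eq k (MvPolynomial (Fin n) k) (A := B)
    rw [_root_.trdeg_eq_zero (A := B), MvPolynomial.trdeg_of_isDomain] at h1
    simpa using h1.symm
  let A := MvPolynomial (Fin n) k
  refine Module.flat_of_isLocalized_maximal A B
    (fun p _ => Localization (Algebra.algebraMapSubmonoid B p.primeCompl))
    (fun p _ => (IsScalarTower.toAlgHom A B _).toLinearMap) fun p hp => ?_
  have hloc : Module.Free (Localization.AtPrime p)
      (Localization (Algebra.algebraMapSubmonoid B p.primeCompl)) := by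
    obtain ⟨ys, hlen, hreg, hys⟩ := exists_isWeaklyRegular_mvPolynomial k n p hp
    have : Module.Finite (Localization.AtPrime p)
      (Localization (Algebra.algebraMapSubmonoid B p.primeCompl)) :=
      .of_isLocalization A B p.primeCompl
    refine free_of_forall_exists_isWeaklyRegular n (ys.map (algebraMap A _)) (by simpa using hlen)
      ?_ hreg.of_flat fun Q hQ => ?_
    · rw [← Ideal.map_ofList, hys, Localization.AtPrime.map_eq_maximalIdeal]
    · have : IsLocalization.AtPrime (Localization.AtPrime Q) (Q.comap (algebraMap B _)) :=
        IsLocalization.isLocalization_isLocalization_atPrime_isLocalization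
          (Algebra.algebraMapSubmonoid B p.primeCompl) _ Q
      have : (Q.comap (algebraMap B _)).IsMaximal := by
        have h1 : Q.comap (algebraMap (Localization.AtPrime p) _) = maximalIdeal _ :=
          eq_maximalIdeal (Ideal.isMaximal_comap_of_isIntegral_of_isMaximal Q)
        have h2 : (Q.comap (algebraMap B _)).comap (algebraMap A B) = p := by
          rw [Ideal.comap_comap, ← IsScalarTower.algebraMap_eq,
            IsScalarTower.algebraMap_eq A (Localization.AtPrime p), ← Ideal.comap_comap, h1]
          exact IsLocalization.AtPrime.under_maximalIdeal _ p
        exact Ideal.isMaximal_of_isIntegral_of_isMaximal_comap (R := A) _ (by rwa [h2])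
      exact exists_isWeaklyRegular_of_isSmooth n htr (Q.comap (algebraMap B _))
  have : Module.Flat (Localization.AtPrime p) _ := .of_free (M := Localization (Algebra.algebraMapSubmonoid B p.primeCompl))
  exact .trans A (Localization.AtPrime p) _

end MiracleFlatness
end GeomFibration

namespace GeomFibration

/-! ### Generic smoothness in characteristic zero -/

section GenericSmoothness

open IsLocalRing TensorProduct KaehlerDifferential

/-- The splitting makes `Ω[R⁄K]` a direct summand of the projective module `Ω[R⁄k]`. Injectivity
kills the connecting map `δ`, so the first cotangent homology over `K` is a quotient of the one over
`k`, which vanishes. -/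
lemma formallySmooth_of_mapBaseChange_split (k K R : Type u) [CommRing k] [CommRing K] [CommRing R]
    [Algebra k K] [Algebra k R] [Algebra K R] [IsScalarTower k K R] [Algebra.FormallySmooth k R]
    (l : Ω[R⁄k] →ₗ[R] R ⊗[K] Ω[K⁄k]) (hl : l ∘ₗ mapBaseChange k K R = LinearMap.id) :
    Algebra.FormallySmooth K R := by
  rw [Algebra.formallySmooth_iff]
  have hinj : Function.Injective (mapBaseChange k K R) :=
    Function.HasLeftInverse.injective ⟨l, LinearMap.congr_fun hl⟩
  constructor
  · have tfae := Function.Exact.split_tfae (KaehlerDifferential.exact_mapBaseChange_map k K R) hinj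
      (KaehlerDifferential.map_surjective k K R)
    obtain ⟨s, hs⟩ := (tfae.out 0 1).2 (Exists.intro l hl)
    exact .of_split _ _ hs
  · have h1 : ∀ x, Algebra.H1Cotangent.δ k K R x = 0 := fun x => hinj (by
      rw [map_zero]; exact (Algebra.H1Cotangent.exact_δ_mapBaseChange k K R).apply_apply_eq_zero x)
    refine subsingleton_of_forall_eq 0 fun x => ?_
    obtain ⟨y, rfl⟩ := ((Algebra.H1Cotangent.exact_map_δ k K R) x).1 (h1 x)
    have : Subsingleton (Algebra.H1Cotangent k R) := inferInstance
    rw [Subsingleton.elim y 0, map_zero]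

/-- In characteristic zero, a local ring which is essentially smooth over `k` is formally smooth
over any field of finite type it contains. -/
theorem formallySmooth_of_field (k K R : Type u) [Field k] [CharZero k] [Field K] [CommRing R]
    [IsLocalRing R] [Algebra k K] [Algebra k R] [Algebra K R] [IsScalarTower k K R]
    [Algebra.EssFiniteType k K] [Algebra.EssFiniteType k R] [Algebra.FormallySmooth k R] :
    Algebra.FormallySmooth K R := by
  have : CharZero K := charZero_of_injective_algebraMap (algebraMap k K).injective
  have : Module.Projective R Ω[R⁄k] := ((Algebra.formallySmooth_iff k R).1 inferInstance).1
  have : Module.Free R Ω[R⁄k] := Module.free_of_flat_of_isLocalRing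
  have : Algebra.EssFiniteType K R := .of_comp k K R
  have : Algebra.EssFiniteType R (ResidueField R) :=
    RingHom.FiniteType.essFiniteType (RingHom.FiniteType.of_surjective (residue R) residue_surjective)
  have : Algebra.EssFiniteType K (ResidueField R) := .comp K R _
  have : Algebra.FormallySmooth K (ResidueField R) := .of_perfectField
  -- Characteristic zero enters here: `K` is perfect, so the residue field is formally smooth over
  -- `K` and the kernel, the image of its first cotangent homology, is zero.
  have hinj : Function.Injective (mapBaseChange k K (ResidueField R)) := by
    rw [injective_iff_map_eq_zero]
    intro x hx
    obtain ⟨y, rfl⟩ := ((Algebra.H1Cotangent.exact_δ_mapBaseChange k K (ResidueField R)) x).1 hx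
    have : Subsingleton (Algebra.H1Cotangent K (ResidueField R)) := inferInstance
    rw [Subsingleton.elim y 0, map_zero]
  -- Over a local ring, split injectivity is detected after tensoring with the residue field. There
  -- the map, followed by `mapBaseChange k R (ResidueField R)`, is identified with the injective map
  -- of `hinj`.
  obtain ⟨l, hl⟩ := (IsLocalRing.split_injective_iff_lTensor_residueField_injective
    (mapBaseChange k K R)).2 (by
      have hcomp : ∀ x, mapBaseChange k R (ResidueField R)
          ((mapBaseChange k K R).lTensor (ResidueField R) x) =
          mapBaseChange k K (ResidueField R)
            (AlgebraTensorModule.cancelBaseChange K R (ResidueField R) (ResidueField R) Ω[K⁄k] x) := by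
        intro x
        induction x with
        | zero => simp
        | add x y hx hy => simp only [map_add, hx, hy]
        | tmul a y =>
          induction y with
          | zero => simp
          | add x y hx hy => simp only [tmul_add, map_add, hx, hy]
          | tmul b z =>
            have hz : map k k R (ResidueField R) (map k k K R z) = map k k K (ResidueField R) z := by
              have hmem : z ∈ Submodule.span K (Set.range (KaehlerDifferential.D k K)) :=
                KaehlerDifferential.span_range_derivation k K ▸ trivial
              induction hmem using Submodule.span_induction with
              | zero => simp
              | add x y _ _ hx hy => simp only [map_add, hx, hy]
              | mem x hx =>
                obtain ⟨x, rfl⟩ := hx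
                rw [map_D, map_D, map_D, IsScalarTower.algebraMap_apply K R (ResidueField R)]
              | smul a x _ hx =>
                rw [map_smul (map k k K R), ← algebraMap_smul R a, map_smul (map k k R _),
                  algebraMap_smul, hx, map_smul (map k k K _)]
            simp only [LinearMap.lTensor_tmul, mapBaseChange_tmul, map_smul,
              AlgebraTensorModule.cancelBaseChange_tmul, hz]
            rw [smul_assoc, smul_comm]
      refine Function.Injective.of_comp (f := mapBaseChange k R (ResidueField R)) ?_
      have := hinj.comp (AlgebraTensorModule.cancelBaseChange K R (ResidueField R)
        (ResidueField R) Ω[K⁄k]).injective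
      convert this
      ext x
      exact hcomp x)
  exact formallySmooth_of_mapBaseChange_split k K R l hl

end GenericSmoothness
end GeomFibration

namespace GeomFibration

section GenericSmoothness

/-- Since `q` contracts to zero, the local ring at `q` contains the fraction field of `C`, over
which `formallySmooth_of_field` applies; passing to the fraction field is formally smooth over `C`.
-/
lemma formallySmooth_localization_of_comap_eq_bot (k C B : Type u) [Field k] [CharZero k]
    [CommRing C] [IsDomain C] [CommRing B] [Algebra k C] [Algebra k B] [Algebra C B]
    [IsScalarTower k C B] [Algebra.FiniteType k C] [Algebra.Smooth k B] (q : Ideal B) [q.IsPrime]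
    (hq : q.comap (algebraMap C B) = ⊥) :
    Algebra.FormallySmooth C (Localization.AtPrime q) := by
  let K := FractionRing C
  let R := Localization.AtPrime q
  have hu : ∀ c : nonZeroDivisors C, IsUnit (algebraMap C R c) := by
    intro c
    rw [IsScalarTower.algebraMap_apply C B R]
    refine IsLocalization.map_units R (⟨algebraMap C B c, fun h => ?_⟩ : q.primeCompl)
    have h' : (c : C) ∈ q.comap (algebraMap C B) := h
    rw [hq] at h'
    exact nonZeroDivisors.coe_ne_zero c h'
  let : Algebra K R := (IsLocalization.lift (M := nonZeroDivisors C) hu).toAlgebra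
  have : IsScalarTower C K R := .of_algebraMap_eq fun x => by
    simp [RingHom.algebraMap_toAlgebra]
  have : IsScalarTower k K R := .to₁₃₄ k C K R
  have : Algebra.EssFiniteType C K := .of_isLocalization _ (nonZeroDivisors C)
  have : Algebra.EssFiniteType k K := .comp k C K
  have : Algebra.EssFiniteType B R := .of_isLocalization _ q.primeCompl
  have : Algebra.EssFiniteType k R := .comp k B R
  have : Algebra.FormallySmooth B R := .of_isLocalization q.primeCompl
  have : Algebra.FormallySmooth k R := .comp k B R
  have : Algebra.FormallySmooth K R := formallySmooth_of_field k K R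
  have : Algebra.FormallySmooth C K := .of_isLocalization (nonZeroDivisors C)
  exact .comp C K R

/-- Smoothness at a point is read off on affine charts, where lying over the generic point means
that the prime of `x` contracts to zero. -/
lemma mem_smoothLocus_of_apply_eq_genericPoint {k : Type u} [Field k] [CharZero k]
    {X Y : Scheme.{u}} [IsIntegral Y] (f : X ⟶ Y) (s : Y ⟶ Spec (CommRingCat.of k))
    [LocallyOfFiniteType s] [Smooth (f ≫ s)] [LocallyOfFinitePresentation f] (x : X)
    (hx : f x = genericPoint Y) : x ∈ f.smoothLocus := by
  obtain ⟨_, ⟨U, hU, rfl⟩, hxU, -⟩ :=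
    Y.isBasis_affineOpens.exists_subset_of_mem_open (Set.mem_univ (f x)) isOpen_univ
  obtain ⟨_, ⟨V, hV, rfl⟩, hxV, hVU : V ≤ f ⁻¹ᵁ U⟩ :=
    X.isBasis_affineOpens.exists_subset_of_mem_open hxU (U.2.preimage f.continuous)
  rw [Scheme.Hom.mem_smoothLocus, formallySmooth_stalkMap_iff U hU V hV hVU hxV]
  have : Nonempty U := ⟨⟨_, hxU⟩⟩
  let := (f.appLE U V hVU).hom.toAlgebra
  have hUs : U ≤ s ⁻¹ᵁ ⊤ := le_top
  have hVs : V ≤ (f ≫ s) ⁻¹ᵁ ⊤ := le_top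
  let a : k →+* Γ(Y, U) := (s.appLE ⊤ U hUs).hom.comp (Scheme.ΓSpecIso (.of k)).inv.hom
  let := a.toAlgebra
  let : Algebra k Γ(X, V) := ((f.appLE U V hVU).hom.comp a).toAlgebra
  have : IsScalarTower k Γ(Y, U) Γ(X, V) := .of_algebraMap_eq fun _ => rfl
  have hiso : Function.Bijective (Scheme.ΓSpecIso (.of k)).inv.hom :=
    ConcreteCategory.bijective_of_isIso (Scheme.ΓSpecIso (.of k)).inv
  have : Algebra.FiniteType k Γ(Y, U) := by
    rw [← RingHom.finiteType_algebraMap]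
    exact (s.finiteType_appLE (isAffineOpen_top _) hU hUs).comp
      (.of_surjective _ hiso.surjective)
  have : Algebra.Smooth k Γ(X, V) := by
    rw [← RingHom.smooth_algebraMap]
    have h : (s.appLE ⊤ U hUs ≫ f.appLE U V hVU).hom.Smooth := by
      rw [Scheme.Hom.appLE_comp_appLE]
      exact (f ≫ s).smooth_appLE (isAffineOpen_top _) hV hVs
    exact RingHom.Smooth.comp (f := (Scheme.ΓSpecIso (.of k)).inv.hom) (.of_bijective hiso) h
  refine formallySmooth_localization_of_comap_eq_bot k Γ(Y, U) Γ(X, V) _ ?_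
  have h := congr($(IsAffineOpen.comap_primeIdealOf_appLE U hU V hV hVU hxV).1)
  have h2 : hU.primeIdealOf ⟨f x, hVU hxV⟩ = hU.primeIdealOf ⟨genericPoint Y, hx ▸ hVU hxV⟩ := by
    congr 2
  rw [h2, hU.primeIdealOf_genericPoint, genericPoint_eq_bot_of_affine] at h
  exact h

end GenericSmoothness
end GeomFibration

namespace GeomFibration

/-! ### Integrality of the pullback, and its generic fibre -/

section BaseChange

open Limits

lemma isIso_restrict_of_isPullback {W V Z Q : Scheme.{u}} {ν : W ⟶ V} {g : W ⟶ Z} {π : V ⟶ Q}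
    {b : Z ⟶ Q} (H : IsPullback ν g π b) (U : Q.Opens) (hU : IsIso (b ∣_ U)) :
    IsIso (ν ∣_ (π ⁻¹ᵁ U)) := by
  have h1 : IsPullback ((ν ⁻¹ᵁ π ⁻¹ᵁ U).ι ≫ g) (ν ∣_ (π ⁻¹ᵁ U)) b ((π ∣_ U) ≫ U.ι) := by
    rw [morphismRestrict_ι]
    exact (isPullback_morphismRestrict ν (π ⁻¹ᵁ U)).flip.paste_horiz H.flip
  exact (IsPullback.of_right' h1 (isPullback_morphismRestrict b U).flip).isIso_snd_of_isIso

/-- The open `b ⁻¹ᵁ U` is schematically dense in the integral scheme `Z`, and this persists under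
the flat base change `g`. Over it `W` is isomorphic to an open subscheme of `V`, so `W` inherits
reducedness and irreducibility. -/
lemma isIntegral_of_isPullback {W V Z Q : Scheme.{u}} {ν : W ⟶ V} {g : W ⟶ Z} {π : V ⟶ Q}
    {b : Z ⟶ Q} (H : IsPullback ν g π b) [Flat π] [IsIntegral V] [IsIntegral Z] (U : Q.Opens)
    [IsLocallyNoetherian Z]
    (hU : IsIso (b ∣_ U)) (hV : (π ⁻¹ᵁ U : Set V).Nonempty) (hZ : (b ⁻¹ᵁ U : Set Z).Nonempty) :
    IsIntegral W := by
  have : Flat g := MorphismProperty.of_isPullback H ‹Flat π›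
  have := isIso_restrict_of_isPullback H U hU
  have : IsIntegral (π ⁻¹ᵁ U).toScheme :=
    have : Nonempty (π ⁻¹ᵁ U) := hV.to_subtype
    inferInstance
  have heq : ν ⁻¹ᵁ π ⁻¹ᵁ U = g ⁻¹ᵁ b ⁻¹ᵁ U := by
    rw [← Scheme.Hom.comp_preimage, ← Scheme.Hom.comp_preimage, H.w]
  have : IsIntegral (g ⁻¹ᵁ b ⁻¹ᵁ U).toScheme := by
    have : Nonempty (ν ⁻¹ᵁ π ⁻¹ᵁ U).toScheme :=
      ⟨(inv (ν ∣_ (π ⁻¹ᵁ U))) (Classical.arbitrary (π ⁻¹ᵁ U).toScheme)⟩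
    exact heq ▸ isIntegral_of_isOpenImmersion (ν ∣_ (π ⁻¹ᵁ U))
  have : IsDominant (b ⁻¹ᵁ U).ι := Opens.isDominant_ι ((b ⁻¹ᵁ U).isOpen.dense hZ)
  have : IsSchemeTheoreticallyDominant (b ⁻¹ᵁ U).ι := .of_isDominant _
  have hpb := (isPullback_morphismRestrict g (b ⁻¹ᵁ U))
  have : IsSchemeTheoreticallyDominant (g ⁻¹ᵁ b ⁻¹ᵁ U).ι := .of_isPullback hpb
  have : QuasiCompact (g ⁻¹ᵁ b ⁻¹ᵁ U).ι := MorphismProperty.of_isPullback hpb inferInstance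
  have : IsReduced W := IsSchemeTheoreticallyDominant.isReduced (g ⁻¹ᵁ b ⁻¹ᵁ U).ι
  have : IrreducibleSpace W := by
    have h : IsIrreducible (closure (Set.range (g ⁻¹ᵁ b ⁻¹ᵁ U).ι)) := by
      rw [← Set.image_univ]
      exact ((IrreducibleSpace.isIrreducible_univ _).image _
        (Scheme.Hom.continuous _).continuousOn).closure
    rw [(Scheme.Hom.denseRange _).closure_range] at h
    exact (irreducibleSpace_def _).2 h
  exact isIntegral_of_irreducibleSpace_of_isReduced W

lemma smooth_fiberToSpecResidueField_of_le_smoothLocus {X Y : Scheme.{u}} (f : X ⟶ Y)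
    [LocallyOfFinitePresentation f] (y : Y) (h : ∀ x, f x = y → x ∈ f.smoothLocus) :
    Smooth (f.fiberToSpecResidueField y) := by
  have : Smooth (f.smoothLocus.ι ≫ f) := by
    rw [← Scheme.Hom.smoothLocus_eq_top_iff, ← Scheme.Hom.preimage_smoothLocus_eq]
    simp
  have h1 := (isPullback_morphismRestrict (f.fiberι y) f.smoothLocus).flip.flip
  have htop : f.fiberι y ⁻¹ᵁ f.smoothLocus = ⊤ := by
    refine top_le_iff.1 fun x _ => h _ ?_
    have : f.fiberι y x ∈ Set.range (f.fiberι y) := ⟨x, rfl⟩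
    rw [Scheme.Hom.range_fiberι] at this
    exact this
  have h2 : IsPullback (f.fiberι y ∣_ f.smoothLocus)
      ((f.fiberι y ⁻¹ᵁ f.smoothLocus).ι ≫ f.fiberToSpecResidueField y) (f.smoothLocus.ι ≫ f)
      (Y.fromSpecResidueField y) :=
    h1.flip.flip.paste_vert (IsPullback.of_hasPullback f (Y.fromSpecResidueField y))
  have h3 : Smooth ((f.fiberι y ⁻¹ᵁ f.smoothLocus).ι ≫ f.fiberToSpecResidueField y) :=
    MorphismProperty.of_isPullback h2 this
  have : IsIso (f.fiberι y ⁻¹ᵁ f.smoothLocus).ι := by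
    rw [htop]
    exact inferInstanceAs (IsIso (Scheme.topIso _).hom)
  rw [← IsIso.inv_hom_id_assoc (f.fiberι y ⁻¹ᵁ f.smoothLocus).ι (f.fiberToSpecResidueField y)]
  infer_instance

/-- The generic point of `X` belongs to this fibre and is dense in it for the subspace topology. -/
lemma irreducibleSpace_fiber_genericPoint {X Y : Scheme.{u}} [IrreducibleSpace X]
    [IrreducibleSpace Y] (f : X ⟶ Y) (h : f (genericPoint X) = genericPoint Y) :
    IrreducibleSpace (f.fiber (genericPoint Y)) := by
  rw [(f.fiberHomeo _).irreducibleSpace_iff]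
  have hcl : closure {(⟨genericPoint X, h⟩ : f ⁻¹' {genericPoint Y})} = Set.univ := by
    rw [Topology.IsInducing.subtypeVal.closure_eq_preimage_closure_image]
    simp [genericPoint_closure]
  have := (isIrreducible_singleton (x := (⟨genericPoint X, h⟩ : f ⁻¹' {genericPoint Y}))).closure
  rw [hcl] at this
  exact (irreducibleSpace_def _).2 this

lemma apply_genericPoint_of_flat {X Y : Scheme.{u}} [IrreducibleSpace X]
    [IrreducibleSpace Y] (f : X ⟶ Y) [Flat f] : f (genericPoint X) = genericPoint Y := by
  obtain ⟨x, hx, hxy⟩ := Flat.generalizingMap f (genericPoint_specializes (f (genericPoint X)))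
  rw [← hxy, (hx.antisymm (genericPoint_specializes x)).eq]

end BaseChange
end GeomFibration

namespace GeomFibration

/-! ### Krull dimension: locality and integral extensions -/

section KrullDimension

open TopologicalSpace

/-- The dimension is a supremum of coheights of irreducible closed sets, and such a coheight can be
computed in any open set that meets the closed set. -/
lemma topologicalKrullDim_le_of_forall_isOpenEmbedding {X : Type*} [TopologicalSpace X]
    (d : WithBot ℕ∞)
    (h : ∀ x : X, ∃ (Y : Type u) (_ : TopologicalSpace Y) (f : Y → X),
      Topology.IsOpenEmbedding f ∧ x ∈ Set.range f ∧ topologicalKrullDim Y ≤ d) :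
    topologicalKrullDim X ≤ d := by
  rw [topologicalKrullDim, Order.krullDim_eq_iSup_coheight]
  refine iSup_le fun Z => ?_
  obtain ⟨z, hz⟩ := Z.isIrreducible.nonempty
  obtain ⟨Y, _, f, hf, ⟨y, rfl⟩, hd⟩ := h z
  let Z' := (IrreducibleCloseds.orderIsoOfIsOpenEmbedding f hf).symm ⟨Z, ⟨y, hz⟩⟩
  have hZ : IrreducibleCloseds.map f hf.continuous Z' = Z :=
    congr_arg Subtype.val ((IrreducibleCloseds.orderIsoOfIsOpenEmbedding f hf).apply_symm_apply
      ⟨Z, ⟨y, hz⟩⟩)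
  rw [← hZ, hf.coheight_map]
  exact (Order.coheight_le_krullDim _).trans hd

/-- Incomparability makes contraction of primes strictly monotone, giving one inequality; lying over
and going up lift chains, giving the other. -/
lemma ringKrullDim_eq_of_isIntegral (R S : Type*) [CommRing R] [CommRing S] [Algebra R S]
    [Algebra.IsIntegral R S] [FaithfulSMul R S] : ringKrullDim S = ringKrullDim R := by
  refine le_antisymm (Order.krullDim_le_of_strictMono (PrimeSpectrum.comap (algebraMap R S)) ?_)
    (iSup_le fun l => ?_)
  · intro p q hpq
    obtain ⟨hle, x, hx, hx'⟩ := SetLike.lt_iff_le_and_exists.1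
      (show p.asIdeal < q.asIdeal from hpq)
    exact Ideal.comap_lt_comap_of_integral_mem_sdiff hle ⟨hx, hx'⟩
      (Algebra.IsIntegral.isIntegral x)
  · obtain ⟨P, hP⟩ := Algebra.IsIntegral.comap_surjective R S l.head
    have : P.asIdeal.LiesOver l.head.asIdeal := ⟨congr($(hP).1).symm⟩
    obtain ⟨L, hL, -⟩ := Ideal.exists_ltSeries_of_hasGoingUp l P.asIdeal
    exact le_iSup_of_le L (by rw [hL])

lemma faithfulSMul_of_flat (R S : Type*) [CommRing R] [IsDomain R] [CommRing S] [Nontrivial S]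
    [Algebra R S] [Module.Flat R S] : FaithfulSMul R S := by
  rw [faithfulSMul_iff_algebraMap_injective, injective_iff_map_eq_zero]
  intro a ha
  by_contra h
  have : Module.IsTorsionFree R S := inferInstance
  have := smul_right_injective S h (show a • (1 : S) = a • 0 by
    rw [Algebra.smul_def, ha]; simp)
  exact one_ne_zero this

lemma topologicalKrullDim_Spec_eq_one {κ : Type u} [Field κ] {S : Type u} [CommRing S]
    [Nontrivial S] (φ : Polynomial κ →+* S) (h1 : φ.Finite) (h2 : φ.Flat) :
    topologicalKrullDim (Spec (CommRingCat.of S)) = 1 := by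
  algebraize [φ]
  have := faithfulSMul_of_flat (Polynomial κ) S
  change topologicalKrullDim (PrimeSpectrum S) = 1
  rw [PrimeSpectrum.topologicalKrullDim_eq_ringKrullDim,
    ringKrullDim_eq_of_isIntegral (Polynomial κ) S]
  exact IsPrincipalIdealRing.ringKrullDim_eq_one _ (Polynomial.not_isField κ)

end KrullDimension
end GeomFibration

namespace GeomFibration

/-! ### Fibres of a finite flat cover of a family of affine lines -/

section FiberDimension

open Limits

lemma exists_apply_eq_of_isPullback {P X Y S : Scheme.{u}} {fst : P ⟶ X} {snd : P ⟶ Y} {f : X ⟶ S}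
    {g : Y ⟶ S} (H : IsPullback fst snd f g) {x : X} {y : Y} (h : f x = g y) :
    ∃ z : P, fst z = x ∧ snd z = y := by
  obtain ⟨z, h1, h2⟩ := Scheme.Pullback.exists_preimage_pullback x y h
  refine ⟨H.isoPullback.inv z, ?_, ?_⟩
  · rw [← Scheme.Hom.comp_apply, H.isoPullback_inv_fst, h1]
  · rw [← Scheme.Hom.comp_apply, H.isoPullback_inv_snd, h2]

lemma topologicalKrullDim_eq_one_of_isFinite {T : Scheme.{u}} [Nonempty T] {κ : Type u} [Field κ]
    (f : T ⟶ Spec (CommRingCat.of (Polynomial κ))) [IsFinite f] [Flat f] :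
    topologicalKrullDim T = 1 := by
  have : IsAffine T := isAffine_of_isAffineHom f
  obtain ⟨φ, hφ⟩ := Spec.map_surjective (T.isoSpec.inv ≫ f)
  have h1 : IsFinite (Spec.map φ) := by rw [hφ]; infer_instance
  have h2 : Flat (Spec.map φ) := by rw [hφ]; infer_instance
  rw [IsFinite.SpecMap_iff] at h1
  rw [Flat.SpecMap_iff] at h2
  have : Nonempty (Spec Γ(T, ⊤)) := ⟨T.isoSpec.hom (Classical.arbitrary T)⟩
  have : Nontrivial Γ(T, ⊤) := PrimeSpectrum.nonempty_iff_nontrivial.1 this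
  rw [← topologicalKrullDim_Spec_eq_one φ.hom h1 h2]
  exact IsHomeomorph.topologicalKrullDim_eq T.isoSpec.hom
    (Scheme.homeoOfIso T.isoSpec).isHomeomorph

attribute [local instance] Polynomial.algebra in
lemma isPullback_SpecMap_polynomial {C K : Type u} [CommRing C] [CommRing K] (φ : C →+* K) :
    IsPullback (Spec.map (CommRingCat.ofHom (Polynomial.mapRingHom φ)))
      (Spec.map (CommRingCat.ofHom Polynomial.C)) (Spec.map (CommRingCat.ofHom Polynomial.C))
      (Spec.map (CommRingCat.ofHom φ)) := by
  algebraize [φ]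
  exact (isPullback_SpecMap_of_isPushout _ _ _ _
      (CommRingCat.isPushout_of_isPushout C K (Polynomial C) (Polynomial K))).flip

/-- In a chart `q` is the projection of an affine line over `C`, whose fibre at `y` is the affine
line over the residue field. The part of the fibre of `g ≫ q` above this chart is then finite flat
over that line, and has dimension one. -/
lemma exists_isOpenImmersion_fiber {W Z P : Scheme.{u}} (g : W ⟶ Z) [IsFinite g] [Flat g]
    (q : Z ⟶ P) {C : CommRingCat.{u}} (j : Spec C ⟶ P) [IsOpenImmersion j]
    (c : Spec (CommRingCat.of (Polynomial C)) ⟶ Z) [IsOpenImmersion c]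
    (hc : c ≫ q = Spec.map (CommRingCat.ofHom Polynomial.C) ≫ j) (y : P) (x : (g ≫ q).fiber y)
    (hx : g ((g ≫ q).fiberι y x) ∈ Set.range c) :
    ∃ (T : Scheme.{u}) (i : T ⟶ (g ≫ q).fiber y), IsOpenImmersion i ∧ x ∈ Set.range i ∧
      topologicalKrullDim T = 1 := by
  have hqx : q (g ((g ≫ q).fiberι y x)) = y := by
    have : (g ≫ q).fiberι y x ∈ Set.range ((g ≫ q).fiberι y) := ⟨x, rfl⟩
    rw [Scheme.Hom.range_fiberι] at this
    simpa using this
  obtain ⟨z, hz⟩ := hx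
  have hy : y ∈ Set.range j := by
    rw [← hqx, ← hz, ← Scheme.Hom.comp_apply, hc]
    exact ⟨_, rfl⟩
  let e := P.fromSpecResidueField y
  -- The point `y` factors through the base of the chart, so the fibre can be formed by pasting
  -- pullback squares inside the chart.
  let t : Spec (P.residueField y) ⟶ Spec C := IsOpenImmersion.lift j e (by
    rw [Scheme.range_fromSpecResidueField]
    simpa using hy)
  have ht : t ≫ j = e := IsOpenImmersion.lift_fac _ _ _
  obtain ⟨φ, hφ⟩ := Spec.map_surjective t
  have H2 := isPullback_SpecMap_polynomial φ.hom
  rw [CommRingCat.ofHom_hom, hφ] at H2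
  have H1 : IsPullback (pullback.fst g c) (pullback.snd g c) g c := .of_hasPullback _ _
  have H3 := IsPullback.of_hasPullback (pullback.snd g c)
    (Spec.map (CommRingCat.ofHom (Polynomial.mapRingHom φ.hom)))
  let T := pullback (pullback.snd g c) (Spec.map (CommRingCat.ofHom (Polynomial.mapRingHom φ.hom)))
  have H4 : IsPullback t (𝟙 _) j e := .of_vert_isIso_mono ⟨by simp [ht]⟩
  have H5 := (H3.paste_vert H2).paste_vert H4
  have hcomp : (pullback.snd g c ≫ Spec.map (CommRingCat.ofHom Polynomial.C)) ≫ j =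
      pullback.fst g c ≫ g ≫ q := by
    rw [Category.assoc, ← hc, pullback.condition_assoc]
  rw [hcomp] at H5
  have H6 := IsPullback.of_right' H5.flip (IsPullback.of_hasPullback (g ≫ q) e).flip
  obtain ⟨w, hw⟩ : (g ≫ q).fiberι y x ∈ Set.range (pullback.fst g c) := by
    rw [Scheme.Pullback.range_fst]
    exact ⟨z, hz⟩
  obtain ⟨v, hv, -⟩ := exists_apply_eq_of_isPullback H6 (x := x) (y := w) hw.symm
  refine ⟨T, _, MorphismProperty.of_isPullback H6.flip inferInstance, ⟨v, hv⟩, ?_⟩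
  have : Nonempty T := ⟨v⟩
  exact topologicalKrullDim_eq_one_of_isFinite (κ := P.residueField y) (pullback.snd (pullback.snd g c)
    (Spec.map (CommRingCat.ofHom (Polynomial.mapRingHom φ.hom))))

lemma topologicalKrullDim_fiber_eq_one {W Z P : Scheme.{u}} (g : W ⟶ Z) [IsFinite g] [Flat g]
    (q : Z ⟶ P) (y : P) [Nonempty ((g ≫ q).fiber y)]
    (h : ∀ z : Z, ∃ (C : CommRingCat.{u}) (j : Spec C ⟶ P)
      (c : Spec (CommRingCat.of (Polynomial C)) ⟶ Z), IsOpenImmersion j ∧ IsOpenImmersion c ∧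
      c ≫ q = Spec.map (CommRingCat.ofHom Polynomial.C) ≫ j ∧ z ∈ Set.range c) :
    topologicalKrullDim ((g ≫ q).fiber y) = 1 := by
  have key : ∀ x : (g ≫ q).fiber y, ∃ (T : Scheme.{u}) (i : T ⟶ (g ≫ q).fiber y),
      IsOpenImmersion i ∧ x ∈ Set.range i ∧ topologicalKrullDim T = 1 := by
    intro x
    obtain ⟨C, j, c, _, _, hc, hx⟩ := h (g ((g ≫ q).fiberι y x))
    exact exists_isOpenImmersion_fiber g q j c hc y x hx
  refine le_antisymm (topologicalKrullDim_le_of_forall_isOpenEmbedding 1 fun x => ?_) ?_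
  · obtain ⟨T, i, hi, hx, hT⟩ := key x
    exact ⟨T, inferInstance, i, i.isOpenEmbedding, hx, hT.le⟩
  · obtain ⟨T, i, hi, hx, hT⟩ := key (Classical.arbitrary _)
    rw [← hT]
    exact i.isOpenEmbedding.isInducing.topologicalKrullDim_le

end FiberDimension
end GeomFibration

namespace GeomFibration

/-! ### The fibration obtained by pulling back a finite flat cover -/

section PullbackFibration

open Limits

lemma restrict_of_isPullback (R : MorphismProperty Scheme.{u}) [R.IsStableUnderBaseChange]
    {W V Z Q : Scheme.{u}} {ν : W ⟶ V} {g : W ⟶ Z} {π : V ⟶ Q}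
    {b : Z ⟶ Q} (H : IsPullback ν g π b) (U : Q.Opens) (hU : R (b ∣_ U)) :
    R (ν ∣_ (π ⁻¹ᵁ U)) := by
  have h1 : IsPullback ((ν ⁻¹ᵁ π ⁻¹ᵁ U).ι ≫ g) (ν ∣_ (π ⁻¹ᵁ U)) b ((π ∣_ U) ≫ U.ι) := by
    rw [morphismRestrict_ι]
    exact (isPullback_morphismRestrict ν (π ⁻¹ᵁ U)).flip.paste_horiz H.flip
  exact MorphismProperty.of_isPullback
    (IsPullback.of_right' h1 (isPullback_morphismRestrict b U).flip) hU

/-- Every point of `Z` lies in an affine line over an affine open subset of `P`. -/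
def HasAffineLineCharts {Z P : Scheme.{u}} (q : Z ⟶ P) : Prop :=
  ∀ z : Z, ∃ (C : CommRingCat.{u}) (j : Spec C ⟶ P)
      (c : Spec (CommRingCat.of (Polynomial C)) ⟶ Z), IsOpenImmersion j ∧ IsOpenImmersion c ∧
      c ≫ q = Spec.map (CommRingCat.ofHom Polynomial.C) ≫ j ∧ z ∈ Set.range c

lemma smooth_polynomial_C (C : Type*) [CommRing C] :
    (Polynomial.C : C →+* Polynomial C).Smooth := by
  have : Algebra.Smooth C (Polynomial C) := ⟨inferInstance, inferInstance⟩
  exact RingHom.smooth_algebraMap.2 this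

lemma HasAffineLineCharts.smooth {Z P : Scheme.{u}} {q : Z ⟶ P} (h : HasAffineLineCharts q)
    [LocallyOfFinitePresentation q] : Smooth q := by
  rw [← Scheme.Hom.smoothLocus_eq_top_iff, ← top_le_iff]
  intro z _
  obtain ⟨C, j, c, _, _, hc, x, rfl⟩ := h z
  have : Smooth (Spec.map (CommRingCat.ofHom (Polynomial.C : C →+* Polynomial C))) :=
    HasRingHomProperty.Spec_iff.2 (smooth_polynomial_C C)
  have h1 : Smooth (c ≫ q) := by rw [hc]; infer_instance
  have h2 : x ∈ c ⁻¹ᵁ q.smoothLocus := by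
    rw [Scheme.Hom.preimage_smoothLocus_eq, Scheme.Hom.smoothLocus_eq_top]
    trivial
  exact h2

variable {k : Type u} [Field k] {V Q Z P : Scheme.{u}}
  {s : V ⟶ Spec (CommRingCat.of k)} {sQ : Q ⟶ Spec (CommRingCat.of k)}
  {sP : P ⟶ Spec (CommRingCat.of k)} {π : V ⟶ Q} {b : Z ⟶ Q} {q : Z ⟶ P}

/-- The data of a finite flat morphism to `Q` and a modification of `Q` fibred over `P`. -/
structure IsFibrationDatum (s : V ⟶ Spec (CommRingCat.of k)) (sQ : Q ⟶ Spec (CommRingCat.of k))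
    (sP : P ⟶ Spec (CommRingCat.of k)) (π : V ⟶ Q) (b : Z ⟶ Q) (q : Z ⟶ P) (U O : Q.Opens) :
    Prop where
  integral_V : IsIntegral V
  integral_Z : IsIntegral Z
  integral_P : IsIntegral P
  smooth_s : Smooth s
  proper_s : IsProper s
  separated_sP : IsSeparated sP
  finiteType_sP : LocallyOfFiniteType sP
  w_π : π ≫ sQ = s
  w_Z : b ≫ sQ = q ≫ sP
  finite_π : IsFinite π
  flat_π : Flat π
  surjective_π : Surjective π
  proper_b : IsProper b
  charts : HasAffineLineCharts q
  isIso_U : IsIso (b ∣_ U)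
  nonempty_U : (U : Set Q).Nonempty
  smooth_O : Smooth (π ∣_ O)
  sup_eq_top : O ⊔ U = ⊤

namespace IsFibrationDatum

variable {U O : Q.Opens}

lemma finiteType_q (h : IsFibrationDatum s sQ sP π b q U O) [LocallyOfFiniteType sQ] :
    LocallyOfFiniteType q := by
  have := h.proper_b
  have : LocallyOfFiniteType (q ≫ sP) := by rw [← h.w_Z]; infer_instance
  exact locallyOfFiniteType_of_comp q sP

lemma isLocallyNoetherian_Z (h : IsFibrationDatum s sQ sP π b q U O) [LocallyOfFiniteType sQ] :
    IsLocallyNoetherian Z := by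
  have := h.proper_b
  exact LocallyOfFiniteType.isLocallyNoetherian (b ≫ sQ)

lemma isLocallyNoetherian_P (h : IsFibrationDatum s sQ sP π b q U O) : IsLocallyNoetherian P := by
  have := h.finiteType_sP
  exact LocallyOfFiniteType.isLocallyNoetherian sP

lemma smooth_q (h : IsFibrationDatum s sQ sP π b q U O) [LocallyOfFiniteType sQ] : Smooth q := by
  have := h.finiteType_q
  have := h.isLocallyNoetherian_P
  exact h.charts.smooth

lemma isIntegral_pullback (h : IsFibrationDatum s sQ sP π b q U O) [LocallyOfFiniteType sQ] :
    IsIntegral (pullback π b) := by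
  have := h.flat_π
  have := h.integral_V
  have := h.integral_Z
  have := h.isLocallyNoetherian_Z
  have := h.surjective_π
  have := h.isIso_U
  obtain ⟨u, hu⟩ := h.nonempty_U
  refine isIntegral_of_isPullback (IsPullback.of_hasPullback π b) U h.isIso_U ?_ ?_
  · obtain ⟨v, rfl⟩ := π.surjective u
    exact ⟨v, hu⟩
  · exact ⟨(inv (b ∣_ U) ⟨u, hu⟩).1, (inv (b ∣_ U) ⟨u, hu⟩).2⟩

lemma w (h : IsFibrationDatum s sQ sP π b q U O) :
    (pullback.snd π b ≫ q) ≫ sP = pullback.fst π b ≫ s := by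
  rw [Category.assoc, ← h.w_Z, ← h.w_π, pullback.condition_assoc]

lemma isProper_fst_comp (h : IsFibrationDatum s sQ sP π b q U O) :
    IsProper (pullback.fst π b ≫ s) := by
  have := h.proper_s
  have := h.proper_b
  infer_instance

lemma isVariety (h : IsFibrationDatum s sQ sP π b q U O) [LocallyOfFiniteType sQ] :
    IsVariety (pullback.fst π b ≫ s) := by
  have := h.isProper_fst_comp
  exact ⟨h.isIntegral_pullback, inferInstance, inferInstance, inferInstance⟩

/-- Properness follows by cancellation, the pullback being proper over `k` and `P` separated;
flatness holds because a flat base change is followed by the smooth `q`. -/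
lemma isProper_flat (h : IsFibrationDatum s sQ sP π b q U O) [LocallyOfFiniteType sQ] :
    IsProper (pullback.snd π b ≫ q) ∧ Flat (pullback.snd π b ≫ q) := by
  have := h.separated_sP
  have := h.isProper_fst_comp
  have := h.smooth_q
  have := h.flat_π
  refine ⟨?_, inferInstance⟩
  have : IsProper ((pullback.snd π b ≫ q) ≫ sP) := by rw [h.w]; infer_instance
  exact .of_comp _ sP

lemma isIso_fst_restrict (h : IsFibrationDatum s sQ sP π b q U O) (U' : Q.Opens) (hU' : U' ≤ U) :
    IsIso (pullback.fst π b ∣_ (π ⁻¹ᵁ U')) := by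
  refine restrict_of_isPullback (MorphismProperty.isomorphisms _) (IsPullback.of_hasPullback π b) U' ?_
  have := h.isIso_U
  have h1 : IsPullback (b ⁻¹ᵁ U').ι (b ∣_ U') b (Q.homOfLE hU' ≫ U.ι) := by
    rw [Scheme.homOfLE_ι]
    exact (isPullback_morphismRestrict b U').flip
  exact (IsPullback.of_right' h1 (isPullback_morphismRestrict b U).flip).isIso_snd_of_isIso

lemma isAffineIsoOpen (h : IsFibrationDatum s sQ sP π b q U O) (U' : Q.Opens) (hU' : U' ≤ U)
    (haff : IsAffineOpen U') (hne : (U' : Set Q).Nonempty) :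
    IsAffineIsoOpen (pullback.fst π b) (π ⁻¹ᵁ U') := by
  have := h.finite_π
  have := h.surjective_π
  have := h.integral_V
  refine ⟨haff.preimage π, (π ⁻¹ᵁ U').isOpen.dense ?_, h.isIso_fst_restrict U' hU'⟩
  obtain ⟨u, hu⟩ := hne
  obtain ⟨v, rfl⟩ := π.surjective u
  exact ⟨v, hu⟩

/-- Over `O` the morphism is a base change of the smooth part of `π` followed by the smooth `q`.
Over `U` the pullback is an open piece of `V`, smooth over `k`, and generic smoothness applies at
points above the generic point. -/
lemma mem_smoothLocus [CharZero k] (h : IsFibrationDatum s sQ sP π b q U O)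
    [LocallyOfFiniteType sQ] [LocallyOfFinitePresentation (pullback.snd π b ≫ q)]
    [IrreducibleSpace P]
    (w : ↑(pullback π b)) (hw : (pullback.snd π b ≫ q) w = genericPoint P) :
    w ∈ (pullback.snd π b ≫ q).smoothLocus := by
  have := h.integral_P
  have := h.smooth_q
  have := h.smooth_s
  have := h.finiteType_sP
  have hw' : π (pullback.fst π b w) ∈ O ⊔ U := h.sup_eq_top ▸ trivial
  rcases hw' with hO | hU
  · have : Smooth (pullback.snd π b ∣_ (b ⁻¹ᵁ O)) :=
      restrict_of_isPullback @Smooth (IsPullback.of_hasPullback π b).flip O h.smooth_O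
    have hs : Smooth ((pullback.snd π b ⁻¹ᵁ b ⁻¹ᵁ O).ι ≫ pullback.snd π b ≫ q) := by
      rw [← Category.assoc, ← morphismRestrict_ι, Category.assoc]
      infer_instance
    have hwO : w ∈ pullback.snd π b ⁻¹ᵁ b ⁻¹ᵁ O := by
      change (pullback.snd π b ≫ b) w ∈ O
      rw [← pullback.condition]
      exact hO
    have h2 : (⟨w, hwO⟩ : (pullback.snd π b ⁻¹ᵁ b ⁻¹ᵁ O).toScheme) ∈
        (pullback.snd π b ⁻¹ᵁ b ⁻¹ᵁ O).ι ⁻¹ᵁ (pullback.snd π b ≫ q).smoothLocus := by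
      rw [Scheme.Hom.preimage_smoothLocus_eq, Scheme.Hom.smoothLocus_eq_top]
      trivial
    exact h2
  · have := h.isIso_fst_restrict U le_rfl
    have hs : Smooth (((pullback.fst π b ⁻¹ᵁ π ⁻¹ᵁ U).ι ≫ pullback.snd π b ≫ q) ≫ sP) := by
      rw [Category.assoc, h.w, ← Category.assoc, ← morphismRestrict_ι, Category.assoc]
      infer_instance
    have h2 : (⟨w, hU⟩ : (pullback.fst π b ⁻¹ᵁ π ⁻¹ᵁ U).toScheme) ∈
        (pullback.fst π b ⁻¹ᵁ π ⁻¹ᵁ U).ι ⁻¹ᵁ (pullback.snd π b ≫ q).smoothLocus := by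
      rw [Scheme.Hom.preimage_smoothLocus_eq]
      exact mem_smoothLocus_of_apply_eq_genericPoint _ sP _ hw
    exact h2

lemma genericFiber [CharZero k] (h : IsFibrationDatum s sQ sP π b q U O)
    [LocallyOfFiniteType sQ] [IrreducibleSpace P] :
    GenericFiberIsSmoothIrreducibleCurve (pullback.snd π b ≫ q) := by
  have := h.isIntegral_pullback
  have := h.finiteType_q
  have := h.isLocallyNoetherian_P
  have := h.finite_π
  have := h.flat_π
  have := h.isProper_flat.2
  have hirr : IrreducibleSpace ((pullback.snd π b ≫ q).fiber (genericPoint P)) :=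
    irreducibleSpace_fiber_genericPoint _ (apply_genericPoint_of_flat _)
  exact ⟨smooth_fiberToSpecResidueField_of_le_smoothLocus _ _ (h.mem_smoothLocus), hirr,
    topologicalKrullDim_fiber_eq_one _ _ _ h.charts⟩

end IsFibrationDatum

end PullbackFibration
end GeomFibration

namespace GeomFibration

/-! ### Ring-valued points of `Proj` -/

section ProjPoints

open HomogeneousLocalization

variable {ι : Type*} {A : Type u} [CommRing A] [SetLike ι A] [AddSubgroupClass ι A]
  (𝒜 : ℕ → ι) [GradedRing 𝒜] {f g : A} {m m' : ℕ}

/-- The ring homomorphism `(A_f)₀ → R` induced by `φ : A → R` with `φ f` invertible. -/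
noncomputable def awayLift {R : Type*} [CommRing R] (φ : A →+* R) (h : IsUnit (φ f)) :
    Away 𝒜 f →+* R :=
  (IsLocalization.Away.lift (S := Localization.Away f) f h).comp
    (algebraMap (Away 𝒜 f) (Localization.Away f))

variable {𝒜}

lemma awayLift_mk {R : Type*} [CommRing R] (φ : A →+* R) (h : IsUnit (φ f)) (hf : f ∈ 𝒜 m) (n : ℕ)
    (x : A) (hx : x ∈ 𝒜 (n • m)) :
    awayLift 𝒜 φ h (Away.mk 𝒜 hf n x hx) * φ f ^ n = φ x := by
  rw [awayLift, RingHom.comp_apply, HomogeneousLocalization.algebraMap_apply, Away.val_mk, ← map_pow,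
    ← IsLocalization.Away.lift_eq (S := Localization.Away f) f h (f ^ n), ← map_mul, ← Localization.mk_one_eq_algebraMap,
    Localization.mk_mul, ← IsLocalization.Away.lift_eq (S := Localization.Away f) f h x, ← Localization.mk_one_eq_algebraMap]
  congr 1
  rw [Localization.mk_eq_mk_iff, Localization.r_iff_exists]
  exact ⟨1, by simp; ring⟩

lemma ringHom_away_ext {R : Type*} [CommRing R] (hf : f ∈ 𝒜 m) {ψ ψ' : Away 𝒜 f →+* R}
    (h : ∀ n x hx, ψ (Away.mk 𝒜 hf n x hx) = ψ' (Away.mk 𝒜 hf n x hx)) : ψ = ψ' := by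
  ext z
  obtain ⟨n, a, ha, rfl⟩ := Away.mk_surjective 𝒜 hf z
  exact h n a ha

lemma eq_awayLift {R : Type*} [CommRing R] (φ : A →+* R) (h : IsUnit (φ f)) (hf : f ∈ 𝒜 m)
    (ψ : Away 𝒜 f →+* R)
    (hψ : ∀ n x hx, ψ (Away.mk 𝒜 hf n x hx) * φ f ^ n = φ x) : ψ = awayLift 𝒜 φ h :=
  ringHom_away_ext hf fun n x hx => (h.pow n).mul_left_injective <| by
    dsimp only
    rw [hψ, awayLift_mk]

lemma comp_awayLift {R S : Type*} [CommRing R] [CommRing S] (φ : A →+* R) (h : IsUnit (φ f))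
    (hf : f ∈ 𝒜 m) (χ : R →+* S) :
    χ.comp (awayLift 𝒜 φ h) = awayLift 𝒜 (χ.comp φ) (h.map χ) :=
  eq_awayLift _ _ hf _ fun n x hx => by
    simp only [RingHom.comp_apply, ← awayLift_mk φ h hf n x hx, map_mul, map_pow]

lemma awayLift_comp_awayMap {R : Type*} [CommRing R] (φ : A →+* R) (hf : f ∈ 𝒜 m) (hg : g ∈ 𝒜 m')
    (h : IsUnit (φ f)) (h' : IsUnit (φ (f * g))) :
    (awayLift 𝒜 φ h').comp (awayMap 𝒜 hg rfl) = awayLift 𝒜 φ h :=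
  eq_awayLift _ _ hf _ fun n x hx => by
    have hg' : IsUnit (φ g) := isUnit_of_mul_isUnit_right (by rwa [map_mul] at h')
    rw [RingHom.comp_apply, awayMap_mk]
    refine (hg'.pow n).mul_left_injective ?_
    dsimp only
    rw [mul_assoc, ← mul_pow, ← map_mul, awayLift_mk, map_mul, map_pow]

variable {R : Type u} [CommRing R]

/-- The `R`-valued point of `Proj 𝒜` given by `φ : A → R` with `φ f` invertible. -/
noncomputable def projPoint (hf : f ∈ 𝒜 m) (hm : 0 < m) (φ : A →+* R) (h : IsUnit (φ f)) :
    Spec (.of R) ⟶ Proj 𝒜 :=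
  Spec.map (CommRingCat.ofHom (awayLift 𝒜 φ h)) ≫ Proj.awayι 𝒜 f hf hm

lemma SpecMap_projPoint {S : Type u} [CommRing S] (hf : f ∈ 𝒜 m) (hm : 0 < m) (φ : A →+* R)
    (h : IsUnit (φ f)) (χ : R →+* S) :
    Spec.map (CommRingCat.ofHom χ) ≫ projPoint hf hm φ h =
      projPoint hf hm (χ.comp φ) (h.map χ) := by
  rw [projPoint, projPoint, ← comp_awayLift _ _ hf, CommRingCat.ofHom_comp, Spec.map_comp,
    Category.assoc]

/-- Both points are compared with the one defined through the chart of the product `f * g`. -/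
lemma projPoint_eq (hf : f ∈ 𝒜 m) (hm : 0 < m) (hg : g ∈ 𝒜 m') (hm' : 0 < m') (φ : A →+* R)
    (h : IsUnit (φ f)) (h' : IsUnit (φ g)) :
    projPoint hf hm φ h = projPoint hg hm' φ h' := by
  have key : ∀ {f g : A} {m m' : ℕ} (hf : f ∈ 𝒜 m) (hm : 0 < m) (hg : g ∈ 𝒜 m')
      (h : IsUnit (φ f)) (h' : IsUnit (φ g)),
      projPoint hf hm φ h = projPoint (SetLike.mul_mem_graded hf hg)
        (hm.trans_le (m.le_add_right m')) φ (by rw [map_mul]; exact h.mul h') := by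
    intro f g m m' hf hm hg h h'
    rw [projPoint, projPoint, ← awayLift_comp_awayMap φ hf hg h (by rw [map_mul]; exact h.mul h'),
      CommRingCat.ofHom_comp, Spec.map_comp, Category.assoc, Proj.SpecMap_awayMap_awayι]
  rw [key hf hm hg h h', key hg hm' hf h' h]
  congr 1
  · exact mul_comm f g
  · exact add_comm m m'

/-- The powers of `c` cancel in fractions of degree zero; proportional homogeneous coordinates give
the same point. -/
lemma projPoint_eq_of_smul (hf : f ∈ 𝒜 m) (hm : 0 < m) (φ φ' : A →+* R) (h : IsUnit (φ f))
    (h' : IsUnit (φ' f)) (c : R)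
    (H : ∀ d, ∀ x ∈ 𝒜 d, φ' x = c ^ d * φ x) :
    projPoint hf hm φ h = projPoint hf hm φ' h' := by
  rw [projPoint, projPoint]
  congr 3
  refine eq_awayLift _ _ hf _ fun n x hx => ?_
  rw [H _ _ hf, H _ _ hx, ← awayLift_mk φ h hf n x hx, smul_eq_mul]
  ring

lemma projPoint_preimage_basicOpen (hf : f ∈ 𝒜 m) (hm : 0 < m) (hg : g ∈ 𝒜 m') (hm' : 0 < m')
    (φ : A →+* R) (h : IsUnit (φ f)) :
    projPoint hf hm φ h ⁻¹ᵁ Proj.basicOpen 𝒜 g = PrimeSpectrum.basicOpen (φ g) := by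
  rw [projPoint, Scheme.Hom.comp_preimage, Proj.awayι_preimage_basicOpen 𝒜 hf hm hg hm']
  have : awayLift 𝒜 φ h (Away.isLocalizationElem hf hg) * φ f ^ m' = φ g ^ m := by
    rw [Away.isLocalizationElem, awayLift_mk, map_pow]
  ext x
  change awayLift 𝒜 φ h (Away.isLocalizationElem hf hg) ∉ x.asIdeal ↔ φ g ∉ x.asIdeal
  have h1 : x.asIdeal.IsPrime := x.2
  refine not_congr ((Ideal.mul_unit_mem_iff_mem _ (h.pow m')).symm.trans ?_)
  rw [this]
  exact h1.pow_mem_iff_mem m hm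

lemma projPoint_toSpecZero (hf : f ∈ 𝒜 m) (hm : 0 < m) (φ : A →+* R) (h : IsUnit (φ f)) :
    projPoint hf hm φ h ≫ Proj.toSpecZero 𝒜 =
      Spec.map (CommRingCat.ofHom (φ.comp (algebraMap (𝒜 0) A))) := by
  rw [projPoint, Category.assoc, Proj.awayι_toSpecZero, ← Spec.map_comp, ← CommRingCat.ofHom_comp]
  congr 2
  ext x
  rw [RingHom.comp_apply, awayLift, RingHom.comp_apply, HomogeneousLocalization.algebraMap_apply]
  exact IsLocalization.Away.lift_eq f h x.1

end ProjPoints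

section ProjMap

open HomogeneousLocalization Graded

variable {A B σ τ : Type u} [CommRing A] [SetLike σ A] [AddSubgroupClass σ A]
  [CommRing B] [SetLike τ B] [AddSubgroupClass τ B]
  {𝒜 : ℕ → σ} {ℬ : ℕ → τ} [GradedRing 𝒜] [GradedRing ℬ] {f : A} {m : ℕ}
  {R : Type u} [CommRing R]

lemma awayLift_comp_map (hf : f ∈ 𝒜 m) (γ : 𝒜 →+*ᵍ ℬ) (φ : B →+* R)
    (h : IsUnit (φ (γ f))) :
    (awayLift ℬ φ h).comp (Away.map γ f) = awayLift 𝒜 (φ.comp γ.toRingHom) h :=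
  eq_awayLift _ _ hf _ fun n x hx => by
    rw [RingHom.comp_apply, Away.map_mk]
    exact awayLift_mk φ h (γ.2 hf) n _ _

lemma projPoint_map (hf : f ∈ 𝒜 m) (hm : 0 < m) (γ : 𝒜 →+*ᵍ ℬ)
    (hγ : HomogeneousIdeal.irrelevant ℬ ≤ (HomogeneousIdeal.irrelevant 𝒜).map γ) (φ : B →+* R)
    (h : IsUnit (φ (γ f))) :
    projPoint (γ.2 hf) hm φ h ≫ Proj.map γ hγ = projPoint hf hm (φ.comp γ.toRingHom) h := by
  rw [projPoint, projPoint, Category.assoc]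
  erw [Proj.awayι_comp_map γ hγ hm f hf]
  rw [← Category.assoc, ← Spec.map_comp, ← CommRingCat.ofHom_comp, awayLift_comp_map hf]

end ProjMap

end GeomFibration

namespace GeomFibration

/-! ### Projective space and its points in homogeneous coordinates -/

section ProjectiveSpaces

open HomogeneousLocalization MvPolynomial

attribute [local instance] MvPolynomial.gradedAlgebra

variable (k : Type u) [Field k] (σ : Type)

/-- Projective space over `k` with homogeneous coordinates indexed by `σ`. -/
noncomputable abbrev ProjSp : Scheme.{u} := Proj (homogeneousSubmodule σ k)

/-- The structure morphism of `ProjSp k σ`. -/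
noncomputable def ProjSp.toSpec : ProjSp k σ ⟶ Spec (.of k) :=
  Proj.toSpecZero (homogeneousSubmodule σ k) ≫
    Spec.map (CommRingCat.ofHom (algebraMap k (homogeneousSubmodule σ k 0)))

instance isScalarTower_zero :
    IsScalarTower k (homogeneousSubmodule σ k 0) (MvPolynomial σ k) :=
  IsScalarTower.of_algebraMap_eq (R := k) (S := homogeneousSubmodule σ k 0)
    (A := MvPolynomial σ k) fun _ => rfl

instance isIso_SpecMap_algebraMap_zero :
    IsIso (Spec.map (CommRingCat.ofHom (algebraMap k (homogeneousSubmodule σ k 0)))) := by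
  have : Function.Bijective (algebraMap k (homogeneousSubmodule σ k 0)) := by
    refine ⟨fun a b hab => C_injective σ k (congrArg Subtype.val hab), fun x => ?_⟩
    obtain ⟨x, hx⟩ := x
    rw [homogeneousSubmodule_zero] at hx
    obtain ⟨c, rfl⟩ := hx
    exact ⟨c, Subtype.ext (Algebra.algebraMap_eq_smul_one c)⟩
  have : IsIso (CommRingCat.ofHom (algebraMap k (homogeneousSubmodule σ k 0))) :=
    (ConcreteCategory.isIso_iff_bijective _).2 this
  infer_instance

instance [Finite σ] : IsProper (ProjSp.toSpec k σ) := by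
  have : Algebra.FiniteType (homogeneousSubmodule σ k 0) (MvPolynomial σ k) :=
    Algebra.FiniteType.of_restrictScalars_finiteType k _ _
  rw [ProjSp.toSpec]
  infer_instance

instance : IsSeparated (ProjSp.toSpec k σ) := by
  rw [ProjSp.toSpec]
  infer_instance

variable {k σ}

/-- The open subset of projective space where a homogeneous coordinate does not vanish. -/
noncomputable abbrev ProjSp.D {k : Type u} [Field k] {σ : Type} (j : σ) :
    (ProjSp k σ).Opens :=
  Proj.basicOpen (homogeneousSubmodule σ k) (X j)

lemma X_mem (j : σ) : X j ∈ homogeneousSubmodule σ k 1 := isHomogeneous_X k j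

lemma ProjSp.iSup_D : ⨆ j, ProjSp.D (k := k) j = (⊤ : (ProjSp k σ).Opens) := by
  refine Proj.iSup_basicOpen_eq_top _ _ ?_
  rw [HomogeneousIdeal.toIdeal_irrelevant_le]
  intro i hi x hx
  have hx : x.IsHomogeneous i := hx
  change x ∈ Ideal.span (Set.range X)
  rw [← Set.image_univ, mem_ideal_span_X_image]
  intro s hs
  by_contra! H
  have h0 : s = 0 := Finsupp.ext fun l => H l (Set.mem_univ l)
  have := hx (mem_support_iff.1 hs)
  rw [h0, map_zero] at this
  omega

lemma ProjSp.exists_mem_D (x : ProjSp k σ) : ∃ j, x ∈ ProjSp.D (k := k) j := by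
  have : x ∈ ⨆ j, ProjSp.D (k := k) j := by rw [ProjSp.iSup_D]; trivial
  simpa using this

variable {R : Type u} [CommRing R]

/-- The `R`-valued point of projective space with the given values of the coordinates, one of
which is a unit. -/
noncomputable def ProjSp.pt (j : σ) (φ : MvPolynomial σ k →+* R) (h : IsUnit (φ (X j))) :
    Spec (.of R) ⟶ ProjSp k σ :=
  projPoint (𝒜 := homogeneousSubmodule σ k) (X_mem j) one_pos φ h

namespace ProjSp

lemma SpecMap_pt {S : Type u} [CommRing S] (j : σ) (φ : MvPolynomial σ k →+* R)
    (h : IsUnit (φ (X j))) (χ : R →+* S) :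
    Spec.map (CommRingCat.ofHom χ) ≫ pt j φ h = pt j (χ.comp φ) (h.map χ) :=
  SpecMap_projPoint _ _ _ _ _

lemma pt_eq (i j : σ) (φ : MvPolynomial σ k →+* R) (h : IsUnit (φ (X i)))
    (h' : IsUnit (φ (X j))) : pt i φ h = pt j φ h' :=
  projPoint_eq _ _ _ _ _ _ _

lemma pt_eq_of_smul (j : σ) (φ φ' : MvPolynomial σ k →+* R) (h : IsUnit (φ (X j)))
    (h' : IsUnit (φ' (X j))) (c : R) (hC : ∀ r, φ' (C r) = φ (C r))
    (hX : ∀ i, φ' (X i) = c * φ (X i)) : pt j φ h = pt j φ' h' := by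
  refine projPoint_eq_of_smul _ _ _ _ _ _ c fun d x hx => ?_
  have hx : x.IsHomogeneous d := hx
  rw [MvPolynomial.as_sum x, map_sum, map_sum, Finset.mul_sum]
  refine Finset.sum_congr rfl fun s hs => ?_
  have hd : ∑ i ∈ s.support, s i = d := by
    have := hx (mem_support_iff.1 hs)
    rw [← this, Finsupp.weight_apply]
    simp [Finsupp.sum]
  rw [monomial_eq, map_mul, map_mul, hC, Finsupp.prod, map_prod, map_prod, ← hd,
    ← Finset.prod_pow_eq_pow_sum, mul_left_comm, ← Finset.prod_mul_distrib]
  congr 1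
  refine Finset.prod_congr rfl fun i _ => ?_
  rw [map_pow, map_pow, hX, mul_pow]

lemma pt_preimage_basicOpen (j : σ) (φ : MvPolynomial σ k →+* R) (h : IsUnit (φ (X j)))
    {m : ℕ} (hm : 0 < m) {g : MvPolynomial σ k} (hg : g.IsHomogeneous m) :
    pt j φ h ⁻¹ᵁ Proj.basicOpen (homogeneousSubmodule σ k) g = PrimeSpectrum.basicOpen (φ g) :=
  projPoint_preimage_basicOpen _ _ (g := g) (m' := m) hg hm _ _

lemma pt_preimage_D (j i : σ) (φ : MvPolynomial σ k →+* R) (h : IsUnit (φ (X j))) :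
    pt j φ h ⁻¹ᵁ D i = PrimeSpectrum.basicOpen (φ (X i)) :=
  pt_preimage_basicOpen j φ h one_pos (isHomogeneous_X k i)

lemma pt_toSpec (j : σ) (φ : MvPolynomial σ k →+* R) (h : IsUnit (φ (X j))) :
    pt j φ h ≫ toSpec k σ = Spec.map (CommRingCat.ofHom (φ.comp C)) := by
  rw [pt, toSpec, ← Category.assoc, projPoint_toSpecZero, ← Spec.map_comp, ← CommRingCat.ofHom_comp]
  rfl

/-- Here `φ` is a dehomogenisation setting `X j = 1`, and `ρ` a section of it. Surjectivity follows
by splitting `ρ r` into homogeneous components and dividing each by a power of `X j`. Stated for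
general `φ`, it serves both the standard charts and `lineChart`. -/
lemma awayLift_bijective [Algebra k R] (j : σ) (φ : MvPolynomial σ k →ₐ[k] R)
    (ρ : R →ₐ[k] MvPolynomial σ k) (hφ : φ (X j) = 1)
    (h1 : ∀ r, φ (ρ r) = r) (h2 : ∀ l, l ≠ j → ρ (φ (X l)) = X l)
    (h : IsUnit ((φ : MvPolynomial σ k →+* R) (X j))) :
    Function.Bijective (awayLift (homogeneousSubmodule σ k) (φ : MvPolynomial σ k →+* R) h) := by
  have hmk (n : ℕ) (x : MvPolynomial σ k) (hx : x ∈ homogeneousSubmodule σ k (n • 1)) :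
      awayLift (homogeneousSubmodule σ k) (φ : MvPolynomial σ k →+* R) h
        (Away.mk _ (X_mem j) n x hx) = φ x := by
    have := awayLift_mk (φ : MvPolynomial σ k →+* R) h (X_mem j) n x hx
    simpa [hφ] using this
  constructor
  · rw [injective_iff_map_eq_zero]
    intro z hz
    obtain ⟨n, x, hx, rfl⟩ := Away.mk_surjective _ (X_mem j) z
    rw [hmk] at hz
    let L := Localization.Away (X j : MvPolynomial σ k)
    let u : L := IsLocalization.Away.invSelf (X j : MvPolynomial σ k)
    have hu : algebraMap (MvPolynomial σ k) L (X j) * u = 1 := IsLocalization.Away.mul_invSelf _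
    -- The substitution `X l ↦ X l / X j` factors through `φ` and sends `x`, homogeneous of degree
    -- `n`, to `x / X j ^ n`; hence `φ x = 0` forces the fraction to vanish.
    let θ : MvPolynomial σ k →ₐ[k] L := aeval fun l => u * algebraMap (MvPolynomial σ k) L (X l)
    have hθ : θ (ρ (φ x)) = u ^ n * algebraMap _ L x := by
      have hxn : x.IsHomogeneous n := by simpa using hx
      have hcomp : (θ.comp ρ).comp φ = θ := by
        ext l
        by_cases hl : l = j
        · subst hl
          simp [hφ, θ, mul_comm u, hu]
        · simp [h2 l hl]
      have : θ (ρ (φ x)) = θ x := DFunLike.congr_fun hcomp x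
      rw [this]
      conv_lhs => rw [MvPolynomial.as_sum x, map_sum]
      conv_rhs => rw [MvPolynomial.as_sum x, map_sum, Finset.mul_sum]
      refine Finset.sum_congr rfl fun s hs => ?_
      have hd : ∑ i ∈ s.support, s i = n := by
        have := hxn (mem_support_iff.1 hs)
        rw [← this, Finsupp.weight_apply]
        simp [Finsupp.sum]
      rw [monomial_eq, map_mul, map_mul, Finsupp.prod, map_prod, map_prod, ← hd,
        ← Finset.prod_pow_eq_pow_sum, mul_left_comm, ← Finset.prod_mul_distrib]
      congr 1
      · simp [θ]; rfl
      · refine Finset.prod_congr rfl fun i _ => ?_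
        rw [map_pow, map_pow, aeval_X, mul_pow]
    rw [hz, map_zero, map_zero] at hθ
    have hx0 : algebraMap (MvPolynomial σ k) L x = 0 := by
      have hun : IsUnit (u ^ n) := (IsUnit.of_mul_eq_one_right _ hu).pow n
      exact (hun.mul_right_eq_zero).1 hθ.symm
    apply HomogeneousLocalization.val_injective
    rw [Away.val_mk, val_zero]
    have := hx0
    rw [Localization.mk_eq_mk', IsLocalization.mk'_eq_zero_iff]
    exact (IsLocalization.map_eq_zero_iff (Submonoid.powers (X j : MvPolynomial σ k)) L x).1 hx0
  · intro r
    rw [← RingHom.mem_range, ← h1 r, ← MvPolynomial.sum_homogeneousComponent (ρ r), map_sum]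
    refine Subring.sum_mem _ fun d _ => ⟨Away.mk _ (X_mem j) d (homogeneousComponent d (ρ r)) ?_, ?_⟩
    · simpa using homogeneousComponent_isHomogeneous d (ρ r)
    · exact hmk _ _ _

lemma isOpenImmersion_pt [Algebra k R] (j : σ) (φ : MvPolynomial σ k →ₐ[k] R)
    (ρ : R →ₐ[k] MvPolynomial σ k) (hφ : φ (X j) = 1)
    (h1 : ∀ r, φ (ρ r) = r) (h2 : ∀ l, l ≠ j → ρ (φ (X l)) = X l)
    (h : IsUnit ((φ : MvPolynomial σ k →+* R) (X j))) :
    ∃ _ : IsOpenImmersion (pt j (φ : MvPolynomial σ k →+* R) h),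
      (pt j (φ : MvPolynomial σ k →+* R) h).opensRange = D j := by
  have : IsIso (CommRingCat.ofHom (awayLift (homogeneousSubmodule σ k)
      (φ : MvPolynomial σ k →+* R) h)) :=
    (ConcreteCategory.isIso_iff_bijective _).2 (awayLift_bijective j φ ρ hφ h1 h2 h)
  refine ⟨by rw [pt, projPoint]; infer_instance, ?_⟩
  refine Eq.trans ?_ (Proj.opensRange_awayι (homogeneousSubmodule σ k) (X j) (X_mem j) one_pos)
  exact Scheme.Hom.opensRange_comp_of_isIso _ _

end ProjSp

end ProjectiveSpaces

end GeomFibration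

namespace GeomFibration

/-! ### Linear changes of coordinates and general position -/

section ProjIso

open HomogeneousLocalization HomogeneousIdeal Graded

variable {A B σ τ : Type u} [CommRing A] [SetLike σ A] [AddSubgroupClass σ A]
  [CommRing B] [SetLike τ B] [AddSubgroupClass τ B]
  {𝒜 : ℕ → σ} {ℬ : ℕ → τ} [GradedRing 𝒜] [GradedRing ℬ]

lemma irrelevant_le_map_of_rightInverse (γ : 𝒜 →+*ᵍ ℬ) (δ : ℬ →+*ᵍ 𝒜)
    (h : ∀ x, γ (δ x) = x) :
    HomogeneousIdeal.irrelevant ℬ ≤ (HomogeneousIdeal.irrelevant 𝒜).map γ := by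
  rw [← toIdeal_le_toIdeal_iff, HomogeneousIdeal.toIdeal_irrelevant_le]
  intro i hi x hx
  have hx : x ∈ ℬ i := hx
  change x ∈ Ideal.map γ (HomogeneousIdeal.irrelevant 𝒜).toIdeal
  rw [← h x]
  refine Ideal.mem_map_of_mem _ ?_
  rw [HomogeneousIdeal.mem_iff, HomogeneousIdeal.mem_irrelevant_iff, GradedRing.proj_apply]
  exact DirectSum.decompose_of_mem_ne _ (δ.2 hx) hi.ne'

/-- The isomorphism of `Proj`s induced by mutually inverse graded homomorphisms. -/
noncomputable def projIso (γ : 𝒜 →+*ᵍ ℬ) (δ : ℬ →+*ᵍ 𝒜) (h : ∀ x, γ (δ x) = x)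
    (h' : ∀ x, δ (γ x) = x) : Proj ℬ ≅ Proj 𝒜 where
  hom := Proj.map γ (irrelevant_le_map_of_rightInverse γ δ h)
  inv := Proj.map δ (irrelevant_le_map_of_rightInverse δ γ h')
  hom_inv_id := by
    rw [← Proj.map_comp, ← Proj.map_id]
    congr 1
    ext x
    exact h x
  inv_hom_id := by
    rw [← Proj.map_comp, ← Proj.map_id]
    congr 1
    ext x
    exact h' x

lemma map_toSpecZero (γ : 𝒜 →+*ᵍ ℬ)
    (hγ : HomogeneousIdeal.irrelevant ℬ ≤ (HomogeneousIdeal.irrelevant 𝒜).map γ)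
    {K : Type u} [CommRing K] (a : K →+* 𝒜 0) (b : K →+* ℬ 0) (hab : ∀ c, γ (a c) = b c) :
    Proj.map γ hγ ≫ Proj.toSpecZero 𝒜 ≫ Spec.map (CommRingCat.ofHom a) =
      Proj.toSpecZero ℬ ≫ Spec.map (CommRingCat.ofHom b) := by
  refine (Proj.mapAffineOpenCover γ hγ).openCover.hom_ext _ _ fun s ↦ ?_
  obtain ⟨d, s⟩ := s
  change Proj.awayι ℬ (γ s) (GradedRingHom.map_mem γ s.2) d.pos ≫ _ =
    Proj.awayι ℬ (γ s) (GradedRingHom.map_mem γ s.2) d.pos ≫ _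
  rw [Proj.awayι_comp_map_assoc γ hγ d.pos s s.2, Proj.awayι_toSpecZero_assoc,
    Proj.awayι_toSpecZero_assoc, ← Spec.map_comp, ← Spec.map_comp, ← Spec.map_comp,
    ← CommRingCat.ofHom_comp, ← CommRingCat.ofHom_comp, ← CommRingCat.ofHom_comp]
  congr 2
  ext c
  simp only [RingHom.comp_apply]
  rw [show fromZeroRingHom 𝒜 (Submonoid.powers s.1) (a c) =
    Away.mk 𝒜 s.2 0 (a c).1 (by simp) by
      ext; rw [Away.val_mk]; simp only [pow_zero]; rfl, Away.map_mk, Away.val_mk, hab]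
  simp only [pow_zero]
  rfl

end ProjIso

section ProjectiveSpaces

open MvPolynomial

attribute [local instance] MvPolynomial.gradedAlgebra

variable {k : Type u} [Field k] {σ τ : Type}

namespace ProjSp

/-- A homogeneous algebra homomorphism between polynomial rings, as a graded homomorphism. -/
noncomputable def gradedHom (e : MvPolynomial σ k →ₐ[k] MvPolynomial τ k)
    (he : ∀ i, (e (X i)).IsHomogeneous 1) :
    GradedRingHom (homogeneousSubmodule σ k) (homogeneousSubmodule τ k) where
  __ := (e : MvPolynomial σ k →+* MvPolynomial τ k)
  map_mem {d x} hx := by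
    have h : e = aeval fun i => e (X i) := by ext; simp
    have := IsHomogeneous.aeval (φ := x) hx (fun i => e (X i)) he
    rw [← h, one_mul] at this
    exact this

/-- The isomorphism of projective spaces given by a linear change of coordinates. -/
noncomputable def isoOfAlgEquiv (e : MvPolynomial σ k ≃ₐ[k] MvPolynomial τ k)
    (he : ∀ i, (e (X i)).IsHomogeneous 1) (he' : ∀ i, (e.symm (X i)).IsHomogeneous 1) :
    ProjSp k τ ≅ ProjSp k σ :=
  projIso (gradedHom e.toAlgHom he) (gradedHom e.symm.toAlgHom he')
    e.apply_symm_apply e.symm_apply_apply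

section

variable (e : MvPolynomial σ k ≃ₐ[k] MvPolynomial τ k)
    (he : ∀ i, (e (X i)).IsHomogeneous 1) (he' : ∀ i, (e.symm (X i)).IsHomogeneous 1)

lemma isoOfAlgEquiv_toSpec : (isoOfAlgEquiv e he he').hom ≫ toSpec k σ = toSpec k τ :=
  map_toSpecZero _ _ _ _ fun c => e.commutes c

lemma isoOfAlgEquiv_preimage (F : MvPolynomial σ k) :
    (isoOfAlgEquiv e he he').hom ⁻¹ᵁ Proj.basicOpen _ F = Proj.basicOpen _ (e F) := rfl

lemma pt_isoOfAlgEquiv {R : Type u} [CommRing R] (j : τ) (i : σ) (φ : MvPolynomial τ k →+* R)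
    (h : IsUnit (φ (X j))) (h' : IsUnit (φ.comp (e : MvPolynomial σ k →+* MvPolynomial τ k) (X i))) :
    pt j φ h ≫ (isoOfAlgEquiv e he he').hom = pt i (φ.comp (e : MvPolynomial σ k →+* MvPolynomial τ k)) h' := by
  rw [pt, projPoint_eq _ _ (he i) one_pos φ h h']
  exact projPoint_map _ _ (gradedHom e.toAlgHom he) _ _ _

end

lemma exists_basicOpen_le {O : (ProjSp k σ).Opens} {x : ProjSp k σ} (hx : x ∈ O) :
    ∃ (m : ℕ) (F : MvPolynomial σ k), 0 < m ∧ F.IsHomogeneous m ∧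
      x ∈ Proj.basicOpen (homogeneousSubmodule σ k) F ∧
      Proj.basicOpen (homogeneousSubmodule σ k) F ≤ O := by
  obtain ⟨_, ⟨f, rfl⟩, hxf, hfO⟩ := TopologicalSpace.Opens.isBasis_iff_nbhd.1
    (Proj.isBasis_basicOpen (homogeneousSubmodule σ k)) hx
  obtain ⟨j, hj⟩ := exists_mem_D x
  rw [Proj.basicOpen_eq_iSup_proj, TopologicalSpace.Opens.mem_iSup] at hxf
  obtain ⟨d, hd⟩ := hxf
  have hF : (GradedRing.proj (homogeneousSubmodule σ k) d f).IsHomogeneous d := by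
    rw [GradedRing.proj_apply]
    exact (DirectSum.decompose (homogeneousSubmodule σ k) f d).2
  -- The extra factor `X j` makes the degree positive even when `d = 0`.
  refine ⟨d + 1, GradedRing.proj (homogeneousSubmodule σ k) d f * X j, by omega,
    hF.mul (isHomogeneous_X k j), ?_, ?_⟩
  · rw [Proj.basicOpen_mul]
    exact ⟨hd, hj⟩
  · rw [Proj.basicOpen_mul]
    refine inf_le_left.trans (le_trans ?_ hfO)
    rw [Proj.basicOpen_eq_iSup_proj _ f]
    exact le_iSup (fun i => Proj.basicOpen (homogeneousSubmodule σ k)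
      (GradedRing.proj (homogeneousSubmodule σ k) i f)) d

/-- A monomial involving no variable other than `X i` is a power of `X i`, and homogeneity fixes its
exponent to `m`. -/
lemma sub_monomial_mem_span [DecidableEq σ] {m : ℕ} {G : MvPolynomial σ k}
    (hG : G.IsHomogeneous m) (i : σ) :
    G - monomial (Finsupp.single i m) (coeff (Finsupp.single i m) G) ∈
      Ideal.span (X '' {l : σ | l ≠ i} : Set (MvPolynomial σ k)) := by
  rw [mem_ideal_span_X_image]
  intro s hs
  by_contra! H
  have hsi : s = Finsupp.single i (s i) := by
    ext l
    by_cases hl : l = i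
    · subst hl; simp
    · simp [H l hl, Ne.symm hl]
  rw [mem_support_iff, coeff_sub, coeff_monomial] at hs
  split_ifs at hs with h
  · rw [← h, sub_self] at hs
    exact hs rfl
  · rw [sub_zero] at hs
    have h1 := hG hs
    apply h
    rw [hsi, Finsupp.weight_apply] at h1
    simp at h1
    rw [hsi, ← h1]

/-- Choose a homogeneous `F` whose nonvanishing locus lies in `O`. A matrix moves the `i`-th
coordinate point to its `i`-th column, so an invertible matrix with `F` nonzero on every column
suffices. The condition on `z` describes the coordinate point without naming it. -/
lemma exists_linear_iso [Infinite k] [Finite σ] (O : (ProjSp k σ).Opens)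
    (hO : (O : Set (ProjSp k σ)).Nonempty) :
    ∃ g : ProjSp k σ ≅ ProjSp k σ, g.hom ≫ toSpec k σ = toSpec k σ ∧
      ∀ i, ∀ z, (∀ l, l ≠ i → z ∉ D l) → g.hom z ∈ O := by
  classical
  have := Fintype.ofFinite σ
  obtain ⟨x, hx⟩ := hO
  obtain ⟨m, F, hm, hF, hxF, hFO⟩ := exists_basicOpen_le hx
  have hF0 : F ≠ 0 := by rintro rfl; simp at hxF
  -- The determinant times the values of `F` on the columns, as a polynomial in the matrix entries;
  -- over an infinite field a nonzero polynomial is nonzero at some matrix.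
  let P : MvPolynomial (σ × σ) k := (Matrix.mvPolynomialX σ σ k).det *
    ∏ i, rename (fun l => (l, i)) F
  have hP : P ≠ 0 := by
    refine mul_ne_zero (Matrix.det_mvPolynomialX_ne_zero σ k) (Finset.prod_ne_zero_iff.2 fun i _ => ?_)
    exact (map_ne_zero_iff _ (rename_injective _ (Prod.mk_left_injective i))).2 hF0
  obtain ⟨M', hM'⟩ : ∃ M' : σ × σ → k, eval M' P ≠ 0 := by
    by_contra! H
    exact hP (MvPolynomial.funext fun x => by rw [H, map_zero])
  let M : Matrix σ σ k := fun a b => M' (a, b)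
  rw [map_mul, map_prod, mul_ne_zero_iff, Finset.prod_ne_zero_iff] at hM'
  have hdet : M.det ≠ 0 := by
    have := hM'.1
    rwa [RingHom.map_det, show (eval M').mapMatrix (Matrix.mvPolynomialX σ σ k) = M by
      ext a b; simp [M, Matrix.mvPolynomialX]] at this
  have hcol (i : σ) : eval (fun l => M l i) F ≠ 0 := by
    have := hM'.2 i (Finset.mem_univ i)
    rwa [eval_rename] at this
  have hMM : M * M⁻¹ = 1 := Matrix.mul_nonsing_inv _ hdet.isUnit
  have hMM' : M⁻¹ * M = 1 := Matrix.nonsing_inv_mul _ hdet.isUnit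
  let e : MvPolynomial σ k ≃ₐ[k] MvPolynomial σ k :=
    AlgEquiv.ofAlgHom (aeval M.toMvPolynomial) (aeval M⁻¹.toMvPolynomial)
      (by
        ext1 i
        have := Matrix.toMvPolynomial_mul M⁻¹ M i
        rw [hMM', Matrix.toMvPolynomial_one] at this
        rw [AlgHom.comp_apply, aeval_X, AlgHom.id_apply]; exact this.symm)
      (by
        ext1 i
        have := Matrix.toMvPolynomial_mul M M⁻¹ i
        rw [hMM, Matrix.toMvPolynomial_one] at this
        rw [AlgHom.comp_apply, aeval_X, AlgHom.id_apply]; exact this.symm)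
  have he (i : σ) : (e (X i)).IsHomogeneous 1 := by
    simpa [e] using Matrix.toMvPolynomial_isHomogeneous M i
  have he' (i : σ) : (e.symm (X i)).IsHomogeneous 1 := by
    simpa [e] using Matrix.toMvPolynomial_isHomogeneous M⁻¹ i
  refine ⟨isoOfAlgEquiv e he he', isoOfAlgEquiv_toSpec e he he', fun i z hz => hFO ?_⟩
  change z ∈ (isoOfAlgEquiv e he he').hom ⁻¹ᵁ Proj.basicOpen (homogeneousSubmodule σ k) F
  rw [isoOfAlgEquiv_preimage]
  have hG : (e F).IsHomogeneous m := (gradedHom e.toAlgHom he).2 hF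
  have hspan := sub_monomial_mem_span hG i
  -- Evaluated at the `i`-th unit vector, `e F` gives this coefficient on one side and the value of
  -- `F` on the `i`-th column on the other.
  have hc : coeff (Finsupp.single i m) (e F) ≠ 0 := by
    have h1 : eval (Pi.single i 1) (e F - monomial (Finsupp.single i m)
        (coeff (Finsupp.single i m) (e F))) = 0 := by
      have : Ideal.span (X '' {l : σ | l ≠ i} : Set (MvPolynomial σ k)) ≤
          RingHom.ker (eval (Pi.single i 1 : σ → k)) := by
        rw [Ideal.span_le]
        rintro _ ⟨l, hl, rfl⟩
        simp [RingHom.mem_ker, Pi.single_eq_of_ne hl]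
      exact this hspan
    rw [map_sub, eval_monomial, sub_eq_zero] at h1
    simp only [Finsupp.prod_single_index, pow_zero, Pi.single_eq_same, one_pow, mul_one] at h1
    rw [← h1]
    have h2 : eval (Pi.single i 1) (e F) = eval (fun l => M l i) F := by
      have : (eval (Pi.single i 1 : σ → k)).comp (e : MvPolynomial σ k →+* _) =
          eval (fun l => M l i) := by
        ext l
        · simpa using congrArg (eval (Pi.single i 1)) (e.commutes l)
        · simp [e, Matrix.toMvPolynomial_eval_eq_apply]
      exact DFunLike.congr_fun this F
    rw [h2]
    exact hcol i
  -- If `e F` vanished at `z`, where all coordinates but the `i`-th vanish, then so would `X i ^ m`,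
  -- leaving no nonzero coordinate.
  intro hmem
  have hle : Ideal.span (X '' {l : σ | l ≠ i} : Set (MvPolynomial σ k)) ≤
      z.asHomogeneousIdeal.toIdeal := by
    rw [Ideal.span_le]
    rintro _ ⟨l, hl, rfl⟩
    by_contra hl'
    exact hz l hl hl'
  have h3 : monomial (Finsupp.single i m) (coeff (Finsupp.single i m) (e F)) ∈
      z.asHomogeneousIdeal.toIdeal := by
    have := Ideal.sub_mem z.asHomogeneousIdeal.toIdeal hmem (hle hspan)
    rwa [sub_sub_cancel] at this
  obtain ⟨l, hl⟩ := exists_mem_D z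
  obtain rfl : l = i := by
    by_contra hli
    exact hz l hli hl
  apply hl
  have h4 : X l ^ m ∈ z.asHomogeneousIdeal.toIdeal := by
    have := Ideal.mul_mem_left _ (C (coeff (Finsupp.single l m) (e F))⁻¹) h3
    rwa [C_mul_monomial, inv_mul_cancel₀ hc, ← X_pow_eq_monomial] at this
  exact z.isPrime.mem_of_pow_mem _ h4

end ProjSp

end ProjectiveSpaces

end GeomFibration

namespace GeomFibration

/-! ### Standard charts and the projection from a coordinate point -/

section ProjectiveCharts

open MvPolynomial

attribute [local instance] MvPolynomial.gradedAlgebra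

variable {k : Type u} [Field k] {σ τ : Type}

namespace ProjSp

open scoped Classical in
/-- Dehomogenisation with respect to the coordinate `j`. -/
noncomputable def dehom (k : Type u) [Field k] {σ : Type} (j : σ) : MvPolynomial σ k →ₐ[k] MvPolynomial {l : σ // l ≠ j} k :=
  aeval fun l => if h : l = j then 1 else X ⟨l, h⟩

@[simp] lemma dehom_X_self (j : σ) : dehom k j (X j) = 1 := by simp [dehom]

@[simp] lemma dehom_X_ne {j l : σ} (h : l ≠ j) : dehom k j (X l) = X ⟨l, h⟩ := by
  simp [dehom, h]

lemma isUnit_dehom (j : σ) :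
    IsUnit ((dehom k j : MvPolynomial σ k →+* MvPolynomial {l : σ // l ≠ j} k) (X j)) := by
  simp

/-- The standard affine chart of projective space. -/
noncomputable def chart (k : Type u) [Field k] {σ : Type} (j : σ) : Spec (.of (MvPolynomial {l : σ // l ≠ j} k)) ⟶ ProjSp k σ :=
  pt j (dehom k j : MvPolynomial σ k →+* MvPolynomial {l : σ // l ≠ j} k) (isUnit_dehom j)

lemma isOpenImmersion_chart_and (j : σ) : ∃ _ : IsOpenImmersion (chart k j),
    (chart k j).opensRange = D j :=
  isOpenImmersion_pt j (dehom k j) (rename Subtype.val) (dehom_X_self j)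
    (fun r => by
      have : (dehom k j).comp (rename Subtype.val) = AlgHom.id k (MvPolynomial {l : σ // l ≠ j} k) := by
        ext l
        rw [AlgHom.comp_apply, rename_X, dehom_X_ne l.2, AlgHom.id_apply]
      exact DFunLike.congr_fun this r)
    (fun l hl => by rw [dehom_X_ne hl, rename_X]) _

instance (j : σ) : IsOpenImmersion (chart k j) := (isOpenImmersion_chart_and j).1

lemma opensRange_chart (j : σ) : (chart k j).opensRange = D j :=
  (isOpenImmersion_chart_and j).2

lemma range_chart (j : σ) : Set.range (chart k j) = (D (k := k) j : Set (ProjSp k σ)) :=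
  congrArg (fun U : (ProjSp k σ).Opens => (U : Set (ProjSp k σ))) (opensRange_chart j)

lemma isAffineOpen_D (j : σ) : IsAffineOpen (D (k := k) j) := by
  rw [← opensRange_chart]
  exact isAffineOpen_opensRange _

lemma exists_chart (x : ProjSp k σ) : ∃ j y, chart k j y = x := by
  obtain ⟨j, hj⟩ := exists_mem_D x
  rw [← SetLike.mem_coe, ← range_chart] at hj
  exact ⟨j, hj⟩

instance : IsReduced (ProjSp k σ) := by
  have (x : ProjSp k σ) : _root_.IsReduced ((ProjSp k σ).presheaf.stalk x) := by
    obtain ⟨j, y, rfl⟩ := exists_chart x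
    have := (inferInstance : _root_.IsReduced
      ((Spec (.of (MvPolynomial {l : σ // l ≠ j} k))).presheaf.stalk y))
    exact isReduced_of_injective _ (ConcreteCategory.bijective_of_isIso
      ((chart k j).stalkMap y)).1
  exact isReduced_of_isReduced_stalk _

instance irreducibleSpace_projSp [Nonempty σ] : IrreducibleSpace (ProjSp k σ) := by
  let z : ProjectiveSpectrum (homogeneousSubmodule σ k) :=
    { asHomogeneousIdeal := ⊥
      isPrime := by
        rw [HomogeneousIdeal.toIdeal_bot]
        exact Ideal.isPrime_bot
      not_irrelevant_le := by
        intro h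
        obtain ⟨j⟩ := ‹Nonempty σ›
        have hX : (X j : MvPolynomial σ k) ∈
            HomogeneousIdeal.irrelevant (homogeneousSubmodule σ k) := by
          rw [HomogeneousIdeal.mem_irrelevant_iff, GradedRing.proj_apply,
            DirectSum.decompose_of_mem_ne (i := 1) _ (X_mem j) one_ne_zero]
        have h0 := h hX
        rw [← HomogeneousIdeal.mem_iff, HomogeneousIdeal.toIdeal_bot, Ideal.mem_bot] at h0
        exact X_ne_zero j h0 }
  have hz : closure {z} = (Set.univ : Set (ProjectiveSpectrum (homogeneousSubmodule σ k))) := by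
    refine Set.eq_univ_of_forall fun x => ?_
    rw [← ProjectiveSpectrum.le_iff_mem_closure]
    exact (bot_le : (⊥ : HomogeneousIdeal _) ≤ x.asHomogeneousIdeal)
  have hi : IsIrreducible (Set.univ : Set (ProjectiveSpectrum (homogeneousSubmodule σ k))) := by
    rw [← hz]
    exact isIrreducible_singleton.closure
  exact (irreducibleSpace_def _).2 hi

instance isIntegral_projSp [Nonempty σ] : IsIntegral (ProjSp k σ) :=
  isIntegral_of_irreducibleSpace_of_isReduced _

section

variable {R : Type u} [CommRing R]

lemma basicOpen_eq_top_iff_isUnit {r : R} : PrimeSpectrum.basicOpen r = ⊤ ↔ IsUnit r := by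
  rw [eq_top_iff, ← PrimeSpectrum.basicOpen_one, PrimeSpectrum.basicOpen_le_basicOpen_iff,
    ← Ideal.eq_top_iff_one, Ideal.radical_eq_top, Ideal.span_singleton_eq_top]

lemma range_pt_subset (j : σ) (φ : MvPolynomial σ k →+* R) (h : IsUnit (φ (X j))) :
    Set.range (pt j φ h) ⊆ (D (k := k) j : Set (ProjSp k σ)) := by
  rintro _ ⟨x, rfl⟩
  have : x ∈ pt j φ h ⁻¹ᵁ D j := by
    rw [pt_preimage_D, basicOpen_eq_top_iff_isUnit.2 h]
    trivial
  exact this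

lemma pt_injective (j : σ) (φ φ' : MvPolynomial σ k →+* R) (h : IsUnit (φ (X j)))
    (h' : IsUnit (φ' (X j))) (H : pt j φ h = pt j φ' h') :
    (∀ c, φ' (C c) = φ (C c)) ∧ ∀ l, φ' (X l) * φ (X j) = φ (X l) * φ' (X j) := by
  rw [pt, pt, projPoint, projPoint, cancel_mono] at H
  have H' := congrArg CommRingCat.Hom.hom (Spec.map_injective H)
  simp only [CommRingCat.hom_ofHom] at H'
  constructor
  · intro c
    have hc : C c ∈ homogeneousSubmodule σ k (0 • 1) := isHomogeneous_C σ c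
    rw [← awayLift_mk φ h (X_mem j) 0 (C c) hc, ← awayLift_mk φ' h' (X_mem j) 0 (C c) hc, H']
    simp
  · intro l
    have hl : X l ∈ homogeneousSubmodule σ k (1 • 1) := isHomogeneous_X k l
    rw [← awayLift_mk φ h (X_mem j) 1 (X l) hl, ← awayLift_mk φ' h' (X_mem j) 1 (X l) hl, H']
    ring

/-- The preimage of `D j` is everything for one presentation, hence for the other, so both can be
normalised by `X j` and compared through the ratios of coordinates. -/
lemma exists_smul_of_pt_eq (i j : σ) (φ φ' : MvPolynomial σ k →+* R) (h : IsUnit (φ (X i)))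
    (h' : IsUnit (φ' (X j))) (H : pt i φ h = pt j φ' h') :
    IsUnit (φ (X j)) ∧ (∀ c, φ' (C c) = φ (C c)) ∧ ∃ u, ∀ l, φ' (X l) = u * φ (X l) := by
  have hj : IsUnit (φ (X j)) := by
    have h1 := pt_preimage_D i j φ h
    rw [H, pt_preimage_D, basicOpen_eq_top_iff_isUnit.2 h'] at h1
    exact basicOpen_eq_top_iff_isUnit.1 h1.symm
  rw [pt_eq i j φ h hj] at H
  obtain ⟨h1, h2⟩ := pt_injective j φ φ' hj h' H
  refine ⟨hj, h1, φ' (X j) * ↑hj.unit⁻¹, fun l => ?_⟩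
  apply hj.mul_left_injective
  dsimp only
  have : (↑hj.unit⁻¹ : R) * φ (X j) = 1 := hj.val_inv_mul
  linear_combination h2 l - φ (X l) * φ' (X j) * this

/-- The ring homomorphism on the standard chart through which `pt j φ` factors. -/
noncomputable def chartPt (j : σ) (φ : MvPolynomial σ k →+* R) (h : IsUnit (φ (X j))) :
    MvPolynomial {l : σ // l ≠ j} k →+* R :=
  eval₂Hom (φ.comp C) fun l => ↑h.unit⁻¹ * φ (X l.1)

lemma SpecMap_chartPt (j : σ) (φ : MvPolynomial σ k →+* R) (h : IsUnit (φ (X j))) :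
    Spec.map (CommRingCat.ofHom (chartPt j φ h)) ≫ chart k j = pt j φ h := by
  rw [chart, SpecMap_pt]
  symm
  refine pt_eq_of_smul j _ _ _ _ (↑h.unit⁻¹) (fun r => ?_) fun i => ?_
  · simp [chartPt, dehom]
  · by_cases hi : i = j
    · subst hi
      simp
    · simp [hi, chartPt]

end

/-- The complement of the point at which all coordinates `X (some t)` vanish. -/
noncomputable def projDomain (k : Type u) [Field k] (τ : Type) : (ProjSp k (Option τ)).Opens :=
  ⨆ t : τ, D (some t)

lemma D_le_projDomain (t : τ) : D (some t) ≤ projDomain k τ :=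
  le_iSup (fun t : τ => D (k := k) (some t)) t

lemma mem_projDomain {x : ProjSp k (Option τ)} : x ∈ projDomain k τ ↔ ∃ t, x ∈ D (some t) := by
  simp [projDomain]

/-- Lift of a morphism landing in a standard open to the domain of the projection. -/
noncomputable def liftProjDomain {T : Scheme.{u}} (a : T ⟶ ProjSp k (Option τ)) (t : τ)
    (h : Set.range a ⊆ (D (k := k) (some t) : Set (ProjSp k (Option τ)))) :
    T ⟶ (projDomain k τ).toScheme :=
  IsOpenImmersion.lift (projDomain k τ).ι a (by
    rw [Scheme.Opens.range_ι]
    exact h.trans (D_le_projDomain t))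

@[simp]
lemma liftProjDomain_ι {T : Scheme.{u}} (a : T ⟶ ProjSp k (Option τ)) (t : τ)
    (h : Set.range a ⊆ (D (k := k) (some t) : Set (ProjSp k (Option τ)))) :
    liftProjDomain a t h ≫ (projDomain k τ).ι = a :=
  IsOpenImmersion.lift_fac _ _ _

@[simp]
lemma liftProjDomain_ι_assoc {T Y : Scheme.{u}} (a : T ⟶ ProjSp k (Option τ)) (t : τ)
    (h : Set.range a ⊆ (D (k := k) (some t) : Set (ProjSp k (Option τ))))
    (f : ProjSp k (Option τ) ⟶ Y) :
    liftProjDomain a t h ≫ (projDomain k τ).ι ≫ f = a ≫ f := by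
  rw [← Category.assoc, liftProjDomain_ι]

/-- The cover of the domain of the projection by standard charts. -/
noncomputable def projDomainCover (k : Type u) [Field k] (τ : Type) :
    (projDomain k τ).toScheme.AffineOpenCover where
  I₀ := τ
  X t := .of (MvPolynomial {l : Option τ // l ≠ some t} k)
  f t := liftProjDomain (chart k (some t)) t (range_chart _).le
  map_prop t := by
    have : IsOpenImmersion (liftProjDomain (chart k (some t)) t (range_chart _).le ≫
        (projDomain k τ).ι) := by
      rw [liftProjDomain_ι]; infer_instance
    exact IsOpenImmersion.of_comp _ (projDomain k τ).ι
  idx x := (mem_projDomain.1 x.2).choose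
  covers x := by
    have h := (mem_projDomain.1 x.2).choose_spec
    rw [← SetLike.mem_coe, ← range_chart] at h
    obtain ⟨y, hy⟩ := h
    refine ⟨y, (projDomain k τ).ι.injective ?_⟩
    rw [← Scheme.Hom.comp_apply, liftProjDomain_ι, hy]
    rfl

lemma projDomain_hom_ext {Y : Scheme.{u}} {f g : (projDomain k τ).toScheme ⟶ Y}
    (h : ∀ t, liftProjDomain (chart k (some t)) t (range_chart _).le ≫ f =
      liftProjDomain (chart k (some t)) t (range_chart _).le ≫ g) : f = g :=
  (projDomainCover k τ).openCover.hom_ext _ _ h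

lemma exists_liftProjDomain_chart (x : (projDomain k τ).toScheme) :
    ∃ t y, liftProjDomain (chart k (some t)) t (range_chart _).le y = x :=
  (projDomainCover k τ).openCover.exists_eq x

/-- The inclusion of polynomial rings obtained by adding one variable. -/
noncomputable def renameSome (k : Type u) [Field k] (τ : Type) :
    MvPolynomial τ k →+* MvPolynomial (Option τ) k :=
  (rename some : MvPolynomial τ k →ₐ[k] MvPolynomial (Option τ) k).toRingHom

@[simp] lemma renameSome_X (t : τ) : renameSome k τ (X t) = X (some t) := rename_X _ _

@[simp] lemma renameSome_C (c : k) : renameSome k τ (C c) = C c := rename_C _ _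

@[simp] lemma comp_renameSome_X {R : Type*} [CommRing R] (φ : MvPolynomial (Option τ) k →+* R)
    (t : τ) : φ.comp (renameSome k τ) (X t) = φ (X (some t)) := by
  rw [RingHom.comp_apply, renameSome_X]

@[simp] lemma comp_renameSome_C {R : Type*} [CommRing R] (φ : MvPolynomial (Option τ) k →+* R)
    (c : k) : φ.comp (renameSome k τ) (C c) = φ (C c) := by
  rw [RingHom.comp_apply, renameSome_C]

/-- The projection on a standard chart. -/
noncomputable def projChart (k : Type u) [Field k] {τ : Type} (t : τ) :
    Spec (.of (MvPolynomial {l : Option τ // l ≠ some t} k)) ⟶ ProjSp k τ :=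
  pt t ((dehom k (some t) : MvPolynomial (Option τ) k →+* MvPolynomial {l // l ≠ some t} k).comp
      (renameSome k τ)) (by rw [comp_renameSome_X]; exact isUnit_dehom _)

/-- Equal points have proportional coordinates, and proportionality survives dropping one
coordinate. This is the gluing condition for `proj`. -/
lemma projChart_compat_Spec {S : Type u} [CommRing S] (i j : τ)
    (α : MvPolynomial {l : Option τ // l ≠ some i} k →+* S)
    (β : MvPolynomial {l : Option τ // l ≠ some j} k →+* S)
    (h : Spec.map (CommRingCat.ofHom α) ≫ chart k (some i) =
      Spec.map (CommRingCat.ofHom β) ≫ chart k (some j)) :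
    Spec.map (CommRingCat.ofHom α) ≫ projChart k i =
      Spec.map (CommRingCat.ofHom β) ≫ projChart k j := by
  rw [chart, chart, SpecMap_pt, SpecMap_pt] at h
  obtain ⟨h1, h2, c, h3⟩ := exists_smul_of_pt_eq _ _ _ _ _ _ h
  rw [projChart, projChart, SpecMap_pt, SpecMap_pt]
  refine (pt_eq i j _ _ (by rw [← RingHom.comp_assoc, comp_renameSome_X]; exact h1)).trans ?_
  refine pt_eq_of_smul j _ _ _ _ c (fun r => ?_) fun l => ?_
  · rw [← RingHom.comp_assoc, comp_renameSome_C, ← RingHom.comp_assoc, comp_renameSome_C]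
    exact h2 r
  · rw [← RingHom.comp_assoc, comp_renameSome_X, ← RingHom.comp_assoc, comp_renameSome_X]
    exact h3 (some l)

lemma projChart_compat {T : Scheme.{u}} (i j : τ)
    (a : T ⟶ Spec (.of (MvPolynomial {l : Option τ // l ≠ some i} k)))
    (b : T ⟶ Spec (.of (MvPolynomial {l : Option τ // l ≠ some j} k)))
    (h : a ≫ chart k (some i) = b ≫ chart k (some j)) :
    a ≫ projChart k i = b ≫ projChart k j := by
  refine T.affineCover.hom_ext _ _ fun x => ?_
  have key : ∀ {S : CommRingCat.{u}} (c : Spec S ⟶ T),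
      c ≫ a ≫ projChart k i = c ≫ b ≫ projChart k j := by
    intro S c
    have h' := congrArg (c ≫ ·) h
    simp only [← Category.assoc] at h' ⊢
    obtain ⟨α, hα⟩ := Spec.map_surjective (c ≫ a)
    obtain ⟨β, hβ⟩ := Spec.map_surjective (c ≫ b)
    rw [← hα, ← hβ] at h' ⊢
    exact projChart_compat_Spec i j α.hom β.hom h'
  exact key _

lemma projChart_compat_of_lift {T : Scheme.{u}} (i j : τ)
    (a : T ⟶ Spec (.of (MvPolynomial {l : Option τ // l ≠ some i} k)))
    (b : T ⟶ Spec (.of (MvPolynomial {l : Option τ // l ≠ some j} k)))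
    (h : a ≫ liftProjDomain (chart k (some i)) i (range_chart _).le =
      b ≫ liftProjDomain (chart k (some j)) j (range_chart _).le) :
    a ≫ projChart k i = b ≫ projChart k j := by
  apply projChart_compat
  have := congrArg (· ≫ (projDomain k τ).ι) h
  simpa only [Category.assoc, liftProjDomain_ι] using this

/-- The linear projection away from a coordinate point. -/
noncomputable def proj (k : Type u) [Field k] (τ : Type) :
    (projDomain k τ).toScheme ⟶ ProjSp k τ :=
  (projDomainCover k τ).openCover.glueMorphisms (fun t => projChart k t) fun i j => by
    exact projChart_compat_of_lift i j _ _ Limits.pullback.condition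

lemma liftProjDomain_chart_proj (t : τ) :
    liftProjDomain (chart k (some t)) t (range_chart _).le ≫ proj k τ = projChart k t :=
  (projDomainCover k τ).openCover.ι_glueMorphisms _ _ t

lemma liftProjDomain_chart_proj_assoc {Y : Scheme.{u}} (t : τ) (f : ProjSp k τ ⟶ Y) :
    liftProjDomain (chart k (some t)) t (range_chart _).le ≫ proj k τ ≫ f =
      projChart k t ≫ f := by
  rw [← Category.assoc, liftProjDomain_chart_proj]

lemma pt_proj {R : Type u} [CommRing R] (t : τ) (φ : MvPolynomial (Option τ) k →+* R)
    (h : IsUnit (φ (X (some t)))) (a : Spec (.of R) ⟶ (projDomain k τ).toScheme)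
    (ha : a ≫ (projDomain k τ).ι = pt (some t) φ h) :
    a ≫ proj k τ = pt t (φ.comp (renameSome k τ))
      (by rwa [comp_renameSome_X]) := by
  have : a = Spec.map (CommRingCat.ofHom (chartPt (some t) φ h)) ≫
      liftProjDomain (chart k (some t)) t (range_chart _).le := by
    rw [← cancel_mono (projDomain k τ).ι, ha, Category.assoc, liftProjDomain_ι, SpecMap_chartPt]
  rw [this, Category.assoc, liftProjDomain_chart_proj, projChart, SpecMap_pt]
  symm
  refine pt_eq_of_smul t _ _ _ _ (↑h.unit⁻¹) (fun r => ?_) fun l => ?_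
  · rw [← RingHom.comp_assoc, comp_renameSome_C, comp_renameSome_C]
    simp [chartPt, dehom]
  · rw [← RingHom.comp_assoc, comp_renameSome_X, comp_renameSome_X]
    by_cases hl : l = t
    · subst hl
      simp
    · simp [hl, chartPt]

lemma proj_toSpec : proj k τ ≫ toSpec k τ = (projDomain k τ).ι ≫ toSpec k (Option τ) := by
  refine projDomain_hom_ext fun t => ?_
  rw [liftProjDomain_chart_proj_assoc, liftProjDomain_ι_assoc, projChart, chart, pt_toSpec,
    pt_toSpec]
  congr 2
  ext r : 1
  rw [RingHom.comp_apply, comp_renameSome_C, RingHom.comp_apply]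

lemma proj_preimage_D (t : τ) :
    proj k τ ⁻¹ᵁ D t = (projDomain k τ).ι ⁻¹ᵁ D (some t) := by
  ext1
  ext x
  obtain ⟨i, y, rfl⟩ := exists_liftProjDomain_chart x
  change y ∈ liftProjDomain (chart k (some i)) i (range_chart _).le ⁻¹ᵁ proj k τ ⁻¹ᵁ D t ↔
    y ∈ liftProjDomain (chart k (some i)) i (range_chart _).le ⁻¹ᵁ (projDomain k τ).ι ⁻¹ᵁ
      D (some t)
  rw [← Scheme.Hom.comp_preimage, ← Scheme.Hom.comp_preimage, liftProjDomain_chart_proj,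
    liftProjDomain_ι, projChart, chart, pt_preimage_D, pt_preimage_D, comp_renameSome_X]

/-- The preimage of a standard open is the standard open of the same coordinate upstairs. Affineness
upgrades properness of a projected morphism to finiteness. -/
instance isAffineHom_proj : IsAffineHom (proj k τ) := by
  apply isAffineHom_of_forall_exists_isAffineOpen
  intro x
  obtain ⟨t, ht⟩ := exists_mem_D x
  refine ⟨D t, ht, isAffineOpen_D t, ?_⟩
  rw [proj_preimage_D]
  refine (isAffineOpen_D (some t)).preimage_of_isOpenImmersion _ ?_
  rw [Scheme.Opens.opensRange_ι]
  exact D_le_projDomain t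

end ProjSp

end ProjectiveCharts

end GeomFibration

namespace GeomFibration

/-! ### Projective Noether normalisation and dimension -/

section NoetherNormalization

open MvPolynomial

attribute [local instance] MvPolynomial.gradedAlgebra

variable {k : Type u} [Field k] {σ τ : Type}

namespace ProjSp

/-- The isomorphism of projective spaces obtained by renaming coordinates. -/
noncomputable def renameIso (k : Type u) [Field k] (e : σ ≃ τ) : ProjSp k τ ≅ ProjSp k σ :=
  isoOfAlgEquiv (renameEquiv k e) (fun i => by simpa using isHomogeneous_X k (e i))
    (fun i => by simpa using isHomogeneous_X k (e.symm i))

lemma renameIso_toSpec (e : σ ≃ τ) : (renameIso k e).hom ≫ toSpec k σ = toSpec k τ :=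
  isoOfAlgEquiv_toSpec _ _ _

lemma renameIso_preimage_D (e : σ ≃ τ) (i : σ) :
    (renameIso k e).hom ⁻¹ᵁ D i = D (e i) := by
  rw [renameIso, D, isoOfAlgEquiv_preimage]
  simp

lemma pt_renameIso (e : σ ≃ τ) {R : Type u} [CommRing R] (j : τ) (φ : MvPolynomial τ k →+* R)
    (h : IsUnit (φ (X j))) :
    pt j φ h ≫ (renameIso k e).hom = pt (e.symm j) (φ.comp (renameEquiv k e).toRingEquiv.toRingHom)
      (by simpa using h) :=
  pt_isoOfAlgEquiv _ _ _ _ _ _ _ _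

variable {V : Scheme.{u}}

/-- The complement of the closed image is a nonempty open set; a linear change of coordinates moves
the centre of projection into it. The projection is then defined on the image, and the composite is
proper over `k` and affine, hence finite. -/
lemma exists_isFinite_of_not_surjective [Infinite k] [Finite τ] (p : V ⟶ ProjSp k (Option τ))
    [IsFinite p] (hp : ¬ Surjective p) :
    ∃ p' : V ⟶ ProjSp k τ, IsFinite p' ∧ p' ≫ toSpec k τ = p ≫ toSpec k (Option τ) := by
  let O : (ProjSp k (Option τ)).Opens := ⟨(Set.range p)ᶜ, p.isClosedMap.isClosed_range.isOpen_compl⟩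
  obtain ⟨g, hg, hgO⟩ := exists_linear_iso O (by
    rw [surjective_iff, Function.Surjective] at hp
    push Not at hp
    obtain ⟨x, hx⟩ := hp
    exact ⟨x, fun ⟨v, hv⟩ => hx v hv⟩)
  have hrange : Set.range (p ≫ g.inv) ⊆ Set.range (projDomain k τ).ι := by
    rw [Scheme.Opens.range_ι]
    rintro _ ⟨v, rfl⟩
    by_contra hv
    refine hgO none ((p ≫ g.inv) v) (fun l hl hlD => hv ?_) ⟨v, ?_⟩
    · obtain ⟨t, rfl⟩ := Option.ne_none_iff_exists'.1 hl
      exact mem_projDomain.2 ⟨t, hlD⟩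
    · rw [← Scheme.Hom.comp_apply, Category.assoc, g.inv_hom_id, Category.comp_id]
  let a : V ⟶ (projDomain k τ).toScheme := IsOpenImmersion.lift (projDomain k τ).ι (p ≫ g.inv) hrange
  have ha : a ≫ (projDomain k τ).ι = p ≫ g.inv := IsOpenImmersion.lift_fac _ _ _
  have hover : (a ≫ proj k τ) ≫ toSpec k τ = p ≫ toSpec k (Option τ) := by
    rw [Category.assoc, proj_toSpec, reassoc_of% ha, ← Iso.eq_inv_comp g |>.2 hg]
  have : IsFinite (a ≫ (projDomain k τ).ι) := by rw [ha]; infer_instance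
  have : IsFinite a := IsFinite.of_comp a (projDomain k τ).ι
  have : Finite (Option τ) := inferInstance
  have : IsProper ((a ≫ proj k τ) ≫ toSpec k τ) := by rw [hover]; infer_instance
  have : IsProper (a ≫ proj k τ) := IsProper.of_comp _ (toSpec k τ)
  exact ⟨a ≫ proj k τ, IsFinite.iff_isProper_and_isAffineHom.2 ⟨this, inferInstance⟩, hover⟩

lemma exists_isFinite_surjective [Infinite k] [Nonempty V] (N : ℕ) (p : V ⟶ ProjSp k (Fin N))
    [IsFinite p] :
    ∃ (m : ℕ) (p' : V ⟶ ProjSp k (Fin (m + 1))), IsFinite p' ∧ Surjective p' ∧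
      p' ≫ toSpec k (Fin (m + 1)) = p ≫ toSpec k (Fin N) := by
  induction N with
  | zero =>
    -- Projective space with no coordinates is empty, so the descent must stop earlier.
    obtain ⟨v⟩ := ‹Nonempty V›
    obtain ⟨j, _⟩ := exists_mem_D (p v)
    exact j.elim0
  | succ N ih =>
    by_cases hp : Surjective p
    · exact ⟨N, p, inferInstance, hp, rfl⟩
    let e := finSuccEquiv N
    have hp' : ¬ Surjective (p ≫ (renameIso k e.symm).hom) := by
      intro h
      apply hp
      have : p = (p ≫ (renameIso k e.symm).hom) ≫ (renameIso k e.symm).inv := by simp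
      rw [this]
      infer_instance
    obtain ⟨p', h1, h2⟩ := exists_isFinite_of_not_surjective _ hp'
    obtain ⟨m, p'', h3, h4, h5⟩ := ih p'
    refine ⟨m, p'', h3, h4, ?_⟩
    rw [h5, h2, Category.assoc, renameIso_toSpec]

lemma exists_isPullback_chart (p : V ⟶ ProjSp k σ) [IsAffineHom p] (j : σ) :
    ∃ (B : CommRingCat.{u}) (c : Spec B ⟶ V)
      (ψ : CommRingCat.of (MvPolynomial {l : σ // l ≠ j} k) ⟶ B),
      IsPullback c (Spec.map ψ) p (chart k j) := by
  let W := Limits.pullback p (chart k j)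
  obtain ⟨ψ, hψ⟩ := Spec.map_surjective (W.isoSpec.inv ≫ Limits.pullback.snd p (chart k j))
  refine ⟨_, W.isoSpec.inv ≫ Limits.pullback.fst p (chart k j), ψ, ?_⟩
  rw [hψ]
  exact IsPullback.of_iso (IsPullback.of_hasPullback p (chart k j)) W.isoSpec (Iso.refl _)
    (Iso.refl _) (Iso.refl _) (by simp) (by simp) (by simp) (by simp)

section

variable {p : V ⟶ ProjSp k σ} {j : σ} {B : CommRingCat.{u}} {c : Spec B ⟶ V}
  {ψ : CommRingCat.of (MvPolynomial {l : σ // l ≠ j} k) ⟶ B}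

lemma isOpenImmersion_of_isPullback_chart
    (H : IsPullback c (Spec.map ψ) p (chart k j)) : IsOpenImmersion c :=
  MorphismProperty.of_isPullback H.flip inferInstance

lemma finite_of_isPullback_chart [IsFinite p]
    (H : IsPullback c (Spec.map ψ) p (chart k j)) : ψ.hom.Finite :=
  (IsFinite.SpecMap_iff ψ).1 (MorphismProperty.of_isPullback H inferInstance)

lemma range_of_isPullback_chart
    (H : IsPullback c (Spec.map ψ) p (chart k j)) : Set.range c = p ⁻¹' (D (k := k) j) := by
  rw [← range_chart]
  ext v
  constructor
  · rintro ⟨x, rfl⟩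
    exact ⟨Spec.map ψ x, by rw [← Scheme.Hom.comp_apply, ← H.w, Scheme.Hom.comp_apply]⟩
  · rintro ⟨y, hy⟩
    obtain ⟨z, hz, -⟩ := exists_apply_eq_of_isPullback H hy.symm
    exact ⟨z, hz⟩

lemma isDomain_of_isPullback_chart [IsIntegral V] [Surjective p]
    (H : IsPullback c (Spec.map ψ) p (chart k j)) : IsDomain B := by
  have := isOpenImmersion_of_isPullback_chart H
  obtain ⟨y⟩ := (inferInstance : Nonempty (Spec (.of (MvPolynomial {l : σ // l ≠ j} k))))
  obtain ⟨v, hv⟩ := p.surjective (chart k j y)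
  obtain ⟨z, -, -⟩ := exists_apply_eq_of_isPullback H hv
  have : Nonempty (Spec B) := ⟨z⟩
  have : IsIntegral (Spec B) := isIntegral_of_isOpenImmersion c
  exact (affine_isIntegral_iff B).1 this

lemma injective_of_isPullback_chart [Surjective p]
    (H : IsPullback c (Spec.map ψ) p (chart k j)) : Function.Injective ψ.hom := by
  have : Surjective (Spec.map ψ) := MorphismProperty.of_isPullback H inferInstance
  have h1 : DenseRange (PrimeSpectrum.comap ψ.hom) := (Spec.map ψ).surjective.denseRange
  rw [PrimeSpectrum.denseRange_comap_iff_ker_le_nilRadical, nilradical_eq_zero] at h1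
  exact (RingHom.injective_iff_ker_eq_bot _).2 (le_bot_iff.1 h1)

lemma topologicalKrullDim_of_isPullback_chart [Finite σ] [IsFinite p] [Surjective p]
    (H : IsPullback c (Spec.map ψ) p (chart k j)) :
    topologicalKrullDim (Spec B) = (Nat.card {l : σ // l ≠ j} : ℕ) := by
  have := Fintype.ofFinite {l : σ // l ≠ j}
  algebraize [ψ.hom]
  have h1 := finite_of_isPullback_chart H
  have h2 := injective_of_isPullback_chart H
  have : Module.Finite (MvPolynomial {l : σ // l ≠ j} k) B := h1
  have : FaithfulSMul (MvPolynomial {l : σ // l ≠ j} k) B :=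
    (faithfulSMul_iff_algebraMap_injective _ _).2 h2
  refine (PrimeSpectrum.topologicalKrullDim_eq_ringKrullDim B).trans ?_
  rw [ringKrullDim_eq_of_isIntegral (MvPolynomial {l : σ // l ≠ j} k) B]
  rw [MvPolynomial.ringKrullDim_of_isNoetherianRing, ringKrullDim_eq_zero_of_field, zero_add]

end

/-- Above each standard chart `p` is an injective integral extension of a polynomial ring in one
variable fewer than there are coordinates. The formula identifies the target of Noether
normalisation. -/
lemma topologicalKrullDim_eq [Finite σ] [Nonempty σ] (p : V ⟶ ProjSp k σ) [IsFinite p]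
    [Surjective p] : topologicalKrullDim V = (Nat.card σ - 1 : ℕ) := by
  have hcard (j : σ) : Nat.card {l : σ // l ≠ j} = Nat.card σ - 1 := by
    classical
    have := Fintype.ofFinite σ
    simp [Nat.card_eq_fintype_card, Fintype.card_subtype_compl]
  apply le_antisymm
  · refine topologicalKrullDim_le_of_forall_isOpenEmbedding _ fun v => ?_
    obtain ⟨j, hj⟩ := exists_mem_D (p v)
    obtain ⟨B, c, ψ, H⟩ := exists_isPullback_chart p j
    have := isOpenImmersion_of_isPullback_chart H
    refine ⟨Spec B, inferInstance, c, c.isOpenEmbedding, ?_, ?_⟩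
    · rw [range_of_isPullback_chart H]
      exact hj
    · rw [topologicalKrullDim_of_isPullback_chart H, hcard]
  · obtain ⟨j⟩ := ‹Nonempty σ›
    obtain ⟨B, c, ψ, H⟩ := exists_isPullback_chart p j
    have := isOpenImmersion_of_isPullback_chart H
    rw [← hcard j, ← topologicalKrullDim_of_isPullback_chart H]
    exact c.isOpenEmbedding.isInducing.topologicalKrullDim_le

end ProjSp

end NoetherNormalization

end GeomFibration

namespace GeomFibration

/-! ### Flatness and generic smoothness of the finite cover -/

section FiniteFlat

open MvPolynomial

variable {k : Type u} [Field k] {σ : Type}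

lemma flat_mvPolynomial_ringHom {ι : Type} [Finite ι] {B : Type u} [CommRing B] [IsDomain B]
    (ψ : MvPolynomial ι k →+* B) (hfin : ψ.Finite) (hinj : Function.Injective ψ)
    (hsmooth : (ψ.comp C).Smooth) : ψ.Flat := by
  obtain ⟨n, ⟨e⟩⟩ := Finite.exists_equiv_fin ι
  let ε : MvPolynomial ι k ≃ₐ[k] MvPolynomial (Fin n) k := renameEquiv k e
  let ψ' : MvPolynomial (Fin n) k →+* B := ψ.comp (ε.symm : MvPolynomial (Fin n) k →+* MvPolynomial ι k)
  have hψ' : ψ'.Finite := hfin.comp (RingHom.Finite.of_surjective _ ε.symm.surjective)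
  have hC : ψ'.comp C = ψ.comp C := by
    ext c
    exact congrArg ψ (ε.symm.commutes c)
  have hflat : ψ'.Flat := by
    algebraize [ψ', ψ.comp C]
    have : IsScalarTower k (MvPolynomial (Fin n) k) B := IsScalarTower.of_algebraMap_eq' hC.symm
    have : FaithfulSMul (MvPolynomial (Fin n) k) B :=
      (faithfulSMul_iff_algebraMap_injective _ _).2 (hinj.comp ε.symm.injective)
    exact flat_mvPolynomial_of_smooth n
  have : ψ = ψ'.comp (ε : MvPolynomial ι k →+* MvPolynomial (Fin n) k) :=
    RingHom.ext fun c => congrArg ψ (ε.symm_apply_apply c).symm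
  rw [this]
  exact (RingHom.Flat.of_bijective (f := (ε : MvPolynomial ι k →+* MvPolynomial (Fin n) k)) ε.bijective).comp hflat

variable {V : Scheme.{u}}

namespace ProjSp

/-- The standard affine open cover of projective space. -/
noncomputable def chartCover (k : Type u) [Field k] (σ : Type) :
    (ProjSp k σ).AffineOpenCover where
  I₀ := σ
  X j := .of (MvPolynomial {l : σ // l ≠ j} k)
  f j := chart k j
  idx x := (exists_chart x).choose
  covers x := (exists_chart x).choose_spec

lemma chart_toSpec (j : σ) : chart k j ≫ toSpec k σ = Spec.map (CommRingCat.ofHom C) := by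
  rw [chart, pt_toSpec]
  congr 2
  ext c
  simp [dehom]

lemma smooth_of_isPullback_chart {p : V ⟶ ProjSp k σ} {j : σ} {B : CommRingCat.{u}}
    {c : Spec B ⟶ V} {ψ : CommRingCat.of (MvPolynomial {l : σ // l ≠ j} k) ⟶ B}
    [Smooth (p ≫ toSpec k σ)] (H : IsPullback c (Spec.map ψ) p (chart k j)) :
    (ψ.hom.comp C).Smooth := by
  have := isOpenImmersion_of_isPullback_chart H
  have h1 : Smooth (c ≫ p ≫ toSpec k σ) := inferInstance
  rw [reassoc_of% H.w, chart_toSpec, ← Spec.map_comp] at h1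
  exact HasRingHomProperty.Spec_iff.1 h1

lemma flat_pullback_snd_chart [Finite σ] [IsIntegral V] (p : V ⟶ ProjSp k σ) [IsFinite p]
    [Surjective p] [Smooth (p ≫ toSpec k σ)] (j : σ) :
    Flat (Limits.pullback.snd p (chart k j)) := by
  obtain ⟨B, c, ψ, H⟩ := exists_isPullback_chart p j
  have := isDomain_of_isPullback_chart H
  have h1 : Flat (Spec.map ψ) := HasRingHomProperty.Spec_iff.2
    (flat_mvPolynomial_ringHom ψ.hom (finite_of_isPullback_chart H)
      (injective_of_isPullback_chart H) (smooth_of_isPullback_chart H))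
  have h2 : Limits.pullback.snd p (chart k j) = H.isoPullback.inv ≫ Spec.map ψ := by simp
  rw [h2]
  infer_instance

/-- Flatness is local on the target, and over a standard chart it is miracle flatness over a
polynomial ring. -/
lemma flat_of_isFinite [Finite σ] [IsIntegral V] (p : V ⟶ ProjSp k σ) [IsFinite p] [Surjective p]
    [Smooth (p ≫ toSpec k σ)] : Flat p := by
  have := HasRingHomProperty.instIsZariskiLocalAtTarget @Flat.{u}
  exact IsZariskiLocalAtTarget.of_openCover (P := @Flat) (chartCover k σ).openCover
    (flat_pullback_snd_chart p)

end ProjSp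

lemma of_comp_isOpenImmersion (R : MorphismProperty Scheme.{u}) [R.IsStableUnderBaseChange]
    {X Y Z : Scheme.{u}} (f : X ⟶ Y) (g : Y ⟶ Z) [IsOpenImmersion g] (h : R (f ≫ g)) : R f :=
  R.of_postcomp (W' := @IsOpenImmersion) f g inferInstance h

/-- The image of the non-smooth locus is closed because `f` is closed, and it misses the generic
point by generic smoothness; `O` is its complement. -/
lemma exists_smooth_morphismRestrict [CharZero k] {X Y : Scheme.{u}} [IsIntegral Y] (f : X ⟶ Y)
    (s : Y ⟶ Spec (.of k)) [LocallyOfFiniteType s] [Smooth (f ≫ s)] [UniversallyClosed f] :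
    ∃ O : Y.Opens, (O : Set Y).Nonempty ∧ Smooth (f ∣_ O) := by
  have : LocallyOfFiniteType f := locallyOfFiniteType_of_comp f s
  have : IsLocallyNoetherian Y := LocallyOfFiniteType.isLocallyNoetherian s
  have hcl : IsClosed (f '' (f.smoothLocus : Set X)ᶜ) :=
    f.isClosedMap _ f.smoothLocus.isOpen.isClosed_compl
  let O : Y.Opens := ⟨(f '' (f.smoothLocus : Set X)ᶜ)ᶜ, hcl.isOpen_compl⟩
  refine ⟨O, ⟨genericPoint Y, ?_⟩, ?_⟩
  · rintro ⟨x, hx, hxη⟩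
    exact hx (mem_smoothLocus_of_apply_eq_genericPoint f s x hxη)
  · have h1 : Smooth ((f ⁻¹ᵁ O).ι ≫ f) := by
      rw [← Scheme.Hom.smoothLocus_eq_top_iff, ← Scheme.Hom.preimage_smoothLocus_eq, eq_top_iff]
      intro x _
      by_contra hx
      exact x.2 ⟨x.1, hx, rfl⟩
    rw [← morphismRestrict_ι] at h1
    exact of_comp_isOpenImmersion @Smooth _ O.ι h1

end FiniteFlat

end GeomFibration

namespace GeomFibration

/-! ### Scheme-theoretic images and sections over open subsets -/

section ImageClosure

lemma isReduced_image {X Y : Scheme.{u}} (f : X ⟶ Y) [QuasiCompact f] [IsReduced X] :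
    IsReduced f.image := by
  refine ⟨fun V => ⟨fun s hs => ?_⟩⟩
  refine f.image.IsSheaf.section_ext fun x hx => ?_
  obtain ⟨_, ⟨_, ⟨U, hU, rfl⟩, rfl⟩, hxW, hWV⟩ :=
    (Y.isBasis_affineOpens.of_isInducing f.imageι.isEmbedding.isInducing).exists_subset_of_mem_open
      hx V.isOpen
  refine ⟨f.imageι ⁻¹ᵁ U, hWV, hxW, ?_⟩
  apply f.toImage_app_injective ⟨U, hU⟩
  have h : IsNilpotent (f.toImage.app (f.imageι ⁻¹ᵁ U)
      (f.image.presheaf.map (homOfLE hWV).op s)) :=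
    (hs.map (f.image.presheaf.map (homOfLE hWV).op).hom).map (f.toImage.app _).hom
  rw [map_zero, map_zero]
  exact h.eq_zero

lemma irreducibleSpace_of_isDominant {X Y : Scheme.{u}} (f : X ⟶ Y) [IsDominant f]
    [IrreducibleSpace X] : IrreducibleSpace Y := by
  have h : IsIrreducible (closure (Set.range f)) := by
    rw [← Set.image_univ]
    exact ((IrreducibleSpace.isIrreducible_univ X).image f f.continuous.continuousOn).closure
  rw [f.denseRange.closure_range] at h
  exact (irreducibleSpace_def _).2 h

lemma isIntegral_image {X Y : Scheme.{u}} (f : X ⟶ Y) [QuasiCompact f] [IsIntegral X] :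
    IsIntegral f.image := by
  have := isReduced_image f
  have := irreducibleSpace_of_isDominant f.toImage
  exact isIntegral_of_irreducibleSpace_of_isReduced _

lemma isIso_of_isClosedImmersion_of_isDominant {X Y : Scheme.{u}} (f : X ⟶ Y) [IsClosedImmersion f]
    [IsDominant f] [IsReduced Y] : IsIso f := by
  have : Surjective f := surjective_of_isDominant_of_isClosed_range f f.isClosedEmbedding.isClosed_range
  exact isIso_of_isClosedImmersion_of_surjective f

/-- A section of a separated morphism is a closed immersion; being also dominant into a reduced
scheme, it is an isomorphism onto `b ⁻¹ᵁ U`. -/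
lemma isIso_morphismRestrict_of_isDominant {Z Q : Scheme.{u}} (b : Z ⟶ Q) [IsSeparated b]
    [IsReduced Z] (U : Q.Opens) (t : U.toScheme ⟶ Z) [IsDominant t] (h : t ≫ b = U.ι) :
    IsIso (b ∣_ U) ∧ ∀ z, b z ∈ U → z ∈ Set.range t := by
  have hr : Set.range t ⊆ Set.range (b ⁻¹ᵁ U).ι := by
    rintro _ ⟨x, rfl⟩
    rw [Scheme.Opens.range_ι]
    change b (t x) ∈ U
    rw [← Scheme.Hom.comp_apply, h]
    exact x.2
  let t' := IsOpenImmersion.lift (b ⁻¹ᵁ U).ι t hr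
  have ht' : t' ≫ (b ⁻¹ᵁ U).ι = t := IsOpenImmersion.lift_fac _ _ _
  have h1 : t' ≫ (b ∣_ U) = 𝟙 _ := by
    rw [← cancel_mono U.ι, Category.assoc, morphismRestrict_ι, ← Category.assoc, ht', h,
      Category.id_comp]
  have : IsClosedImmersion (t' ≫ (b ∣_ U)) := by rw [h1]; infer_instance
  have : IsClosedImmersion t' := IsClosedImmersion.of_comp t' (b ∣_ U)
  have : IsDominant (t' ≫ (b ⁻¹ᵁ U).ι) := by rw [ht']; infer_instance
  have : IsDominant t' := IsDominant.of_comp_of_isOpenImmersion t' (b ⁻¹ᵁ U).ι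
  have := isIso_of_isClosedImmersion_of_isDominant t'
  constructor
  · rw [← IsIso.inv_eq_of_hom_inv_id h1]
    infer_instance
  · intro z hz
    obtain ⟨x, hx⟩ := t'.surjective ⟨z, hz⟩
    refine ⟨x, ?_⟩
    rw [← ht', Scheme.Hom.comp_apply, hx]
    rfl

end ImageClosure

end GeomFibration

namespace GeomFibration

/-! ### The blow-up of a coordinate point as the closure of a graph -/

section ProjectionGraph

open MvPolynomial

attribute [local instance] MvPolynomial.gradedAlgebra

variable {k : Type u} [Field k] {τ : Type}

namespace ProjSp

/-- The graph of the projection from a coordinate point. -/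
noncomputable def projGraph (k : Type u) [Field k] (τ : Type) :
    (projDomain k τ).toScheme ⟶ Limits.pullback (toSpec k (Option τ)) (toSpec k τ) :=
  Limits.pullback.lift (projDomain k τ).ι (proj k τ) proj_toSpec.symm

/-- The closure of the graph of the projection, i.e. the blow-up of a coordinate point. -/
noncomputable abbrev blowup (k : Type u) [Field k] (τ : Type) : Scheme.{u} := (projGraph k τ).image

/-- The blow-down morphism. -/
noncomputable def blowupFst (k : Type u) [Field k] (τ : Type) : blowup k τ ⟶ ProjSp k (Option τ) :=
  (projGraph k τ).imageι ≫ Limits.pullback.fst _ _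

/-- The morphism resolving the projection. -/
noncomputable def blowupSnd (k : Type u) [Field k] (τ : Type) : blowup k τ ⟶ ProjSp k τ :=
  (projGraph k τ).imageι ≫ Limits.pullback.snd _ _

/-- The inclusion of the domain of the projection into the blow-up. -/
noncomputable abbrev toBlowup (k : Type u) [Field k] (τ : Type) :
    (projDomain k τ).toScheme ⟶ blowup k τ := (projGraph k τ).toImage

lemma blowup_w : blowupFst k τ ≫ toSpec k (Option τ) = blowupSnd k τ ≫ toSpec k τ := by
  rw [blowupFst, blowupSnd, Category.assoc, Category.assoc, Limits.pullback.condition]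

lemma toBlowup_fst : toBlowup k τ ≫ blowupFst k τ = (projDomain k τ).ι := by
  rw [blowupFst, ← Category.assoc, Scheme.Hom.toImage_imageι, projGraph, Limits.pullback.lift_fst]

lemma toBlowup_snd : toBlowup k τ ≫ blowupSnd k τ = proj k τ := by
  rw [blowupSnd, ← Category.assoc, Scheme.Hom.toImage_imageι, projGraph, Limits.pullback.lift_snd]

lemma isLocallyNoetherian_projSp [Finite τ] : IsLocallyNoetherian (ProjSp k τ) :=
  LocallyOfFiniteType.isLocallyNoetherian (toSpec k τ)

instance isImmersion_projGraph : IsImmersion (projGraph k τ) := by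
  have : IsImmersion (projGraph k τ ≫ Limits.pullback.fst _ _) := by
    rw [projGraph, Limits.pullback.lift_fst]; infer_instance
  exact IsImmersion.of_comp _ (Limits.pullback.fst _ _)

instance quasiCompact_projGraph [Finite τ] : QuasiCompact (projGraph k τ) := by
  have := isLocallyNoetherian_projSp (k := k) (τ := Option τ)
  have : QuasiCompact (projGraph k τ ≫ Limits.pullback.fst _ _) := by
    rw [projGraph, Limits.pullback.lift_fst]; infer_instance
  exact QuasiCompact.of_comp _ (Limits.pullback.fst _ _)

instance isProper_blowupFst [Finite τ] : IsProper (blowupFst k τ) := by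
  unfold blowupFst; infer_instance

instance isSeparated_blowupFst : IsSeparated (blowupFst k τ) := by
  unfold blowupFst; infer_instance

instance nonempty_projDomain [Nonempty τ] : Nonempty (projDomain k τ).toScheme := by
  obtain ⟨t⟩ := ‹Nonempty τ›
  have x : Spec (.of (MvPolynomial {l : Option τ // l ≠ some t} k)) := genericPoint _
  exact ⟨liftProjDomain (chart k (some t)) t (range_chart _).le x⟩

instance isIntegral_projDomain [Nonempty τ] : IsIntegral (projDomain k τ).toScheme :=
  isIntegral_of_isOpenImmersion (projDomain k τ).ι

instance isIntegral_blowup [Nonempty τ] [Finite τ] : IsIntegral (blowup k τ) :=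
  isIntegral_image _

lemma isIso_blowupFst [Nonempty τ] [Finite τ] : IsIso (blowupFst k τ ∣_ projDomain k τ) :=
  (isIso_morphismRestrict_of_isDominant _ _ (toBlowup k τ) toBlowup_fst).1

lemma mem_range_toBlowup [Nonempty τ] [Finite τ] {z : blowup k τ}
    (hz : blowupFst k τ z ∈ projDomain k τ) : z ∈ Set.range (toBlowup k τ) :=
  (isIso_morphismRestrict_of_isDominant _ _ (toBlowup k τ) toBlowup_fst).2 z hz

lemma blowup_hom_ext {T : Scheme.{u}} {f g : T ⟶ blowup k τ}
    (h1 : f ≫ blowupFst k τ = g ≫ blowupFst k τ) (h2 : f ≫ blowupSnd k τ = g ≫ blowupSnd k τ) :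
    f = g := by
  rw [← cancel_mono (projGraph k τ).imageι]
  apply Limits.pullback.hom_ext
  · simpa only [blowupFst, Category.assoc] using h1
  · simpa only [blowupSnd, Category.assoc] using h2

/-- The homogeneous coordinates `(v : y)` on the affine line over the chart `t`. -/
noncomputable def lineHom (k : Type u) [Field k] (t : τ) :
    MvPolynomial (Option τ) k →ₐ[k] Polynomial (MvPolynomial {l : τ // l ≠ t} k) :=
  aeval fun o => o.elim Polynomial.X fun l => Polynomial.C (dehom k t (X l))

@[simp] lemma lineHom_none (t : τ) : lineHom k t (X none) = Polynomial.X := by simp [lineHom]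

@[simp] lemma lineHom_some (t l : τ) :
    lineHom k t (X (some l)) = Polynomial.C (dehom k t (X l)) := by simp [lineHom]

lemma isUnit_lineHom (t : τ) : IsUnit ((lineHom k t : MvPolynomial (Option τ) k →+*
    Polynomial (MvPolynomial {l : τ // l ≠ t} k)) (X (some t))) := by
  simp

/-- The affine line over the chart `t` in the domain of the projection. -/
noncomputable def lineChart (k : Type u) [Field k] (t : τ) :
    Spec (.of (Polynomial (MvPolynomial {l : τ // l ≠ t} k))) ⟶ (projDomain k τ).toScheme :=
  liftProjDomain (pt (some t) (lineHom k t : MvPolynomial (Option τ) k →+*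
    Polynomial (MvPolynomial {l : τ // l ≠ t} k)) (isUnit_lineHom t)) t (range_pt_subset _ _ _)

lemma lineChart_ι (t : τ) : lineChart k t ≫ (projDomain k τ).ι =
    pt (some t) (lineHom k t : MvPolynomial (Option τ) k →+*
      Polynomial (MvPolynomial {l : τ // l ≠ t} k)) (isUnit_lineHom t) :=
  liftProjDomain_ι _ _ _

lemma isOpenImmersion_lineChart_and (t : τ) :
    ∃ _ : IsOpenImmersion (lineChart k t ≫ (projDomain k τ).ι),
      (lineChart k t ≫ (projDomain k τ).ι).opensRange = D (some t) := by
  rw [lineChart_ι]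
  refine isOpenImmersion_pt (some t) (lineHom k t)
    { Polynomial.eval₂RingHom (rename (some ∘ Subtype.val) : MvPolynomial {l : τ // l ≠ t} k →ₐ[k]
        MvPolynomial (Option τ) k).toRingHom (X none) with
      commutes' := fun r => by simp [IsScalarTower.algebraMap_apply k (MvPolynomial {l : τ // l ≠ t} k) (Polynomial (MvPolynomial {l : τ // l ≠ t} k)), ← MvPolynomial.algebraMap_eq] } ?_ ?_ ?_ _
  · simp
  · intro r
    induction r using Polynomial.induction_on' with
    | add p q hp hq => rw [map_add, map_add, hp, hq]
    | monomial n a =>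
      have h : (lineHom k t).comp (rename (some ∘ Subtype.val)) =
          (IsScalarTower.toAlgHom k (MvPolynomial {l : τ // l ≠ t} k)
            (Polynomial (MvPolynomial {l : τ // l ≠ t} k))) := by
        ext1 l
        simp [l.2]
      have h' : lineHom k t (rename (some ∘ Subtype.val) a) = Polynomial.C a :=
        DFunLike.congr_fun h a
      simp [h', Polynomial.C_mul_X_pow_eq_monomial]
  · intro l hl
    rcases l with _ | l
    · simp
    · have : l ≠ t := fun h => hl (by rw [h])
      simp [this]

instance isOpenImmersion_lineChart (t : τ) : IsOpenImmersion (lineChart k t) := by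
  have := (isOpenImmersion_lineChart_and (k := k) t).1
  exact IsOpenImmersion.of_comp _ (projDomain k τ).ι

lemma lineChart_proj (t : τ) : lineChart k t ≫ proj k τ =
    Spec.map (CommRingCat.ofHom Polynomial.C) ≫ chart k t := by
  rw [pt_proj t _ _ _ (lineChart_ι t), chart, SpecMap_pt]
  refine pt_eq_of_smul t _ _ _ _ 1 (fun r => ?_) fun l => ?_
  · rw [comp_renameSome_C]
    simp [← MvPolynomial.algebraMap_eq, IsScalarTower.algebraMap_apply k
      (MvPolynomial {l : τ // l ≠ t} k) (Polynomial (MvPolynomial {l : τ // l ≠ t} k))]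
  · rw [comp_renameSome_X]
    simp

end ProjSp

end ProjectionGraph

end GeomFibration

namespace GeomFibration

/-! ### Lifting morphisms into a closed subscheme -/

section LiftToClosed

open TensorProduct

lemma isDominant_SpecMap {R S : Type u} [CommRing R] [CommRing S] (f : R →+* S)
    (hf : Function.Injective f) : IsDominant (Spec.map (CommRingCat.ofHom f)) := by
  refine ⟨(PrimeSpectrum.denseRange_comap_iff_ker_le_nilRadical (f := f)).2 ?_⟩
  rw [(RingHom.injective_iff_ker_eq_bot f).1 hf]
  exact bot_le

/-- The preimage of `Z` is a closed subscheme of the reduced scheme `L` containing the dense image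
of `D`, so it is all of `L`. -/
lemma exists_lift_of_isClosedImmersion {Z M L D : Scheme.{u}} (i : Z ⟶ M) [IsClosedImmersion i]
    (g : L ⟶ M) [IsReduced L] (h : D ⟶ L) [IsDominant h] (d : D ⟶ Z) (w : d ≫ i = h ≫ g) :
    ∃ c : L ⟶ Z, c ≫ i = g := by
  have : IsDominant (Limits.pullback.lift d h w ≫ Limits.pullback.snd i g) := by
    rw [Limits.pullback.lift_snd]; infer_instance
  have := IsDominant.of_comp (Limits.pullback.lift d h w) (Limits.pullback.snd i g)
  have := isIso_of_isClosedImmersion_of_isDominant (Limits.pullback.snd i g)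
  refine ⟨inv (Limits.pullback.snd i g) ≫ Limits.pullback.fst i g, ?_⟩
  rw [Category.assoc, Limits.pullback.condition, IsIso.inv_hom_id_assoc]

lemma isOpenImmersion_of_isClosedImmersion_lift {L Z M : Scheme.{u}} (c : L ⟶ Z) [IsDominant c]
    [IsReduced Z] (Z' : Z.Opens) (hr : Set.range c ⊆ Set.range Z'.ι) (m : Z'.toScheme ⟶ M)
    [IsSeparated m] (H : IsClosedImmersion (IsOpenImmersion.lift Z'.ι c hr ≫ m)) :
    IsOpenImmersion c ∧ ∀ z ∈ Z', z ∈ Set.range c := by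
  have h : IsOpenImmersion.lift Z'.ι c hr ≫ Z'.ι = c := IsOpenImmersion.lift_fac _ _ _
  have := IsClosedImmersion.of_comp (IsOpenImmersion.lift Z'.ι c hr) m
  have : IsDominant (IsOpenImmersion.lift Z'.ι c hr ≫ Z'.ι) := by rw [h]; infer_instance
  have := IsDominant.of_comp_of_isOpenImmersion (IsOpenImmersion.lift Z'.ι c hr) Z'.ι
  have := isIso_of_isClosedImmersion_of_isDominant (IsOpenImmersion.lift Z'.ι c hr)
  constructor
  · rw [← h]; infer_instance
  · intro z hz
    obtain ⟨x, hx⟩ := (IsOpenImmersion.lift Z'.ι c hr).surjective ⟨z, hz⟩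
    refine ⟨x, ?_⟩
    rw [← h, Scheme.Hom.comp_apply, hx]
    rfl

lemma isClosedImmersion_of_productMap_surjective {k A B R : Type u} [CommRing k] [CommRing A]
    [CommRing B] [CommRing R] [Algebra k A] [Algebra k B] [Algebra k R] (α : A →ₐ[k] R)
    (β : B →ₐ[k] R) (h : Function.Surjective (Algebra.TensorProduct.productMap α β))
    (l : Spec (.of R) ⟶ Limits.pullback (Spec.map (CommRingCat.ofHom (algebraMap k A)))
      (Spec.map (CommRingCat.ofHom (algebraMap k B))))
    (h1 : l ≫ Limits.pullback.fst _ _ = Spec.map (CommRingCat.ofHom (α : A →+* R)))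
    (h2 : l ≫ Limits.pullback.snd _ _ = Spec.map (CommRingCat.ofHom (β : B →+* R))) :
    IsClosedImmersion l := by
  have key : l = Spec.map (CommRingCat.ofHom
      (Algebra.TensorProduct.productMap α β : A ⊗[k] B →+* R)) ≫ (pullbackSpecIso k A B).inv := by
    apply Limits.pullback.hom_ext
    · rw [h1, Category.assoc, pullbackSpecIso_inv_fst, ← Spec.map_comp, ← CommRingCat.ofHom_comp]
      congr 2
      ext a
      simp
    · rw [h2, Category.assoc, pullbackSpecIso_inv_snd, ← Spec.map_comp, ← CommRingCat.ofHom_comp]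
      congr 2
      ext a
      simp
  have := IsClosedImmersion.spec_of_surjective (CommRingCat.ofHom
      (Algebra.TensorProduct.productMap α β : A ⊗[k] B →+* R)) h
  rw [key]
  infer_instance

end LiftToClosed

/-! ### Affine-line charts of the blow-up around the exceptional divisor -/

section ExceptionalCharts

open MvPolynomial

attribute [local instance] MvPolynomial.gradedAlgebra

variable {k : Type u} [Field k] {τ : Type}

namespace ProjSp

lemma algHom_C {R : Type*} [CommRing R] [Algebra k R] {σ : Type} (φ : MvPolynomial σ k →ₐ[k] R)
    (r : k) : φ (C r) = algebraMap k R r := φ.commutes r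

/-- The homogeneous coordinates `(1 : u y)` on the affine line over the chart `t`. -/
noncomputable def excHom (k : Type u) [Field k] (t : τ) :
    MvPolynomial (Option τ) k →ₐ[k] Polynomial (MvPolynomial {l : τ // l ≠ t} k) :=
  aeval fun o => o.elim 1 fun l => Polynomial.X * Polynomial.C (dehom k t (X l))

@[simp] lemma excHom_none (t : τ) : excHom k t (X none) = 1 := by simp [excHom]

@[simp] lemma excHom_some (t l : τ) :
    excHom k t (X (some l)) = Polynomial.X * Polynomial.C (dehom k t (X l)) := by simp [excHom]

/-- The morphism to `ℙ(Option τ)` with coordinates `(1 : u y)`. -/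
noncomputable def excPt (k : Type u) [Field k] (t : τ) :
    Spec (.of (Polynomial (MvPolynomial {l : τ // l ≠ t} k))) ⟶ ProjSp k (Option τ) :=
  pt none (excHom k t : MvPolynomial (Option τ) k →+*
    Polynomial (MvPolynomial {l : τ // l ≠ t} k)) (by simp)

lemma excPt_toSpec (t : τ) : excPt k t ≫ toSpec k (Option τ) =
    (Spec.map (CommRingCat.ofHom Polynomial.C) ≫ chart k t) ≫ toSpec k τ := by
  rw [excPt, pt_toSpec, Category.assoc, chart_toSpec, ← Spec.map_comp, ← CommRingCat.ofHom_comp]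
  congr 2
  ext r : 1
  exact algHom_C (excHom k t) r

open LaurentPolynomial in
-- Where `u` is invertible, `(1 : u y)` and `(u⁻¹ : y)` are the same point; the two kinds of chart
-- differ by inverting the line coordinate.
lemma excPt_eq_lineChart (t : τ) :
    Spec.map (CommRingCat.ofHom
      ((invert : (MvPolynomial {l : τ // l ≠ t} k)[T;T⁻¹] ≃ₐ[_] _).toRingEquiv.toRingHom.comp
        Polynomial.toLaurent)) ≫ lineChart k t ≫ (projDomain k τ).ι =
    Spec.map (CommRingCat.ofHom Polynomial.toLaurent) ≫ excPt k t := by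
  rw [lineChart_ι, excPt, SpecMap_pt, SpecMap_pt]
  symm
  have h1 : IsUnit ((Polynomial.toLaurent.comp (excHom k t : MvPolynomial (Option τ) k →+*
      Polynomial (MvPolynomial {l : τ // l ≠ t} k))) (X (some t))) := by
    simp [LaurentPolynomial.isUnit_T]
  refine (pt_eq none (some t) _ _ h1).trans ?_
  refine pt_eq_of_smul (some t) _ _ _ _ (T (-1)) (fun r => ?_) fun i => ?_
  · simp only [RingHom.comp_apply, RingHom.coe_coe, algHom_C]
    rw [IsScalarTower.algebraMap_apply k (MvPolynomial {l : τ // l ≠ t} k)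
      (Polynomial (MvPolynomial {l : τ // l ≠ t} k)), ← Polynomial.C_eq_algebraMap]
    simp
  · rcases i with _ | l
    · simp
    · simp [← mul_assoc]

open LaurentPolynomial in
-- Given by `(1 : u y)` and `y`, the chart maps the dense locus `u ≠ 0` into the graph of the
-- projection, hence maps entirely into its closure.
lemma exists_exceptionalChart [Finite τ] [Nonempty τ] (t : τ) :
    ∃ c : Spec (.of (Polynomial (MvPolynomial {l : τ // l ≠ t} k))) ⟶ blowup k τ, IsDominant c ∧
      c ≫ blowupFst k τ = excPt k t ∧
      c ≫ blowupSnd k τ = Spec.map (CommRingCat.ofHom Polynomial.C) ≫ chart k t := by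
  let h := Spec.map (CommRingCat.ofHom (Polynomial.toLaurent (R := MvPolynomial {l : τ // l ≠ t} k)))
  let d := Spec.map (CommRingCat.ofHom
      ((invert : (MvPolynomial {l : τ // l ≠ t} k)[T;T⁻¹] ≃ₐ[_] _).toRingEquiv.toRingHom.comp
        Polynomial.toLaurent))
  have : IsDominant h := isDominant_SpecMap _ Polynomial.toLaurent_injective
  have : IsDominant d := isDominant_SpecMap _
    ((invert : (MvPolynomial {l : τ // l ≠ t} k)[T;T⁻¹] ≃ₐ[_] _).injective.comp
      Polynomial.toLaurent_injective)
  have hd : h ≫ excPt k t = d ≫ lineChart k t ≫ (projDomain k τ).ι := (excPt_eq_lineChart t).symm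
  have hd2 : h ≫ Spec.map (CommRingCat.ofHom Polynomial.C) =
      d ≫ Spec.map (CommRingCat.ofHom Polynomial.C) := by
    rw [← Spec.map_comp, ← Spec.map_comp, ← CommRingCat.ofHom_comp, ← CommRingCat.ofHom_comp]
    congr 2
    refine RingHom.ext fun r => ?_
    simp
  obtain ⟨c, hc⟩ := exists_lift_of_isClosedImmersion (projGraph k τ).imageι
    (Limits.pullback.lift (excPt k t) _ (excPt_toSpec t)) h (d ≫ lineChart k t ≫ toBlowup k τ) (by
      apply Limits.pullback.hom_ext
      · simp only [Category.assoc, Limits.pullback.lift_fst, hd]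
        rw [← toBlowup_fst, blowupFst]
      · simp only [Category.assoc, Limits.pullback.lift_snd]
        rw [reassoc_of% hd2, ← lineChart_proj, ← toBlowup_snd, blowupSnd])
  have h1 : c ≫ blowupFst k τ = excPt k t := by
    rw [blowupFst, ← Category.assoc, hc, Limits.pullback.lift_fst]
  have h2 : c ≫ blowupSnd k τ = Spec.map (CommRingCat.ofHom Polynomial.C) ≫ chart k t := by
    rw [blowupSnd, ← Category.assoc, hc, Limits.pullback.lift_snd]
  have h3 : h ≫ c = d ≫ lineChart k t ≫ toBlowup k τ := by
    apply blowup_hom_ext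
    · rw [Category.assoc, h1, hd, Category.assoc, Category.assoc, toBlowup_fst]
    · rw [Category.assoc, h2, Category.assoc, Category.assoc, toBlowup_snd, lineChart_proj,
        reassoc_of% hd2]
  have : IsDominant (lineChart k t) := ⟨(lineChart k t).isOpenEmbedding.isOpen_range.dense
    ⟨_, genericPoint _, rfl⟩⟩
  have : IsDominant (h ≫ c) := by rw [h3]; infer_instance
  exact ⟨c, IsDominant.of_comp h c, h1, h2⟩

/-- Inside the open part `Z'` of the blow-up where the two indicated coordinates are nonzero, the
chart is closed, since its map to the product of the two affine charts is a closed immersion. Being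
dominant, it is an isomorphism onto `Z'`. -/
lemma isOpenImmersion_exceptionalChart [Finite τ] [Nonempty τ] (t : τ)
    (c : Spec (.of (Polynomial (MvPolynomial {l : τ // l ≠ t} k))) ⟶ blowup k τ) [IsDominant c]
    (h1 : c ≫ blowupFst k τ = excPt k t)
    (h2 : c ≫ blowupSnd k τ = Spec.map (CommRingCat.ofHom Polynomial.C) ≫ chart k t) :
    IsOpenImmersion c ∧ ∀ z, blowupFst k τ z ∈ D (k := k) (none : Option τ) →
      blowupSnd k τ z ∈ D (k := k) t → z ∈ Set.range c := by
  let Z' : (blowup k τ).Opens := blowupFst k τ ⁻¹ᵁ D none ⊓ blowupSnd k τ ⁻¹ᵁ D t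
  let m1 := IsOpenImmersion.lift (chart k (none : Option τ)) (Z'.ι ≫ blowupFst k τ) (by
    rw [range_chart]
    rintro _ ⟨z, rfl⟩
    exact z.2.1)
  have hm1 : m1 ≫ chart k none = Z'.ι ≫ blowupFst k τ := IsOpenImmersion.lift_fac _ _ _
  let m2 := IsOpenImmersion.lift (chart k t) (Z'.ι ≫ blowupSnd k τ) (by
    rw [range_chart]
    rintro _ ⟨z, rfl⟩
    exact z.2.2)
  have hm2 : m2 ≫ chart k t = Z'.ι ≫ blowupSnd k τ := IsOpenImmersion.lift_fac _ _ _
  let m : Z'.toScheme ⟶ Limits.pullback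
      (Spec.map (CommRingCat.ofHom (algebraMap k (MvPolynomial {l : Option τ // l ≠ none} k))))
      (Spec.map (CommRingCat.ofHom (algebraMap k (MvPolynomial {l : τ // l ≠ t} k)))) :=
    Limits.pullback.lift m1 m2 (by
      rw [algebraMap_eq, algebraMap_eq, ← chart_toSpec, ← chart_toSpec, reassoc_of% hm1,
        reassoc_of% hm2, blowup_w])
  have : IsSeparated m1 := by
    have : IsSeparated (m1 ≫ chart k none) := by rw [hm1]; infer_instance
    exact IsSeparated.of_comp m1 (chart k none)
  have : IsSeparated m := by
    have : IsSeparated (m ≫ Limits.pullback.fst _ _) := by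
      rw [Limits.pullback.lift_fst]; infer_instance
    exact IsSeparated.of_comp m (Limits.pullback.fst _ _)
  have hr : Set.range c ⊆ Set.range Z'.ι := by
    rw [Scheme.Opens.range_ι]
    rintro _ ⟨x, rfl⟩
    constructor
    · change blowupFst k τ (c x) ∈ D none
      rw [← Scheme.Hom.comp_apply, h1]
      exact range_pt_subset _ _ _ ⟨x, rfl⟩
    · change blowupSnd k τ (c x) ∈ D t
      rw [← Scheme.Hom.comp_apply, h2, Scheme.Hom.comp_apply, ← SetLike.mem_coe, ← range_chart]
      exact ⟨_, rfl⟩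
  let c' := IsOpenImmersion.lift Z'.ι c hr
  have hc' : c' ≫ Z'.ι = c := IsOpenImmersion.lift_fac _ _ _
  let α : MvPolynomial {l : Option τ // l ≠ none} k →ₐ[k]
    Polynomial (MvPolynomial {l : τ // l ≠ t} k) := aeval fun l => excHom k t (X l.1)
  let β : MvPolynomial {l : τ // l ≠ t} k →ₐ[k]
    Polynomial (MvPolynomial {l : τ // l ≠ t} k) := IsScalarTower.toAlgHom k _ _
  -- The `y`-coordinates come from `β`, and the line variable is the image under `α` of the
  -- coordinate `some t`, because `y_t = 1` on the chart.
  have hs : Function.Surjective (Algebra.TensorProduct.productMap α β) := by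
    rw [← AlgHom.range_eq_top, Algebra.TensorProduct.productMap_range, eq_top_iff]
    rintro p -
    induction p using Polynomial.induction_on' with
    | add p q hp hq => exact add_mem hp hq
    | monomial n a =>
      rw [← Polynomial.C_mul_X_pow_eq_monomial]
      refine mul_mem (le_sup_right (a := α.range) ⟨a, rfl⟩) (pow_mem
        (le_sup_left (a := α.range) ⟨X ⟨some t, by simp⟩, ?_⟩) n)
      simp [α]
  have H := isClosedImmersion_of_productMap_surjective α β hs (c' ≫ m) (by
    rw [Category.assoc, Limits.pullback.lift_fst, ← cancel_mono (chart k none), Category.assoc, hm1,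
      reassoc_of% hc', h1, chart, SpecMap_pt, excPt]
    refine pt_eq_of_smul none _ _ _ _ 1 (fun r => ?_) fun i => ?_
    · simp only [RingHom.comp_apply, RingHom.coe_coe, algHom_C, AlgHom.commutes]
    · rcases i with _ | l
      · simp
      · simp [α]) (by
    rw [Category.assoc, Limits.pullback.lift_snd, ← cancel_mono (chart k t), Category.assoc, hm2,
      reassoc_of% hc', h2]
    rfl)
  obtain ⟨h3, h4⟩ := isOpenImmersion_of_isClosedImmersion_lift c Z' hr m H
  exact ⟨h3, fun z hz hz' => h4 z ⟨hz, hz'⟩⟩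

/-- Away from the centre the lines `(v : y)` cover. A point above the centre has nonzero coordinate
`none` there, and is covered by an exceptional chart. -/
lemma hasAffineLineCharts_blowupSnd [Finite τ] [Nonempty τ] :
    HasAffineLineCharts (blowupSnd k τ) := by
  intro z
  by_cases hz : blowupFst k τ z ∈ projDomain k τ
  · obtain ⟨x, rfl⟩ := mem_range_toBlowup hz
    obtain ⟨t, ht⟩ := mem_projDomain.1 x.2
    refine ⟨.of (MvPolynomial {l : τ // l ≠ t} k), chart k t, lineChart k t ≫ toBlowup k τ,
      inferInstance, inferInstance, ?_, ?_⟩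
    · rw [Category.assoc, toBlowup_snd, lineChart_proj]
    · have h : x.1 ∈ (lineChart k t ≫ (projDomain k τ).ι).opensRange := by
        rw [(isOpenImmersion_lineChart_and t).2]
        exact ht
      obtain ⟨y, hy⟩ := h
      refine ⟨y, ?_⟩
      rw [Scheme.Hom.comp_apply]
      congr 1
      exact (projDomain k τ).ι.injective (by rw [← Scheme.Hom.comp_apply, hy]; rfl)
  · have hz1 : blowupFst k τ z ∈ D (k := k) (none : Option τ) := by
      obtain ⟨o, ho⟩ := exists_mem_D (blowupFst k τ z)
      rcases o with _ | t
      · exact ho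
      · exact absurd (mem_projDomain.2 ⟨t, ho⟩) hz
    obtain ⟨t, ht⟩ := exists_mem_D (blowupSnd k τ z)
    obtain ⟨c, hd, h1, h2⟩ := exists_exceptionalChart (k := k) t
    obtain ⟨h3, h4⟩ := isOpenImmersion_exceptionalChart t c h1 h2
    exact ⟨.of (MvPolynomial {l : τ // l ≠ t} k), chart k t, c, inferInstance, h3, h2, h4 z hz1 ht⟩

end ProjSp

end ExceptionalCharts

end GeomFibration

namespace GeomFibration

/-! ### Points of codimension at most one dominate under some coordinate projection -/

section Divisors

open MvPolynomial

lemma apply_genericPoint_of_isDominant {X Y : Scheme.{u}} [IrreducibleSpace X] [IrreducibleSpace Y]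
    (f : X ⟶ Y) [IsDominant f] : f (genericPoint X) = genericPoint Y := by
  have h := (genericPoint_spec X).image f.continuous
  rw [Set.image_univ, f.denseRange.closure_range] at h
  exact h.eq (genericPoint_spec Y)

lemma eq_or_eq_genericPoint_of_coheight_eq_one {X : Scheme.{u}} [IrreducibleSpace X] {x a : X}
    (hx : Order.coheight x = 1) (ha : a ⤳ x) : a = x ∨ a = genericPoint X := by
  by_cases h : x ⤳ a
  · exact .inl (ha.antisymm h).eq
  · right
    have h1 : x < a := lt_of_le_not_ge ha h
    have h2 : Order.coheight a < 1 := by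
      rw [← hx]
      exact Order.coheight_strictAnti h1 (by
        have := Order.coheight_anti h1.le
        rw [hx] at this
        exact this.trans_lt (by simp))
    have h3 : IsMax a := Order.coheight_eq_zero.1 (Order.lt_one_iff.1 h2)
    have h4 : a ⤳ genericPoint X := h3 (genericPoint_specializes a)
    exact (h4.antisymm (genericPoint_specializes a)).eq

/-- Flatness lifts generisations, and above `x` there are only `x` and the generic point. -/
lemma eq_or_eq_genericPoint_of_flat {X Y : Scheme.{u}} [IrreducibleSpace X] [IrreducibleSpace Y]
    (f : X ⟶ Y) [Flat f] {x : X} (hx : Order.coheight x = 1) {a : Y} (ha : a ⤳ f x) :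
    a = f x ∨ a = genericPoint Y := by
  obtain ⟨x', h1, rfl⟩ := Flat.generalizingMap f ha
  rcases eq_or_eq_genericPoint_of_coheight_eq_one hx h1 with rfl | rfl
  · exact .inl rfl
  · exact .inr (apply_genericPoint_of_flat f)

/-- In a factorial ring such a prime, if nonzero, is generated by a prime element `F`. Degrees in
one variable add under multiplication, so if every variable failed then `F` would have degree zero
in all of them and be a unit. -/
lemma exists_forall_mem_degreeOf_eq_zero {k : Type*} [Field k] {ι : Type*} [Nonempty ι]
    (p : Ideal (MvPolynomial ι k)) [hp : p.IsPrime]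
    (h : ∀ q : Ideal (MvPolynomial ι k), q.IsPrime → q ≤ p → q = p ∨ q = ⊥) :
    ∃ i, ∀ f ∈ p, degreeOf i f = 0 → f = 0 := by
  by_contra! H
  obtain ⟨i₀⟩ := ‹Nonempty ι›
  obtain ⟨f, hf, -, hf0⟩ := H i₀
  have hpb : p ≠ ⊥ := fun hb => hf0 (by rw [hb] at hf; exact hf)
  obtain ⟨F, hF, hFp⟩ := hp.exists_mem_prime_of_ne_bot hpb
  have hFI : (Ideal.span {F}).IsPrime := (Ideal.span_singleton_prime hFp.ne_zero).2 hFp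
  have hspan : Ideal.span {F} = p := by
    refine (h _ hFI ((Ideal.span_singleton_le_iff_mem _).2 hF)).resolve_right fun hb => ?_
    exact hFp.ne_zero (Ideal.span_singleton_eq_bot.1 hb)
  have hdeg : ∀ i, degreeOf i F = 0 := by
    intro i
    obtain ⟨f, hf, hfi, hf0⟩ := H i
    rw [← hspan, Ideal.mem_span_singleton] at hf
    obtain ⟨g, rfl⟩ := hf
    rw [degreeOf_mul_eq (left_ne_zero_of_mul hf0) (right_ne_zero_of_mul hf0)] at hfi
    omega
  have hv : F.vars = ∅ := by
    classical
    ext i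
    simp only [Finset.notMem_empty, iff_false]
    intro hi
    rw [vars_def, Multiset.mem_toFinset, ← Multiset.count_pos, ← degreeOf_def, hdeg i] at hi
    exact lt_irrefl _ hi
  rw [vars_eq_empty_iff_eq_C] at hv
  have hc : F.coeff 0 ≠ 0 := fun hc => hFp.ne_zero (by rw [hv, hc, C_0])
  exact hFp.not_isUnit (by rw [hv]; exact (isUnit_iff_ne_zero.2 hc).map C)

lemma closure_image_eq_univ {W V P : Scheme.{u}} [IrreducibleSpace P] (ν : W ⟶ V) (f : W ⟶ P)
    [UniversallyClosed f] (U : V.Opens) (D : WeilDivisor V) (w : W) (hw : ν w ∈ D.supp)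
    (hwU : ν w ∈ U) (hf : f w = genericPoint P) : f '' properTransform ν U D = Set.univ := by
  have hc : IsClosed (f '' properTransform ν U D) := f.isClosedMap _ isClosed_closure
  rw [← Set.univ_subset_iff, ← genericPoint_closure P, hc.closure_subset_iff,
    Set.singleton_subset_iff]
  exact ⟨w, subset_closure ⟨hw, hwU⟩, hf⟩

lemma exists_coheight_eq_one_mem_supp {V : Scheme.{u}} (D : WeilDivisor V) (x : V)
    (hx : x ∈ D.supp) : ∃ y, Order.coheight y = 1 ∧ y ∈ D.supp ∧ y ⤳ x := by
  simp only [WeilDivisor.supp, Set.mem_iUnion] at hx ⊢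
  obtain ⟨y, hy, hxy⟩ := hx
  exact ⟨y, y.2, ⟨y, hy, subset_closure rfl⟩, specializes_iff_mem_closure.2 hxy⟩

attribute [local instance] MvPolynomial.gradedAlgebra

namespace ProjSp

variable {k : Type u} [Field k] {σ τ : Type}

lemma eq_or_eq_bot_of_chart [Nonempty σ] (j : σ)
    (y : Spec (.of (MvPolynomial {l : σ // l ≠ j} k)))
    (h : ∀ a, a ⤳ chart k j y → a = chart k j y ∨ a = genericPoint (ProjSp k σ))
    (q : Ideal (MvPolynomial {l : σ // l ≠ j} k)) (hq : q.IsPrime) (hle : q ≤ y.asIdeal) :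
    q = y.asIdeal ∨ q = ⊥ := by
  let y' : Spec (.of (MvPolynomial {l : σ // l ≠ j} k)) := ⟨q, hq⟩
  have h1 : y' ⤳ y := (PrimeSpectrum.le_iff_specializes y' y).1 hle
  rcases h _ (h1.map (chart k j).continuous) with h2 | h2
  · left
    rw [← (chart k j).injective h2]
  · right
    have : IsDominant (chart k j) := ⟨(chart k j).isOpenEmbedding.isOpen_range.dense
      ⟨_, genericPoint _, rfl⟩⟩
    rw [← apply_genericPoint_of_isDominant (chart k j)] at h2
    have h3 := (chart k j).injective h2
    rw [genericPoint_eq_bot_of_affine] at h3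
    exact congrArg PrimeSpectrum.asIdeal h3

/-- The projection forgets the coordinate `e none`. By hypothesis the polynomials in the other
coordinates inject into the coordinate ring of the closure of `y`, so this closure dominates the
target chart. -/
lemma proj_eq_genericPoint [Nonempty τ] (e : Option τ ≃ σ) (j : σ) (hj : j ≠ e none)
    (y : Spec (.of (MvPolynomial {l : σ // l ≠ j} k)))
    (h : ∀ f ∈ y.asIdeal, degreeOf (⟨e none, hj.symm⟩ : {l : σ // l ≠ j}) f = 0 → f = 0) :
    ∃ z : (projDomain k τ).toScheme, (projDomain k τ).ι z = (renameIso k e).hom (chart k j y) ∧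
      proj k τ z = genericPoint (ProjSp k τ) := by
  obtain ⟨t, ht⟩ : ∃ t, e.symm j = some t := by
    rcases ho : e.symm j with _ | t
    · exact absurd (by rw [← ho, e.apply_symm_apply]) hj
    · exact ⟨t, rfl⟩
  let mk := Ideal.Quotient.mk y.asIdeal
  let φ : MvPolynomial (Option τ) k →+* MvPolynomial {l : σ // l ≠ j} k ⧸ y.asIdeal :=
    (mk.comp (dehom k j : MvPolynomial σ k →+* MvPolynomial {l : σ // l ≠ j} k)).comp
      (renameEquiv k e).toRingEquiv.toRingHom
  have hφ (o : Option τ) : φ (X o) = mk (dehom k j (X (e o))) := by simp [φ]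
  have hφC (c : k) : φ (C c) = mk (C c) := by simp [φ, MvPolynomial.algebraMap_eq]
  have hφt : IsUnit (φ (X (some t))) := by
    rw [hφ, ← ht, e.apply_symm_apply]
    simp
  have h1 : (Spec.map (CommRingCat.ofHom mk) ≫ chart k j) ≫ (renameIso k e).hom =
      pt (some t) φ hφt := by
    rw [chart, SpecMap_pt, pt_renameIso]
    exact pt_eq _ _ _ _ _
  let a := liftProjDomain (pt (some t) φ hφt) t (range_pt_subset _ _ _)
  have ha : a ≫ (projDomain k τ).ι = pt (some t) φ hφt := liftProjDomain_ι _ _ _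
  have hinj : ∀ l : {l : τ // l ≠ t}, e (some l.1) ≠ j := by
    intro l hl
    apply l.2
    rw [← hl, e.symm_apply_apply] at ht
    exact Option.some_injective _ ht
  let ψ : MvPolynomial {l : τ // l ≠ t} k →+* MvPolynomial {l : σ // l ≠ j} k :=
    (rename fun l => ⟨e (some l.1), hinj l⟩ :
      MvPolynomial {l : τ // l ≠ t} k →ₐ[k] MvPolynomial {l : σ // l ≠ j} k)
  have h2 : a ≫ proj k τ = Spec.map (CommRingCat.ofHom (mk.comp ψ)) ≫ chart k t := by
    rw [pt_proj t φ hφt a ha, chart, SpecMap_pt]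
    symm
    refine pt_eq_of_smul t _ _ _ _ 1 (fun r => ?_) fun l => ?_
    · rw [comp_renameSome_C, hφC]
      simp [ψ, MvPolynomial.algebraMap_eq]
    · rw [comp_renameSome_X, hφ]
      by_cases hl : l = t
      · subst hl
        rw [← ht, e.apply_symm_apply]
        simp
      · simp [hl, ψ, hinj ⟨l, hl⟩]
  have hdom : Function.Injective (mk.comp ψ) := by
    rw [injective_iff_map_eq_zero]
    intro f hf
    have hf' : rename (fun l : {l : τ // l ≠ t} => (⟨e (some l.1), hinj l⟩ : {l : σ // l ≠ j})) f
        ∈ y.asIdeal := Ideal.Quotient.eq_zero_iff_mem.1 hf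
    have hi : Function.Injective
        (fun l : {l : τ // l ≠ t} => (⟨e (some l.1), hinj l⟩ : {l : σ // l ≠ j})) := by
      intro l l' hl
      exact Subtype.ext (Option.some_injective _ (e.injective (congrArg Subtype.val hl)))
    refine rename_injective _ hi ((h _ hf' ?_).trans (map_zero _).symm)
    classical
    rw [degreeOf_def, Multiset.count_eq_zero, ← Multiset.mem_toFinset, ← vars_def]
    intro hmem
    obtain ⟨l, -, hl⟩ := Finset.mem_image.1 (vars_rename _ _ hmem)
    exact absurd (e.injective (congrArg Subtype.val hl)) (by simp)
  have : IsDomain (MvPolynomial {l : σ // l ≠ j} k ⧸ y.asIdeal) :=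
    (Ideal.Quotient.isDomain_iff_prime y.asIdeal).2 y.isPrime
  have : IsDominant (Spec.map (CommRingCat.ofHom (mk.comp ψ))) := isDominant_SpecMap _ hdom
  have : IsDominant (chart k t) := ⟨(chart k t).isOpenEmbedding.isOpen_range.dense
      ⟨_, genericPoint _, rfl⟩⟩
  -- The generic point of the spectrum of the quotient by `y` maps to `y` itself.
  refine ⟨a (genericPoint _), ?_, ?_⟩
  · rw [← Scheme.Hom.comp_apply, ha, ← h1, Scheme.Hom.comp_apply, Scheme.Hom.comp_apply]
    congr 2
    rw [genericPoint_eq_bot_of_affine]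
    exact PrimeSpectrum.ext (Ideal.mk_ker)
  · rw [← Scheme.Hom.comp_apply, h2]
    exact apply_genericPoint_of_isDominant _

lemma exists_proj_eq_genericPoint [Nontrivial σ] (x : ProjSp k σ)
    (h : ∀ a, a ⤳ x → a = x ∨ a = genericPoint (ProjSp k σ)) :
    ∃ i : σ, ∀ {τ : Type} [Nonempty τ] (e : Option τ ≃ σ), e none = i →
      ∃ z : (projDomain k τ).toScheme, (projDomain k τ).ι z = (renameIso k e).hom x ∧
        proj k τ z = genericPoint (ProjSp k τ) := by
  obtain ⟨j, y, rfl⟩ := exists_chart x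
  have : Nonempty {l : σ // l ≠ j} := by
    obtain ⟨l, hl⟩ := exists_ne j
    exact ⟨⟨l, hl⟩⟩
  have := y.isPrime
  obtain ⟨i, hi⟩ := exists_forall_mem_degreeOf_eq_zero y.asIdeal (eq_or_eq_bot_of_chart j y h)
  refine ⟨i.1, fun {τ} _ e he => ?_⟩
  refine proj_eq_genericPoint e j (he ▸ i.2.symm) y ?_
  have : (⟨e none, he ▸ i.2⟩ : {l : σ // l ≠ j}) = i := Subtype.ext he
  rw [this]
  exact hi

end ProjSp

end Divisors

end GeomFibration

namespace GeomFibration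

/-! ### Assembling the fibrations -/

section Construction

open MvPolynomial

lemma smooth_morphismRestrict_comp_iso {V Q Q' : Scheme.{u}} (f : V ⟶ Q) (θ : Q ≅ Q') (O : Q.Opens)
    (h : Smooth (f ∣_ O)) : Smooth ((f ≫ θ.hom) ∣_ (θ.inv ⁻¹ᵁ O)) := by
  refine restrict_of_isPullback @Smooth (g := 𝟙 V) (IsPullback.of_vert_isIso ⟨?_⟩) O h
  simp

attribute [local instance] MvPolynomial.gradedAlgebra

namespace ProjSp

variable {k : Type u} [Field k] {σ τ : Type} {V : Scheme.{u}} {s : V ⟶ Spec (CommRingCat.of k)}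

lemma isFibrationDatum [Finite σ] [Finite τ] [Nonempty τ] [IsIntegral V] [Smooth s] [IsProper s]
    (p : V ⟶ ProjSp k σ) [IsFinite p] [Surjective p] (hp : p ≫ toSpec k σ = s) (e : Option τ ≃ σ)
    (O : (ProjSp k σ).Opens) (hsm : Smooth (p ∣_ O)) (hO : ∀ z, (∀ l, l ≠ e none → z ∉ D l) → z ∈ O) :
    IsFibrationDatum s (toSpec k (Option τ)) (toSpec k τ) (p ≫ (renameIso k e).hom)
      (blowupFst k τ) (blowupSnd k τ) (projDomain k τ) ((renameIso k e).inv ⁻¹ᵁ O) := by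
  have hw : (p ≫ (renameIso k e).hom) ≫ toSpec k (Option τ) = s := by
    rw [Category.assoc, renameIso_toSpec, hp]
  have : Smooth ((p ≫ (renameIso k e).hom) ≫ toSpec k (Option τ)) := by rw [hw]; infer_instance
  exact
  { integral_V := inferInstance
    integral_Z := inferInstance
    integral_P := inferInstance
    smooth_s := inferInstance
    proper_s := inferInstance
    separated_sP := inferInstance
    finiteType_sP := inferInstance
    w_π := hw
    w_Z := blowup_w
    finite_π := inferInstance
    flat_π := flat_of_isFinite _
    surjective_π := inferInstance
    proper_b := inferInstance
    charts := hasAffineLineCharts_blowupSnd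
    isIso_U := isIso_blowupFst
    nonempty_U := by
      obtain ⟨x⟩ := nonempty_projDomain (k := k) (τ := τ)
      exact ⟨x.1, x.2⟩
    smooth_O := smooth_morphismRestrict_comp_iso p (renameIso k e) O hsm
    -- A point outside the domain of projection has all coordinates other than `e none` zero, so it
    -- is the centre, which `hO` places in `O`.
    sup_eq_top := by
      rw [← top_le_iff]
      intro z _
      by_cases hz : z ∈ projDomain k τ
      · exact .inr hz
      · refine .inl (hO _ fun l hl hzl => hz ?_)
        obtain ⟨t, ht⟩ : ∃ t, e.symm l = some t := by
          rcases ho : e.symm l with _ | t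
          · exact absurd (by rw [← ho, e.apply_symm_apply]) hl
          · exact ⟨t, rfl⟩
        refine mem_projDomain.2 ⟨t, ?_⟩
        have h1 : (renameIso k e).inv z ∈ (renameIso k e).hom ⁻¹ᵁ D (some t) := by
          rw [renameIso_preimage_D, ← ht, e.apply_symm_apply]
          exact hzl
        change (renameIso k e).hom ((renameIso k e).inv z) ∈ D (some t) at h1
        rw [← Scheme.Hom.comp_apply, Iso.inv_hom_id] at h1
        exact h1 }

lemma exists_isAffineIsoOpen [Finite τ] [Nonempty τ] {π : V ⟶ ProjSp k (Option τ)}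
    {O : (ProjSp k (Option τ)).Opens}
    (h : IsFibrationDatum s (toSpec k (Option τ)) (toSpec k τ) π
      (blowupFst k τ) (blowupSnd k τ) (projDomain k τ) O) :
    ∃ U : V.Opens, IsAffineIsoOpen (Limits.pullback.fst π (blowupFst k τ)) U := by
  obtain ⟨t⟩ := ‹Nonempty τ›
  refine ⟨_, h.isAffineIsoOpen (D (some t)) (D_le_projDomain t) (isAffineOpen_D _) ?_⟩
  rw [← range_chart]
  exact ⟨_, genericPoint _, rfl⟩

/-- The points `x` and `z` agree in projective space, so they lift to a common point `w` of the
fibre product; it lies in the proper transform and above the generic point. -/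
lemma image_properTransform_eq_univ [Finite τ] [Nonempty τ] {π : V ⟶ ProjSp k (Option τ)}
    (f : Limits.pullback π (blowupFst k τ) ⟶ ProjSp k τ) [UniversallyClosed f]
    (hf : f = Limits.pullback.snd π (blowupFst k τ) ≫ blowupSnd k τ) (U : V.Opens)
    (D : WeilDivisor V) (x : V) (hx : x ∈ D.supp) (hxU : x ∈ U)
    (z : (projDomain k τ).toScheme) (hz : (projDomain k τ).ι z = π x)
    (hzη : proj k τ z = genericPoint (ProjSp k τ)) :
    f '' properTransform (Limits.pullback.fst π (blowupFst k τ)) U D = Set.univ := by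
  obtain ⟨w, rfl, hw⟩ := exists_apply_eq_of_isPullback
    (IsPullback.of_hasPullback π (blowupFst k τ)) (x := x) (y := toBlowup k τ z) (by
      rw [← hz, ← Scheme.Hom.comp_apply, toBlowup_fst])
  refine closure_image_eq_univ _ f U D w hx hxU ?_
  rw [hf, Scheme.Hom.comp_apply, hw, ← Scheme.Hom.comp_apply, toBlowup_snd, hzη]

/-- After a linear change of coordinates, a smooth projective variety is finite over projective
space, and smooth over a neighbourhood of every coordinate point. -/
lemma exists_finite_morphism [CharZero k] [IsIntegral V] [Smooth s] (n : ℕ)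
    (hproj : IsProjective s) (hdim : topologicalKrullDim V = n) :
    ∃ (p : V ⟶ ProjSp k (Fin (n + 1))) (O : (ProjSp k (Fin (n + 1))).Opens),
      IsFinite p ∧ Surjective p ∧ p ≫ toSpec k (Fin (n + 1)) = s ∧ Smooth (p ∣_ O) ∧
      ∀ i, ∀ z, (∀ l, l ≠ i → z ∉ D l) → z ∈ O := by
  obtain ⟨N, j, hj, hjs⟩ := hproj
  obtain ⟨m, p, h1, h2, h3⟩ := exists_isFinite_surjective (k := k) (N + 1) j
  have hps : p ≫ toSpec k (Fin (m + 1)) = s := h3.trans hjs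
  have hm : m = n := by
    have h := topologicalKrullDim_eq p
    rw [hdim, Nat.card_fin, Nat.add_sub_cancel] at h
    exact_mod_cast h.symm
  subst hm
  have : Smooth (p ≫ toSpec k (Fin (m + 1))) := by rw [hps]; infer_instance
  obtain ⟨O, hO, hsm⟩ := exists_smooth_morphismRestrict p (toSpec k (Fin (m + 1)))
  obtain ⟨g, hg, hgO⟩ := exists_linear_iso O hO
  refine ⟨p ≫ g.inv, g.hom ⁻¹ᵁ O, inferInstance, inferInstance, ?_,
    smooth_morphismRestrict_comp_iso p g.symm O hsm, hgO⟩
  rw [Category.assoc, ← hps]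
  congr 1
  rw [Iso.inv_comp_eq, hg]

end ProjSp

end Construction

end GeomFibration

theorem mainTheorem5 {k : Type u} [Field k] [NumberField k] (n : ℕ) (hn : 1 ≤ n)
    (V : Scheme.{u}) (s : V ⟶ Spec (CommRingCat.of k))
    (hV : GeomFibration.IsVariety s) (hsmooth : Smooth s)
    (hproj : GeomFibration.IsProjective s) (hdim : topologicalKrullDim V = n) :
    ∃ (r : ℕ) (W : Fin r → Scheme.{u}) (ν : ∀ i, W i ⟶ V)
      (f : ∀ i, W i ⟶ GeomFibration.ProjSpace k (n - 1)),
      (∀ i, GeomFibration.IsVariety (ν i ≫ s)) ∧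
      (∀ i, ∃ U : V.Opens, GeomFibration.IsAffineIsoOpen (ν i) U) ∧
      (∀ i, f i ≫ GeomFibration.ProjSpace.toSpec k (n - 1) = ν i ≫ s) ∧
      (∀ i, IsProper (f i) ∧ Flat (f i)) ∧
      (∀ i, GeomFibration.GenericFiberIsSmoothIrreducibleCurve (f i)) ∧
      ∀ U : Fin r → V.Opens, (∀ i, GeomFibration.IsAffineIsoOpen (ν i) (U i)) →
        ∀ D : GeomFibration.WeilDivisor V, (D.supp ∩ ⋂ i, (U i : Set V)).Nonempty →
          ∃ i, f i '' GeomFibration.properTransform (ν i) (U i) D = Set.univ := by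
  obtain ⟨n, rfl⟩ : ∃ m, n = m + 1 := ⟨n - 1, by omega⟩
  have := hV.isIntegral
  have : IsProper s := by
    obtain ⟨N, j, hj, rfl⟩ := hproj
    exact inferInstanceAs (IsProper (j ≫ GeomFibration.ProjSp.toSpec k (Fin (N + 1))))
  obtain ⟨p, O, hp1, hp2, hps, hsm, hO⟩ :=
    GeomFibration.ProjSp.exists_finite_morphism (n + 1) hproj hdim
  -- After the shift `V` has dimension `n + 1` and there are `n + 2` coordinate points; `e i` makes
  -- the `i`-th coordinate the forgotten one.
  let e : ∀ i : Fin (n + 2), Option (Fin (n + 1)) ≃ Fin (n + 2) := fun i => (finSuccEquiv' i).symm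
  have he (i) : e i none = i := finSuccEquiv'_symm_none i
  have H (i : Fin (n + 2)) := GeomFibration.ProjSp.isFibrationDatum p hps (e i) O hsm
    (hO (e i none))
  have hflat : Flat p := by
    have : Smooth (p ≫ GeomFibration.ProjSp.toSpec k (Fin (n + 2))) := by
      rw [hps]; exact hsmooth
    exact GeomFibration.ProjSp.flat_of_isFinite p
  refine ⟨n + 2, fun i => Limits.pullback (p ≫ (GeomFibration.ProjSp.renameIso k (e i)).hom)
      (GeomFibration.ProjSp.blowupFst k (Fin (n + 1))), fun i => Limits.pullback.fst _ _,
    fun i => Limits.pullback.snd _ _ ≫ GeomFibration.ProjSp.blowupSnd k (Fin (n + 1)),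
    fun i => (H i).isVariety, fun i => GeomFibration.ProjSp.exists_isAffineIsoOpen (H i),
    fun i => (H i).w, fun i => (H i).isProper_flat, fun i => (H i).genericFiber, ?_⟩
  rintro U - D ⟨x, hxD, hxU⟩
  -- The given point is replaced by the generic point of a component of `D` through it, which
  -- remains in each `U i` because open sets are stable under generisation.
  obtain ⟨y, hy, hyD, hyx⟩ := GeomFibration.exists_coheight_eq_one_mem_supp D x hxD
  obtain ⟨i, hi⟩ := GeomFibration.ProjSp.exists_proj_eq_genericPoint (p y)
    fun a ha => GeomFibration.eq_or_eq_genericPoint_of_flat p hy ha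
  obtain ⟨z, hz, hzη⟩ := hi (e i) (he i)
  have := (H i).isProper_flat.1
  refine ⟨i, GeomFibration.ProjSp.image_properTransform_eq_univ _ rfl (U i) D y hyD
    (hyx.mem_open (U i).isOpen (Set.mem_iInter.1 hxU i)) z ?_ hzη⟩
  rw [hz, Scheme.Hom.comp_apply]
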